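/- **Setting.** Let $n\in\{2,3\}$, let $\Omega\subset\mathbb R^n$ be a bounded Lipschitz domain, $\Gamma_{\rm Dir}$ a relatively open subset of $\partial\Omega$, $\mathrm m>\frac n2$, and $T,\mu,\nu>0$. Let $\mathbb M_{\rm sym}\supset\mathbb M_{\rm D}$ be the spaces of symmetric $n\times n$ matrices and of symmetric matrices with null trace, with the product $A:B$, and let $\mathrm E(u)=\frac12(\nabla u+\nabla u^T)$. Let $H^1_{\rm Dir}(\Omega;\mathbb R^n)$ be the space of $u\in H^1(\Omega;\mathbb R^n)$ with null trace on $\Gamma_{\rm Dir}$, let $$a_{\mathrm m}(z_1,z_2)=\int_\Omega\int_\Omega\frac{(\nabla z_1(x)-\nabla z_1(y))\cdot(\nabla z_2(x)-\nabla z_2(y))}{|x-y|^{n+2(\mathrm m-1)}}\,dx\,dy,$$ and let $H^{\mathrm m}(\Omega)$ be the Hilbert space of those $z\in H^1(\Omega)$ with $a_{\mathrm m}(z,z)<\infty$, with scalar product $\int_\Omega z_1z_2\,dx+a_{\mathrm m}(z_1,z_2)$ (it embeds into $\mathrm C^0(\overline\Omega)$). Set $\mathbf Q=H^1_{\rm Dir}(\Omega;\mathbb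 R^n)\times H^{\mathrm m}(\Omega)\times L^2(\Omega;\mathbb M_{\rm D})$, with elements $q=(u,z,p)$. The data are as follows. * $\mathbb C\in \mathrm C^{1,1}([0,\infty);\mathrm{Lin}(\mathbb M_{\rm sym};\mathbb M_{\rm sym}))$, with $z\mapsto\mathbb C(z)\xi:\xi$ nondecreasing and $\gamma_1|\xi|^2\le\mathbb C(z)\xi:\xi\le\gamma_2|\xi|^2$ for all $z\ge 0$ and $\xi\in\mathbb M_{\rm sym}$, for some $\gamma_1,\gamma_2>0$. * $\mathbb D\in \mathrm C^0(\overline\Omega;\mathrm{Lin}(\mathbb M_{\rm sym};\mathbb M_{\rm sym}))$ symmetric, with $\delta_1|A|^2\le\mathbb D(x)A:A\le\delta_2|A|^2$ for all $x\in\Omega$ and $A\in\mathbb M_{\rm sym}$, for some $\delta_1,\delta_2>0$. * $W\in \mathrm C^2((0,\infty);[0,\infty))$ with $s^{2n}W(s)\to+\infty$ as $s\to0^+$, extended by $+\infty$ to $(-\infty,0]$; and a constant $\kappa\ge0$. * $K(z)\subset\mathbb M_{\rm D}$ ($z\ge0$) closed and convex, with $B_{\bar r}(0)\subset K(z_1)\subset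 K(z_2)\subset B_{\bar R}(0)$ for $0\le z_1\le z_2$ and Hausdorff distance $d(K(z_1),K(z_2))\le C_K|z_1-z_2|$, for some $0<\bar r<\bar R$ and $C_K>0$. * $w\in H^1(0,T;H^1(\Omega;\mathbb R^n))$ and $F\in H^1(0,T;H^1(\Omega;\mathbb R^n)^*)$. The energy is, with $e=\mathrm E(u+w(t))-p$, $$\mathcal E_\mu(t,u,z,p)=\int_\Omega\tfrac12\mathbb C(z)e:e\,dx+\int_\Omega\big(W(z)+\tfrac\mu2|p|^2\big)dx+\tfrac12a_{\mathrm m}(z,z)-\langle F(t),u+w(t)\rangle .$$ It is Fréchet differentiable in $q$ on the set where $z>0$ in $\overline\Omega$, with differential $\mathrm D_q\mathcal E_\mu=(\mathrm D_u\mathcal E_\mu,\mathrm D_z\mathcal E_\mu,\mathrm D_p\mathcal E_\mu)$. Let $\mathcal H(z,\pi)=\int_\Omega\sup_{\sigma\in K(z(x))}\sigma:\pi(x)\,dx$ for $\pi\in L^2(\Omega;\mathbb M_{\rm D})$; for $\zeta\in H^{\mathrm m}(\Omega)$ let $\mathcal R(\zeta)=\int_\Omega(-\kappa\zeta)\,dx$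 if $\zeta\le0$ a.e. and $\mathcal R(\zeta)=+\infty$ otherwise; the convex subdifferentials $\partial\mathcal R(0)\subset H^{\mathrm m}(\Omega)^*$ and $\partial_\pi\mathcal H(z,0)\subset L^2(\Omega;\mathbb M_{\rm D})$ are taken in these spaces. Let $\|u\|_{H^1,\mathbb D}^2=\int_\Omega\mathbb D\,\mathrm E(u):\mathrm E(u)\,dx$ on $H^1_{\rm Dir}(\Omega;\mathbb R^n)$, with dual norm $\|\cdot\|_{(H^1,\mathbb D)^*}$; let $d_{L^2}$ be the $L^2$-distance and let $\widetilde d_{L^2}(\chi,\partial\mathcal R(0))\in[0,\infty]$ be the infimum of $\|\chi-\gamma\|_{L^2}$ over the $\gamma\in\partial\mathcal R(0)$ with $\chi-\gamma\in L^2(\Omega)$. Put $$\mathcal D_\nu(q')=\sqrt{\nu\|u'\|_{H^1,\mathbb D}^2+\|z'\|_{L^2}^2+\nu\|p'\|_{L^2}^2},$$ $$\mathcal D^{*,\mu}_\nu(t,q)=\sqrt{\tfrac1\nu\|{-}\mathrm D_u\mathcal E_\mu\|^2_{(H^1,\mathbb D)^*}+\widetilde d_{L^2}({-}\mathrm D_z\mathcal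 E_\mu,\partial\mathcal R(0))^2+\tfrac1\nu d_{L^2}({-}\mathrm D_p\mathcal E_\mu,\partial_\pi\mathcal H(z,0))^2}$$ (with $\mathrm D_u\mathcal E_\mu,\mathrm D_z\mathcal E_\mu,\mathrm D_p\mathcal E_\mu$ taken at $(t,q)$), and for $t'\ge0$ $$\mathcal M^\mu_{0,\nu}(t,q,t',q')=\mathcal R(z')+\mathcal H(z,p')+\mathcal M^{\mu,\rm red}_{0,\nu}(t,q,t',q').$$ Here, if $t'>0$, $\mathcal M^{\mu,\rm red}_{0,\nu}=0$ when $-\mathrm D_u\mathcal E_\mu(t,q)=0$, $-\mathrm D_z\mathcal E_\mu(t,q)\in\partial\mathcal R(0)$ and $-\mathrm D_p\mathcal E_\mu(t,q)\in\partial_\pi\mathcal H(z,0)$, and $\mathcal M^{\mu,\rm red}_{0,\nu}=+\infty$ otherwise; if $t'=0$, $\mathcal M^{\mu,\rm red}_{0,\nu}=\mathcal D_\nu(q')\,\mathcal D_\nu^{*,\mu}(t,q)$, with $0\cdot\infty=\infty$. **Proposition.** Let $S>0$ and let $(\mathsf t,\mathsf q)=(\mathsf t,\mathsf u,\mathsf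 z,\mathsf p)\in \mathrm{AC}([0,S];[0,T]\times\mathbf Q)$ be a curve with $\mathsf t$ nondecreasing and $\mathsf z(s)>0$ in $\overline\Omega$ for every $s\in[0,S]$. The following properties are equivalent. 1. $(\mathsf t,\mathsf q)$ is a parameterized Balanced Viscosity solution to the rate-independent system with hardening, that is, for every $s\in[0,S]$ $$\mathcal E_\mu(\mathsf t(s),\mathsf q(s))+\int_0^s\mathcal M^\mu_{0,\nu}(\mathsf t,\mathsf q,\mathsf t',\mathsf q')\,d\tau=\mathcal E_\mu(\mathsf t(0),\mathsf q(0))+\int_0^s\partial_t\mathcal E_\mu(\mathsf t,\mathsf q)\,\mathsf t'\,d\tau .$$ 2. $(\mathsf t,\mathsf q)$ satisfies the upper energy-dissipation estimate on $[0,S]$: $$\mathcal E_\mu(\mathsf t(S),\mathsf q(S))+\int_0^S\mathcal M^\mu_{0,\nu}(\mathsf t,\mathsf q,\mathsf t',\mathsf q')\,d\tau\le\mathcal E_\mu(\mathsf t(0),\mathsf q(0))+\int_0^S\partial_t\mathcal E_\mu(\mathsf t,\mathsf q)\,\mathsf t'\,d\tau .$$ 3. $(\mathsf t,\mathsf q)$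 satisfies the contact condition $$\mathcal M^\mu_{0,\nu}(\mathsf t(s),\mathsf q(s),\mathsf t'(s),\mathsf q'(s))=\langle-\mathrm D_q\mathcal E_\mu(\mathsf t(s),\mathsf q(s)),\mathsf q'(s)\rangle_{\mathbf Q}\quad\text{for a.a. } s\in(0,S).$$ -/

import Mathlib

open MeasureTheory Set Filter Topology
open scoped ENNReal ContDiff

noncomputable section

namespace PlasticDamage

/-! ### Vectors and matrices -/

/-- The Euclidean space `ℝⁿ`. -/
abbrev Vec (n : ℕ) : Type := EuclideanSpace ℝ (Fin n)

/-- Real `n × n` matrices with the Frobenius scalar product `A : B = ∑ i j, A i j * B i j`. -/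
abbrev Mat (n : ℕ) : Type := EuclideanSpace ℝ (Fin n × Fin n)

/-- The subspace of symmetric matrices. -/
def symSub (n : ℕ) : Submodule ℝ (Mat n) where
  carrier := {A | ∀ i j, A (i, j) = A (j, i)}
  add_mem' := by
    intro A B hA hB i j
    simp [hA i j, hB i j]
  zero_mem' := by
    intro i j
    simp
  smul_mem' := by
    intro c A hA i j
    simp [hA i j]

/-- The subspace of deviatoric matrices: symmetric with null trace. -/
def devSub (n : ℕ) : Submodule ℝ (Mat n) where
  carrier := {A | (∀ i j, A (i, j) = A (j, i)) ∧ ∑ i, A (i, i) = 0}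
  add_mem' := by
    rintro A B ⟨hA, hA'⟩ ⟨hB, hB'⟩
    refine ⟨fun i j => by simp [hA i j, hB i j], ?_⟩
    simp [Finset.sum_add_distrib, hA', hB']
  zero_mem' := ⟨fun i j => by simp, by simp⟩
  smul_mem' := by
    rintro c A ⟨hA, hA'⟩
    refine ⟨fun i j => by simp [hA i j], ?_⟩
    simp [← Finset.mul_sum, hA']

theorem devSub_le_symSub (n : ℕ) : devSub n ≤ symSub n := fun _ hA => hA.1

/-- The Euclidean space of symmetric matrices. -/
def SymMat (n : ℕ) : Type := symSub n

/-- The Euclidean space of deviatoric matrices. -/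
def DevMat (n : ℕ) : Type := devSub n

instance (n : ℕ) : NormedAddCommGroup (SymMat n) := inferInstanceAs (NormedAddCommGroup (symSub n))

instance (n : ℕ) : InnerProductSpace ℝ (SymMat n) :=
  inferInstanceAs (InnerProductSpace ℝ (symSub n))

instance (n : ℕ) : FiniteDimensional ℝ (SymMat n) :=
  inferInstanceAs (FiniteDimensional ℝ (symSub n))

instance (n : ℕ) : NormedAddCommGroup (DevMat n) := inferInstanceAs (NormedAddCommGroup (devSub n))

instance (n : ℕ) : InnerProductSpace ℝ (DevMat n) :=
  inferInstanceAs (InnerProductSpace ℝ (devSub n))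

instance (n : ℕ) : FiniteDimensional ℝ (DevMat n) :=
  inferInstanceAs (FiniteDimensional ℝ (devSub n))

/-- A deviatoric matrix, regarded as a symmetric one. -/
def devToSym {n : ℕ} (A : DevMat n) : SymMat n := Submodule.inclusion (devSub_le_symSub n) A

/-- The symmetric part `(A + Aᵀ) / 2` of a matrix. -/
def symPart {n : ℕ} (A : Mat n) : SymMat n :=
  (⟨WithLp.toLp 2 fun ij => (A ij + A ij.swap) / 2, by
    intro i j
    simp [add_comm]⟩ : symSub n)

/-! ### Function spaces -/

/-- `Ω` is a bounded Lipschitz domain: bounded, open, connected, and near each boundary point it is,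
in suitable orthonormal coordinates, the set of points lying above the graph of a Lipschitz function. -/
structure IsBoundedLipschitzDomain {n : ℕ} (Ω : Set (Vec n)) : Prop where
  isOpen : IsOpen Ω
  isConnected : IsConnected Ω
  isBounded : Bornology.IsBounded Ω
  lipschitz_boundary : ∀ x₀ ∈ frontier Ω, ∃ (e : Vec n) (g : Vec n → ℝ) (L : NNReal) (r : ℝ),
    ‖e‖ = 1 ∧ LipschitzWith L g ∧ 0 < r ∧
      ∀ x ∈ Metric.ball x₀ r, (x ∈ Ω ↔ g (x - inner ℝ e x • e) < inner ℝ e x)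

/-- `φ` is a smooth real function with compact support in `ℝⁿ`. -/
def IsTestFun {n : ℕ} (φ : Vec n → ℝ) : Prop := ContDiff ℝ ∞ φ ∧ HasCompactSupport φ

/-- The partial derivative `∂φ/∂x_j`. -/
def pd {n : ℕ} (φ : Vec n → ℝ) (j : Fin n) (x : Vec n) : ℝ :=
  fderiv ℝ φ x (EuclideanSpace.single j 1)

/-- On `Ω`, the function `g` is the weak `j`-th partial derivative of `v`
(used for square integrable `v` and `g` only). -/
def IsWeakPd {n : ℕ} (Ω : Set (Vec n)) (j : Fin n) (v g : Vec n → ℝ) : Prop :=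
  ∀ φ : Vec n → ℝ, IsTestFun φ → tsupport φ ⊆ Ω →
    ∫ x in Ω, v x * pd φ j x = - ∫ x in Ω, g x * φ x

theorem IsTestFun.memLp {n : ℕ} {φ : Vec n → ℝ} (h : IsTestFun φ) (Ω : Set (Vec n)) :
    MemLp φ 2 (volume.restrict Ω) :=
  (h.1.continuous.memLp_of_hasCompactSupport h.2).restrict Ω

theorem IsTestFun.memLp_pd {n : ℕ} {φ : Vec n → ℝ} (h : IsTestFun φ) (j : Fin n)
    (Ω : Set (Vec n)) : MemLp (pd φ j) 2 (volume.restrict Ω) := by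
  refine (Continuous.memLp_of_hasCompactSupport ?_ ?_).restrict Ω
  · exact (h.1.continuous_fderiv (by simp)).clm_apply continuous_const
  · exact h.2.fderiv_apply ℝ _

theorem IsWeakPd.add {n : ℕ} {Ω : Set (Vec n)} {j : Fin n} {v g v' g' : Vec n → ℝ}
    (hv : MemLp v 2 (volume.restrict Ω)) (hg : MemLp g 2 (volume.restrict Ω))
    (hv' : MemLp v' 2 (volume.restrict Ω)) (hg' : MemLp g' 2 (volume.restrict Ω))
    (h : IsWeakPd Ω j v g) (h' : IsWeakPd Ω j v' g') :
    IsWeakPd Ω j (fun x => v x + v' x) (fun x => g x + g' x) := by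
  intro φ hφ hs
  have e := h φ hφ hs
  have e' := h' φ hφ hs
  have i1 : Integrable (fun x => v x * pd φ j x) (volume.restrict Ω) :=
    hv.integrable_mul (hφ.memLp_pd j Ω)
  have i2 : Integrable (fun x => v' x * pd φ j x) (volume.restrict Ω) :=
    hv'.integrable_mul (hφ.memLp_pd j Ω)
  have i3 : Integrable (fun x => g x * φ x) (volume.restrict Ω) :=
    hg.integrable_mul (hφ.memLp Ω)
  have i4 : Integrable (fun x => g' x * φ x) (volume.restrict Ω) :=
    hg'.integrable_mul (hφ.memLp Ω)
  simp only [add_mul]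
  rw [integral_add i1 i2, integral_add i3 i4, e, e']
  ring

theorem IsWeakPd.smul {n : ℕ} {Ω : Set (Vec n)} {j : Fin n} {v g : Vec n → ℝ} (c : ℝ)
    (h : IsWeakPd Ω j v g) : IsWeakPd Ω j (fun x => c * v x) (fun x => c * g x) := by
  intro φ hφ hs
  simp only [mul_assoc]
  rw [integral_const_mul, integral_const_mul, h φ hφ hs]
  ring

theorem IsWeakPd.zero {n : ℕ} {Ω : Set (Vec n)} {j : Fin n} :
    IsWeakPd Ω j (fun _ => 0) (fun _ => 0) := by
  intro φ _ _
  simp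

theorem IsWeakPd.congr {n : ℕ} {Ω : Set (Vec n)} {j : Fin n} {v g v' g' : Vec n → ℝ}
    (h : IsWeakPd Ω j v g) (hv : v' =ᵐ[volume.restrict Ω] v)
    (hg : g' =ᵐ[volume.restrict Ω] g) : IsWeakPd Ω j v' g' := by
  intro φ hφ hs
  have e1 : ∫ x in Ω, v' x * pd φ j x = ∫ x in Ω, v x * pd φ j x :=
    integral_congr_ae (hv.mono fun x hx => by simp only [hx])
  have e2 : ∫ x in Ω, g' x * φ x = ∫ x in Ω, g x * φ x :=
    integral_congr_ae (hg.mono fun x hx => by simp only [hx])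
  rw [e1, e2, h φ hφ hs]

/-- Coordinates of square integrable functions are square integrable. -/
theorem memLp_coord {X : Type*} [MeasurableSpace X] {ρ : Measure X} {ι : Type*} [Fintype ι]
    (u : Lp (EuclideanSpace ℝ ι) 2 ρ) (i : ι) : MemLp (fun x => u x i) 2 ρ :=
  (EuclideanSpace.proj (𝕜 := ℝ) i).comp_memLp' (Lp.memLp u)

/-- The Sobolev space `H¹(Ω;ℝⁿ)`, consisting of the pairs `(u, ∇u)` with `u` and its weak gradient in
`L²(Ω)`, where `(∇u) (i, j) = ∂u_i/∂x_j`; the norm is `(‖u‖² + ‖∇u‖²)^(1/2)`. -/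
def H1 {n : ℕ} (Ω : Set (Vec n)) : Submodule ℝ
    (WithLp 2 (Lp (Vec n) 2 (volume.restrict Ω) × Lp (Mat n) 2 (volume.restrict Ω))) where
  carrier := {u | ∀ i j, IsWeakPd Ω j (fun x => u.fst x i) (fun x => u.snd x (i, j))}
  add_mem' := by
    intro u v hu hv i j
    refine ((hu i j).add (memLp_coord _ _) (memLp_coord _ _) (memLp_coord _ _)
      (memLp_coord _ _) (hv i j)).congr ?_ ?_
    · filter_upwards [Lp.coeFn_add u.fst v.fst] with x hx
      simp only [WithLp.add_fst, hx, Pi.add_apply, PiLp.add_apply]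
    · filter_upwards [Lp.coeFn_add u.snd v.snd] with x hx
      simp only [WithLp.add_snd, hx, Pi.add_apply, PiLp.add_apply]
  zero_mem' := by
    intro i j
    refine IsWeakPd.zero.congr ?_ ?_
    · filter_upwards [Lp.coeFn_zero (Vec n) 2 (volume.restrict Ω)] with x hx
      simp only [WithLp.zero_fst, hx, Pi.zero_apply, PiLp.zero_apply]
    · filter_upwards [Lp.coeFn_zero (Mat n) 2 (volume.restrict Ω)] with x hx
      simp only [WithLp.zero_snd, hx, Pi.zero_apply, PiLp.zero_apply]
  smul_mem' := by
    intro c u hu i j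
    refine ((hu i j).smul c).congr ?_ ?_
    · filter_upwards [Lp.coeFn_smul c u.fst] with x hx
      simp only [WithLp.smul_fst, hx, Pi.smul_apply, PiLp.smul_apply, smul_eq_mul]
    · filter_upwards [Lp.coeFn_smul c u.snd] with x hx
      simp only [WithLp.smul_snd, hx, Pi.smul_apply, PiLp.smul_apply, smul_eq_mul]

/-- The linearized strain `E(u) = (∇u + ∇uᵀ)/2` of `u ∈ H¹(Ω;ℝⁿ)`. -/
def strain {n : ℕ} {Ω : Set (Vec n)} (u : H1 Ω) (x : Vec n) : SymMat n := symPart (u.1.snd x)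

/-- The `(n-1)`-dimensional Hausdorff measure on `Γ`. -/
def surfaceMeasure {n : ℕ} (Γ : Set (Vec n)) : Measure (Vec n) :=
  (Measure.hausdorffMeasure ((n : ℝ) - 1)).restrict Γ

/-- The pairs `(φ|_Ω, φ|_Γ)` in `H¹(Ω;ℝⁿ) × L²(Γ;ℝⁿ)`, with `φ` smooth on `ℝⁿ` and compactly
supported. -/
def smoothTraces {n : ℕ} (Ω Γ : Set (Vec n)) :
    Submodule ℝ (H1 Ω × Lp (Vec n) 2 (surfaceMeasure Γ)) where
  carrier := {v | ∃ φ : Vec n → Vec n, ContDiff ℝ ∞ φ ∧ HasCompactSupport φ ∧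
    (v.1.1.fst : Vec n → Vec n) =ᵐ[volume.restrict Ω] φ ∧
    (v.2 : Vec n → Vec n) =ᵐ[surfaceMeasure Γ] φ}
  add_mem' := by
    rintro v v' ⟨φ, h1, h2, h3, h4⟩ ⟨φ', h1', h2', h3', h4'⟩
    refine ⟨φ + φ', h1.add h1', h2.add h2', ?_, ?_⟩
    · filter_upwards [Lp.coeFn_add v.1.1.fst v'.1.1.fst, h3, h3'] with x hx a b
      simp only [Prod.fst_add, Submodule.coe_add, WithLp.add_fst, hx, Pi.add_apply, a, b]
    · filter_upwards [Lp.coeFn_add v.2 v'.2, h4, h4'] with x hx a b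
      simp only [Prod.snd_add, hx, Pi.add_apply, a, b]
  zero_mem' := by
    refine ⟨0, contDiff_const, HasCompactSupport.zero, ?_, ?_⟩
    · exact Lp.coeFn_zero (Vec n) 2 (volume.restrict Ω)
    · exact Lp.coeFn_zero (Vec n) 2 (surfaceMeasure Γ)
  smul_mem' := by
    rintro c v ⟨φ, h1, h2, h3, h4⟩
    refine ⟨c • φ, contDiff_const.smul h1, h2.smul_left (f := fun _ => c), ?_, ?_⟩
    · filter_upwards [Lp.coeFn_smul c v.1.1.fst, h3] with x hx a
      simp only [Prod.smul_fst, Submodule.coe_smul, WithLp.smul_fst, hx, Pi.smul_apply, a]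
    · filter_upwards [Lp.coeFn_smul c v.2, h4] with x hx a
      simp only [Prod.smul_snd, hx, Pi.smul_apply, a]

/-- `H¹_Dir(Ω;ℝⁿ)`, the functions in `H¹(Ω;ℝⁿ)` with null trace on `Γ`.  The graph of the trace operator
`H¹(Ω;ℝⁿ) → L²(Γ;ℝⁿ)` is the closure of its restriction to smooth functions. -/
def H1Dir {n : ℕ} (Ω Γ : Set (Vec n)) : Submodule ℝ (H1 Ω) :=
  (smoothTraces Ω Γ).topologicalClosure.comap
    (LinearMap.inl ℝ (H1 Ω) (Lp (Vec n) 2 (surfaceMeasure Γ)))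

/-- The function `(x, y) ↦ (ζ(x) - ζ(y)) / |x - y|^(n/2 + m - 1)`. -/
def quot {n : ℕ} (m : ℝ) (ζ : Vec n → Vec n) (xy : Vec n × Vec n) : Vec n :=
  (‖xy.1 - xy.2‖ ^ ((n : ℝ) / 2 + m - 1))⁻¹ • (ζ xy.1 - ζ xy.2)

/-- The fractional Sobolev space `H^m(Ω)`: the functions `z` in `L²(Ω)` with weak gradient in
`L²(Ω;ℝⁿ)` and with finite seminorm
`∫_Ω ∫_Ω |∇z(x) - ∇z(y)|² / |x - y|^(n + 2(m - 1)) dx dy`.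
The element `z` is stored with the difference quotient of its gradient, an element of
`L²(Ω×Ω;ℝⁿ)`; the scalar product is thus
`∫_Ω z₁ z₂ dx + ∫_Ω ∫_Ω (∇z₁(x) - ∇z₁(y)) · (∇z₂(x) - ∇z₂(y)) / |x - y|^(n + 2(m - 1)) dx dy`. -/
def Hm {n : ℕ} (Ω : Set (Vec n)) (m : ℝ) : Submodule ℝ
    (WithLp 2 (Lp ℝ 2 (volume.restrict Ω) ×
      Lp (Vec n) 2 ((volume.restrict Ω).prod (volume.restrict Ω)))) where
  carrier := {z | ∃ ζ : Lp (Vec n) 2 (volume.restrict Ω),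
    (∀ j, IsWeakPd Ω j (fun x => z.fst x) (fun x => ζ x j)) ∧
    (z.snd : Vec n × Vec n → Vec n)
      =ᵐ[(volume.restrict Ω).prod (volume.restrict Ω)] quot m ζ}
  add_mem' := by
    rintro z z' ⟨ζ, h, hq⟩ ⟨ζ', h', hq'⟩
    refine ⟨ζ + ζ', fun j => ?_, ?_⟩
    · refine ((h j).add (Lp.memLp _) (memLp_coord _ _) (Lp.memLp _)
        (memLp_coord _ _) (h' j)).congr ?_ ?_
      · filter_upwards [Lp.coeFn_add z.fst z'.fst] with x hx
        simp only [WithLp.add_fst, hx, Pi.add_apply]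
      · filter_upwards [Lp.coeFn_add ζ ζ'] with x hx
        simp only [hx, Pi.add_apply, PiLp.add_apply]
    · have ha := Lp.coeFn_add ζ ζ'
      filter_upwards [Lp.coeFn_add z.snd z'.snd, hq, hq',
        Measure.quasiMeasurePreserving_fst.ae_eq_comp ha,
        Measure.quasiMeasurePreserving_snd.ae_eq_comp ha] with xy h1 h2 h3 h4 h5
      simp only [Function.comp_apply, Pi.add_apply] at h1 h4 h5
      simp only [WithLp.add_snd, h1, h2, h3, quot, h4, h5]
      rw [← smul_add]
      congr 1
      abel
  zero_mem' := by
    refine ⟨0, fun j => ?_, ?_⟩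
    · refine IsWeakPd.zero.congr ?_ ?_
      · filter_upwards [Lp.coeFn_zero ℝ 2 (volume.restrict Ω)] with x hx
        simp only [WithLp.zero_fst, hx, Pi.zero_apply]
      · filter_upwards [Lp.coeFn_zero (Vec n) 2 (volume.restrict Ω)] with x hx
        simp only [hx, Pi.zero_apply, PiLp.zero_apply]
    · have ha := Lp.coeFn_zero (Vec n) 2 (volume.restrict Ω)
      filter_upwards [Lp.coeFn_zero (Vec n) 2 ((volume.restrict Ω).prod (volume.restrict Ω)),
        Measure.quasiMeasurePreserving_fst.ae_eq_comp ha,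
        Measure.quasiMeasurePreserving_snd.ae_eq_comp ha] with xy h1 h4 h5
      simp only [Function.comp_apply, Pi.zero_apply] at h1 h4 h5
      simp only [WithLp.zero_snd, h1, quot, h4, h5, sub_zero, smul_zero]
  smul_mem' := by
    rintro c z ⟨ζ, h, hq⟩
    refine ⟨c • ζ, fun j => ?_, ?_⟩
    · refine ((h j).smul c).congr ?_ ?_
      · filter_upwards [Lp.coeFn_smul c z.fst] with x hx
        simp only [WithLp.smul_fst, hx, Pi.smul_apply, smul_eq_mul]
      · filter_upwards [Lp.coeFn_smul c ζ] with x hx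
        simp only [hx, Pi.smul_apply, PiLp.smul_apply, smul_eq_mul]
    · have ha := Lp.coeFn_smul c ζ
      filter_upwards [Lp.coeFn_smul c z.snd, hq,
        Measure.quasiMeasurePreserving_fst.ae_eq_comp ha,
        Measure.quasiMeasurePreserving_snd.ae_eq_comp ha] with xy h1 h2 h4 h5
      simp only [Function.comp_apply, Pi.smul_apply] at h1 h4 h5
      simp only [WithLp.smul_snd, h1, h2, quot, h4, h5]
      rw [← smul_sub, smul_comm]

/-- The function underlying an element of `H^m(Ω)`. -/
def damageFn {n : ℕ} {Ω : Set (Vec n)} {m : ℝ} (z : Hm Ω m) : Lp ℝ 2 (volume.restrict Ω) := z.1.fst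

/-- The bilinear form `a_m` of `H^m(Ω)`,
`∫_Ω ∫_Ω (∇z₁(x) - ∇z₁(y)) · (∇z₂(x) - ∇z₂(y)) / |x - y|^(n + 2(m - 1)) dx dy`. -/
def am {n : ℕ} {Ω : Set (Vec n)} {m : ℝ} (z₁ z₂ : Hm Ω m) : ℝ := inner ℝ z₁.1.snd z₂.1.snd

/-- `v ∈ H¹(0,T;X)`: there is `v' ∈ L²(0,T;X)` with `v(t) = v(0) + ∫₀ᵗ v'` on `[0,T]`. -/
def IsH1InTime {X : Type*} [NormedAddCommGroup X] [NormedSpace ℝ X] (T : ℝ) (v : ℝ → X) : Prop :=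
  ∃ v' : ℝ → X, MemLp v' 2 (volume.restrict (Ioc 0 T)) ∧
    ∀ t ∈ Icc 0 T, v t = v 0 + ∫ τ in (0 : ℝ)..t, v' τ

/-- The convex analysis subdifferential of a proper function `f : X → (-∞,∞]` at a point `x` of its
domain. -/
def subdiff {X : Type*} [NormedAddCommGroup X] [NormedSpace ℝ X] (f : X → EReal) (x : X) :
    Set (StrongDual ℝ X) :=
  {ξ | ∀ y, f x + ((ξ (y - x) : ℝ) : EReal) ≤ f y}

/-! ### The model -/

/-- The data of the model. -/
structure Model (n : ℕ) where
  /-- the reference configuration -/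
  Ω : Set (Vec n)
  /-- the Dirichlet part of the boundary -/
  ΓD : Set (Vec n)
  /-- the order of the Sobolev space of the damage variable -/
  m : ℝ
  /-- the final time -/
  T : ℝ
  /-- the elastic tensor, as a function of the damage variable in `[0,∞)` -/
  C : ℝ → (SymMat n →L[ℝ] SymMat n)
  /-- the viscosity tensor, on the closure of `Ω` -/
  D : Vec n → (SymMat n →L[ℝ] SymMat n)
  /-- the damage energy density, on `(0,∞)` -/
  W : ℝ → ℝ
  /-- the constant of the damage dissipation potential -/
  κ : ℝ
  /-- the constraint sets of the plastic flow rule, for damage values in `[0,∞)` -/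
  K : ℝ → Set (DevMat n)
  /-- the Dirichlet loading -/
  w : ℝ → H1 Ω
  /-- the total load -/
  F : ℝ → StrongDual ℝ (H1 Ω)
  /-- the hardening parameter -/
  μ : ℝ
  /-- the rate parameter -/
  ν : ℝ

namespace Model

variable {n : ℕ} (P : Model n)

/-- Lebesgue measure on `Ω`. -/
abbrev vol : Measure (Vec n) := volume.restrict P.Ω

/-- The state space `Q = H¹_Dir(Ω;ℝⁿ) × H^m(Ω) × L²(Ω;M_D)`; its elements are `q = (u, z, p)`. -/
abbrev State : Type := H1Dir P.Ω P.ΓD × Hm P.Ω P.m × Lp (DevMat n) 2 P.vol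

/-- The standing assumptions on the data. -/
structure Standing : Prop where
  dim : n = 2 ∨ n = 3
  domain : IsBoundedLipschitzDomain P.Ω
  dirichlet : ∃ U, IsOpen U ∧ P.ΓD = U ∩ frontier P.Ω
  order : (n : ℝ) / 2 < P.m
  time_pos : 0 < P.T
  /-- `C` is of class `C^{1,1}` on `[0,∞)` -/
  elastic_smooth : ∃ (C' : ℝ → (SymMat n →L[ℝ] SymMat n)) (L : NNReal),
    (∀ z ∈ Ici (0 : ℝ), HasDerivWithinAt P.C (C' z) (Ici 0) z) ∧ LipschitzOnWith L C' (Ici 0)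
  elastic_mono : ∀ ξ : SymMat n, MonotoneOn (fun z => inner ℝ (P.C z ξ) ξ) (Ici 0)
  elastic_coercive : ∃ γ₁ γ₂ : ℝ, 0 < γ₁ ∧ 0 < γ₂ ∧ ∀ z ∈ Ici (0 : ℝ), ∀ ξ : SymMat n,
    γ₁ * ‖ξ‖ ^ 2 ≤ inner ℝ (P.C z ξ) ξ ∧ inner ℝ (P.C z ξ) ξ ≤ γ₂ * ‖ξ‖ ^ 2
  visc_cont : ContinuousOn P.D (closure P.Ω)
  visc_symm : ∀ x ∈ closure P.Ω, ∀ A B : SymMat n, inner ℝ (P.D x A) B = inner ℝ A (P.D x B)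
  visc_coercive : ∃ δ₁ δ₂ : ℝ, 0 < δ₁ ∧ 0 < δ₂ ∧ ∀ x ∈ P.Ω, ∀ A : SymMat n,
    δ₁ * ‖A‖ ^ 2 ≤ inner ℝ (P.D x A) A ∧ inner ℝ (P.D x A) A ≤ δ₂ * ‖A‖ ^ 2
  W_smooth : ContDiffOn ℝ 2 P.W (Ioi 0)
  W_nonneg : ∀ s ∈ Ioi (0 : ℝ), 0 ≤ P.W s
  W_blowup : Tendsto (fun s => s ^ (2 * n) * P.W s) (𝓝[>] 0) atTop
  κ_nonneg : 0 ≤ P.κ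
  K_closed : ∀ z ∈ Ici (0 : ℝ), IsClosed (P.K z)
  K_convex : ∀ z ∈ Ici (0 : ℝ), Convex ℝ (P.K z)
  K_mono : ∃ r R : ℝ, 0 < r ∧ r < R ∧ ∀ z₁ z₂ : ℝ, 0 ≤ z₁ → z₁ ≤ z₂ →
    Metric.ball 0 r ⊆ P.K z₁ ∧ P.K z₁ ⊆ P.K z₂ ∧ P.K z₂ ⊆ Metric.ball 0 R
  K_lipschitz : ∃ CK : ℝ, 0 < CK ∧ ∀ z₁ ∈ Ici (0 : ℝ), ∀ z₂ ∈ Ici (0 : ℝ),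
    Metric.hausdorffDist (P.K z₁) (P.K z₂) ≤ CK * |z₁ - z₂|
  w_time : IsH1InTime P.T P.w
  F_time : IsH1InTime P.T P.F
  μ_pos : 0 < P.μ
  ν_pos : 0 < P.ν

/-! ### The energy -/

/-- The elastic part `E(u + w(t)) - p` of the strain. -/
def elasticStrain (t : ℝ) (q : P.State) (x : Vec n) : SymMat n :=
  strain (q.1.1 + P.w t) x - devToSym (q.2.2 x)

/-- The damage energy density, extended by `+∞` to the values `z ≤ 0`. -/
def Wext (s : ℝ) : ℝ≥0∞ := if 0 < s then ENNReal.ofReal (P.W s) else ⊤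

/-- The energy `∫_Ω ½ C(z) e : e dx + ∫_Ω (W(z) + (μ/2) |p|²) dx + ½ a_m(z,z) - ⟨F(t), u + w(t)⟩` with
`e = E(u + w(t)) - p`. -/
def energy (t : ℝ) (q : P.State) : EReal :=
  (((∫ x in P.Ω, inner ℝ (P.C (damageFn q.2.1 x) (P.elasticStrain t q x)) (P.elasticStrain t q x)) / 2
      + ∫ x in P.Ω, P.μ / 2 * ‖q.2.2 x‖ ^ 2)
    + am q.2.1 q.2.1 / 2 - P.F t (q.1.1 + P.w t) : ℝ)
  + ((∫⁻ x in P.Ω, P.Wext (damageFn q.2.1 x) : ℝ≥0∞) : EReal)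

/-- The domain of the energy: the states with `z > 0` in the closure of `Ω`.  As `Ω` is bounded and `z`
has a continuous representative on the closure of `Ω`, this says that `z` is bounded from below by
a positive constant. -/
def domain : Set P.State := {q | ∃ c > 0, ∀ᵐ x ∂P.vol, c ≤ damageFn q.2.1 x}

/-- The Fréchet differential `D_q E(t,q)`. -/
def DqE (t : ℝ) (q : P.State) : StrongDual ℝ P.State :=
  fderiv ℝ (fun q' : P.State => (P.energy t q').toReal) q

/-- The partial differential `D_u E(t,q)`. -/
def DuE (t : ℝ) (q : P.State) : StrongDual ℝ (H1Dir P.Ω P.ΓD) :=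
  (P.DqE t q).comp (ContinuousLinearMap.inl ℝ _ _)

/-- The partial differential `D_z E(t,q)`. -/
def DzE (t : ℝ) (q : P.State) : StrongDual ℝ (Hm P.Ω P.m) :=
  (P.DqE t q).comp ((ContinuousLinearMap.inr ℝ _ _).comp (ContinuousLinearMap.inl ℝ _ _))

/-- The partial differential `D_p E(t,q)`. -/
def DpE (t : ℝ) (q : P.State) : StrongDual ℝ (Lp (DevMat n) 2 P.vol) :=
  (P.DqE t q).comp ((ContinuousLinearMap.inr ℝ _ _).comp (ContinuousLinearMap.inr ℝ _ _))

/-- The partial time derivative `∂_t E(t,q)`. -/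
def dtE (t : ℝ) (q : P.State) : ℝ := deriv (fun t' : ℝ => (P.energy t' q).toReal) t

/-! ### The dissipation potentials -/

/-- The support function `H(z,π) = sup {σ : π | σ ∈ K(z)}` of the constraint set. -/
def H (z : ℝ) (π : DevMat n) : ℝ := sSup ((fun σ : DevMat n => (inner ℝ σ π : ℝ)) '' P.K z)

/-- The plastic dissipation potential `∫_Ω H(z,π) dx`. -/
def calH (z : Hm P.Ω P.m) (π : Lp (DevMat n) 2 P.vol) : ℝ := ∫ x in P.Ω, P.H (damageFn z x) (π x)

/-- The damage dissipation density: `-κ ζ` if `ζ ≤ 0`, and `+∞` otherwise. -/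
def R (ζ : ℝ) : ℝ≥0∞ := if ζ ≤ 0 then ENNReal.ofReal (-P.κ * ζ) else ⊤

/-- The damage dissipation potential `∫_Ω R(ζ) dx` on `H^m(Ω)`. -/
def calR (ζ : Hm P.Ω P.m) : ℝ≥0∞ := ∫⁻ x in P.Ω, P.R (damageFn ζ x)

/-- The subdifferential at `0` of the damage dissipation potential, a subset of `H^m(Ω)*`. -/
def subR0 : Set (StrongDual ℝ (Hm P.Ω P.m)) := subdiff (fun ζ => ((P.calR ζ : ℝ≥0∞) : EReal)) 0

/-- The subdifferential at `0` of the plastic dissipation potential, a subset of the dual of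
`L²(Ω;M_D)`. -/
def subH0 (z : Hm P.Ω P.m) : Set (StrongDual ℝ (Lp (DevMat n) 2 P.vol)) :=
  subdiff (fun π => ((P.calH z π : ℝ) : EReal)) 0

/-- The square of the norm `‖u‖_{H¹,D} = (∫_Ω D E(u) : E(u) dx)^(1/2)`. -/
def normDsq (u : H1Dir P.Ω P.ΓD) : ℝ := ∫ x in P.Ω, inner ℝ (P.D x (strain u.1 x)) (strain u.1 x)

/-- The norm on `H¹_Dir(Ω;ℝⁿ)*` dual to `‖·‖_{H¹,D}`. -/
def dualNormD (η : StrongDual ℝ (H1Dir P.Ω P.ΓD)) : ℝ≥0∞ :=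
  ⨆ (v : H1Dir P.Ω P.ΓD) (_ : P.normDsq v ≤ 1), ENNReal.ofReal (η v)

/-- The `L²(Ω)`-norm of a functional on `H^m(Ω)`: it is `‖b‖` if the functional is
`v ↦ ∫_Ω b v dx` for some `b ∈ L²(Ω)`, and `+∞` if there is no such `b`. -/
def L2norm (β : StrongDual ℝ (Hm P.Ω P.m)) : ℝ≥0∞ :=
  ⨅ (b : Lp ℝ 2 P.vol) (_ : ∀ v : Hm P.Ω P.m, β v = ∫ x in P.Ω, b x * damageFn v x), ‖b‖ₑ

/-- The `L²(Ω)`-distance, possibly `+∞`, of `χ ∈ H^m(Ω)*` from the subdifferential at `0` of the damage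
dissipation potential. -/
def distR (χ : StrongDual ℝ (Hm P.Ω P.m)) : ℝ≥0∞ := ⨅ γ ∈ P.subR0, P.L2norm (χ - γ)

/-- The `L²`-distance of `ξ` from the subdifferential at `0` of the plastic dissipation potential
(`L²(Ω;M_D)` is isometric to its dual). -/
def distH (z : Hm P.Ω P.m) (ξ : StrongDual ℝ (Lp (DevMat n) 2 P.vol)) : ℝ≥0∞ :=
  Metric.infEDist ξ (P.subH0 z)

/-! ### The vanishing-viscosity contact potential -/

/-- `D_ν(q') = (ν ‖u'‖²_{H¹,D} + ‖z'‖²_{L²} + ν ‖p'‖²_{L²})^(1/2)`. -/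
def Dnu (v : P.State) : ℝ :=
  Real.sqrt (P.ν * P.normDsq v.1 + ‖damageFn v.2.1‖ ^ 2 + P.ν * ‖v.2.2‖ ^ 2)

/-- `D_ν^*(t,q)`, the square root of
`(1/ν) ‖-D_u E‖² + dist(-D_z E, ∂R(0))² + (1/ν) dist(-D_p E, ∂_π H(z,0))²`. -/
def DnuStar (t : ℝ) (q : P.State) : ℝ≥0∞ :=
  ((ENNReal.ofReal P.ν)⁻¹ * P.dualNormD (-P.DuE t q) ^ 2
    + P.distR (-P.DzE t q) ^ 2
    + (ENNReal.ofReal P.ν)⁻¹ * P.distH q.2.1 (-P.DpE t q) ^ 2) ^ (1 / 2 : ℝ)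

open Classical in
/-- The reduced contact potential for rates `t' ≥ 0`.  If `t' > 0`, it is `0` at the states in equilibrium
and `+∞` elsewhere; if `t' = 0`, it is `D_ν(q') D_ν^*(t,q)`, which is `+∞` if `D_ν^*(t,q) = +∞`, also
where `D_ν(q') = 0`. -/
def Mred (t : ℝ) (q : P.State) (t' : ℝ) (q' : P.State) : ℝ≥0∞ :=
  if 0 < t' then
    if -P.DuE t q = 0 ∧ -P.DzE t q ∈ P.subR0 ∧ -P.DpE t q ∈ P.subH0 q.2.1 then 0 else ⊤
  else if P.DnuStar t q = ⊤ then ⊤ else ENNReal.ofReal (P.Dnu q') * P.DnuStar t q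

/-- The vanishing-viscosity contact potential. -/
def M (t : ℝ) (q : P.State) (t' : ℝ) (q' : P.State) : ℝ≥0∞ :=
  P.calR q'.2.1 + ENNReal.ofReal (P.calH q.2.1 q'.2.2) + P.Mred t q t' q'

/-! ### Parameterized curves -/

/-- `(t,q)` is a parameterized curve in `AC([0,S]; [0,T] × Q)` with `t` nondecreasing. -/
structure IsCurve (S : ℝ) (t : ℝ → ℝ) (q : ℝ → P.State) : Prop where
  ac_t : AbsolutelyContinuousOnInterval t 0 S
  ac_q : AbsolutelyContinuousOnInterval q 0 S
  mapsTo : MapsTo t (Icc 0 S) (Icc 0 P.T)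
  mono : MonotoneOn t (Icc 0 S)

/-- The dissipated energy `∫₀ˢ M(t,q,t',q') dτ`. -/
def dissipation (t : ℝ → ℝ) (q : ℝ → P.State) (s : ℝ) : ℝ≥0∞ :=
  ∫⁻ τ in Ioc 0 s, P.M (t τ) (q τ) (deriv t τ) (deriv q τ)

/-- The power `∂_t E(t,q) t'` of the external loads along the curve. -/
def power (t : ℝ → ℝ) (q : ℝ → P.State) (τ : ℝ) : ℝ := P.dtE (t τ) (q τ) * deriv t τ

/-- `(t,q)` is a (parameterized) Balanced Viscosity solution on `[0,S]` to the rate-independent system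
with hardening. -/
structure IsBVSolution (S : ℝ) (t : ℝ → ℝ) (q : ℝ → P.State) : Prop where
  curve : P.IsCurve S t q
  balance : ∀ s ∈ Icc 0 S, IntervalIntegrable (P.power t q) volume 0 s ∧
    P.energy (t s) (q s) + ((P.dissipation t q s : ℝ≥0∞) : EReal) =
      P.energy (t 0) (q 0) + ((∫ τ in (0 : ℝ)..s, P.power t q τ : ℝ) : EReal)

/-- The energy-dissipation upper estimate on `[0,S]`. -/
def UpperEstimate (S : ℝ) (t : ℝ → ℝ) (q : ℝ → P.State) : Prop :=
  IntervalIntegrable (P.power t q) volume 0 S ∧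
    P.energy (t S) (q S) + ((P.dissipation t q S : ℝ≥0∞) : EReal) ≤
      P.energy (t 0) (q 0) + ((∫ τ in (0 : ℝ)..S, P.power t q τ : ℝ) : EReal)

/-- The contact condition `M(t,q,t',q') = ⟨-D_q E(t,q), q'⟩` almost everywhere in `(0,S)`. -/
def ContactCondition (S : ℝ) (t : ℝ → ℝ) (q : ℝ → P.State) : Prop :=
  ∀ᵐ s ∂(volume.restrict (Ioo 0 S)),
    ((P.M (t s) (q s) (deriv t s) (deriv q s) : ℝ≥0∞) : EReal) =
      (((-P.DqE (t s) (q s)) (deriv q s) : ℝ) : EReal)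

end Model

end PlasticDamage

end

/-! Two facts give the equivalence. The chain rule: along the curve the energy is absolutely
continuous, and its increment over `[0,s]` is the integral of the power `∂_t E t'` plus that of
`⟨D_q E, q'⟩`. The contact inequality: `M(t,q,t',q') ≥ ⟨-D_q E(t,q), q'⟩` for all arguments.
Inserting the chain rule, the upper estimate says `∫ M ≤ ∫ ⟨-D_q E, q'⟩` on `(0,S)`, so the
pointwise inequality must be an equality almost everywhere, which is the contact condition.
Integrating that equality over `[0,s]` gives the balance at `s`, and the balance at `s = S` contains
the upper estimate. This is `tfae_energy_balance`.

The contact inequality (`Standing.ofReal_le_M`) splits `⟨-D_q E, q'⟩` into three pairings. Each is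
at most a dissipation potential, tested through an almost nearest subgradient, plus a distance times
a norm; a Cauchy-Schwarz inequality with weights `ν` and `1/ν` collects the remainders.

The chain rule (`chain_rule`, `Standing.energy_chain_rule`) needs three ingredients. (a) The energy
is `C¹` in the triple (boundary datum, load, state). As `m > n/2`, `H^m(Ω)` embeds into `L^∞(Ω)`
(`IsBoundedLipschitzDomain.exists_bound`), and on `L^∞` the superpositions `z ↦ C(z)` and `z ↦ W(z)`
are `C¹` near functions bounded away from `0` (`contDiffAt_superpos`); everything else is
multilinear and bounded. (b) Absolutely continuous curves in separable Hilbert spaces are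
differentiable almost everywhere (`ae_differentiableAt_of_absolutelyContinuous`). (c) The data `w`
and `F` are only `H¹` in time, and `t` may be constant on intervals where it sits at a bad time.
Since `t` is monotone, the data composed with `t` remain absolutely continuous, and almost
everywhere either the datum is differentiable at `t(s)` or `t'(s) = 0` (`IsH1InTime.along_curve`).

To deduce equality from equality of integrals, `M` must be measurable along the curve. The dual norm
and the distances are suprema or infima over uncountable families, but they are lower semicontinuous
along the curve, by weak compactness (`Standing.aemeasurable_M`). -/

noncomputable section

namespace PlasticDamage

/-! ### Absolutely continuous curves in Hilbert spaces -/

section Hilbert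

variable {E : Type*} [NormedAddCommGroup E] [InnerProductSpace ℝ E]

/-- Bounded families in a Hilbert space have weak limits along ultrafilters. -/
theorem exists_weak_limit [CompleteSpace E] {ι : Type*} (l : Ultrafilter ι) (x : ι → E) (M : ℝ)
    (hx : ∀ᶠ i in (l : Filter ι), ‖x i‖ ≤ M) :
    ∃ y : E, ‖y‖ ≤ M ∧ ∀ e : E, Tendsto (fun i => inner ℝ (x i) e) l (𝓝 (inner ℝ y e)) := by
  -- Banach-Alaoglu: through the Riesz isomorphism the family is carried into a weak-* compact ball,
  -- where every ultrafilter converges.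
  have hc := WeakDual.isCompact_closedBall (𝕜 := ℝ) (E := E) 0 M
  let g : ι → WeakDual ℝ E := fun i => StrongDual.toWeakDual (InnerProductSpace.toDual ℝ E (x i))
  obtain ⟨y, hy, hl⟩ := hc.ultrafilter_le_nhds (l.map g) (by
    simp only [Ultrafilter.coe_map, le_principal_iff, mem_map]
    filter_upwards [hx] with i hi
    simpa [g] using hi)
  refine ⟨(InnerProductSpace.toDual ℝ E).symm (WeakDual.toStrongDual y), ?_, fun e => ?_⟩
  · simpa using hy
  · have h1 : Tendsto g l (𝓝 y) := hl
    have h2 := (WeakBilin.eval_continuous (topDualPairing ℝ E) e).continuousAt.tendsto.comp h1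
    have h3 : inner ℝ ((InnerProductSpace.toDual ℝ E).symm (WeakDual.toStrongDual y)) e
      = topDualPairing ℝ E y e := by
      rw [InnerProductSpace.toDual_symm_apply]; rfl
    rw [h3]
    exact h2

/-- A map into a separable Hilbert space is measurable if its scalar products with a dense
sequence are. -/
theorem measurable_of_inner {X : Type*} [MeasurableSpace X] [MeasurableSpace E] [BorelSpace E]
    [SecondCountableTopology E] {e : ℕ → E} (he : DenseRange e) {f : X → E}
    (h : ∀ k, Measurable fun x => (inner ℝ (f x) (e k) : ℝ)) : Measurable f := by
  -- A closed ball is a countable intersection of half-spaces with normals `e k`. By density the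
  -- inequalities extend to all normals, in particular to `f x - y`. Open sets are countable unions
  -- of such balls.
  have key : ∀ y : E, ∀ r : ℝ, 0 ≤ r → MeasurableSet (f ⁻¹' Metric.closedBall y r) := by
    intro y r hr
    have hy : ∀ v : E, Measurable fun x => (inner ℝ (f x) v : ℝ) := by
      intro v
      obtain ⟨u, hu, hlim⟩ := mem_closure_iff_seq_limit.1 (he v)
      choose k hk using hu
      refine measurable_of_tendsto_metrizable (f := fun j x => (inner ℝ (f x) (u j) : ℝ)) (fun j => ?_) ?_
      · simpa [hk] using h (k j)
      · rw [tendsto_pi_nhds]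
        intro x
        exact (continuous_const.inner continuous_id).continuousAt.tendsto.comp hlim
    have : f ⁻¹' Metric.closedBall y r = ⋂ k, {x | (inner ℝ (f x) (e k) : ℝ) - inner ℝ y (e k) ≤ r * ‖e k‖} := by
      ext x
      simp only [mem_preimage, mem_closedBall_iff_norm, mem_iInter, mem_ofPred_eq]
      constructor
      · intro hx k
        rw [← inner_sub_left]
        exact (real_inner_le_norm _ _).trans (by gcongr)
      · intro hx
        have hall : ∀ v : E, (inner ℝ (f x - y) v : ℝ) ≤ r * ‖v‖ := by
          have hcl : IsClosed {v : E | (inner ℝ (f x - y) v : ℝ) ≤ r * ‖v‖} :=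
            isClosed_le (by fun_prop) (by fun_prop)
          intro v
          refine hcl.closure_subset_iff.2 ?_ (he v)
          rintro _ ⟨k, rfl⟩
          simpa [inner_sub_left] using hx k
        have := hall (f x - y)
        rw [real_inner_self_eq_norm_sq] at this
        by_contra hlt
        push Not at hlt
        nlinarith
    rw [this]
    exact MeasurableSet.iInter fun k => measurableSet_le ((hy _).sub_const _) measurable_const
  refine measurable_of_isOpen fun U hU => ?_
  have : f ⁻¹' U = ⋃ (k : ℕ) (j : ℕ) (_ : Metric.closedBall (e k) (1 / ((j : ℝ) + 1)) ⊆ U),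
      f ⁻¹' Metric.closedBall (e k) (1 / ((j : ℝ) + 1)) := by
    ext x
    simp only [mem_preimage, mem_iUnion, exists_prop]
    constructor
    · intro hx
      obtain ⟨ε, hε, hb⟩ := Metric.isOpen_iff.1 hU _ hx
      obtain ⟨j, hj⟩ := exists_nat_one_div_lt (half_pos hε)
      obtain ⟨k, hk⟩ := he.exists_dist_lt (f x) (show 0 < 1 / ((j : ℝ) + 1) by positivity)
      refine ⟨k, j, fun z hz => hb ?_, Metric.mem_closedBall.2 hk.le⟩
      rw [Metric.mem_closedBall] at hz
      rw [Metric.mem_ball]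
      calc dist z (f x) ≤ dist z (e k) + dist (f x) (e k) := dist_triangle_right _ _ _
        _ < ε := by linarith
    · rintro ⟨k, j, hsub, hx⟩
      exact hsub hx
  rw [this]
  exact MeasurableSet.iUnion fun k => MeasurableSet.iUnion fun j => MeasurableSet.iUnion fun _ =>
    key _ _ (by positivity)

theorem AbsolutelyContinuousOnInterval.comp_lipschitz {X Y : Type*} [PseudoMetricSpace X]
    [PseudoMetricSpace Y] {f : ℝ → X} {a b : ℝ} (hf : AbsolutelyContinuousOnInterval f a b)
    {g : ℝ → Y} {K : NNReal}
    (hg : ∀ x ∈ uIcc a b, ∀ y ∈ uIcc a b, dist (g x) (g y) ≤ K * dist (f x) (f y)) :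
    AbsolutelyContinuousOnInterval g a b := by
  unfold AbsolutelyContinuousOnInterval at hf ⊢
  refine squeeze_zero' (.of_forall fun _ => Finset.sum_nonneg fun _ _ => dist_nonneg) ?_
    (by simpa using hf.const_mul (K : ℝ))
  rw [eventually_inf_principal]
  filter_upwards with E hE
  rw [Finset.mul_sum]
  exact Finset.sum_le_sum fun i hi => hg _ (hE.1 i hi).1 _ (hE.1 i hi).2

/-- The Radon-Nikodym property of separable Hilbert spaces. -/
theorem ae_differentiableAt_of_absolutelyContinuous [CompleteSpace E] [SecondCountableTopology E] {q : ℝ → E} {a b : ℝ}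
    (hab : a ≤ b) (hq : AbsolutelyContinuousOnInterval q a b) :
    ∀ᵐ s ∂(volume.restrict (Ioo a b)), DifferentiableAt ℝ q s := by
  borelize E
  set e : ℕ → E := TopologicalSpace.denseSeq E with he_def
  have he : DenseRange e := TopologicalSpace.denseRange_denseSeq E
  have hbv := hq.boundedVariationOn.locallyBoundedVariationOn
  -- The variation function is monotone, hence differentiable almost everywhere, and its slopes
  -- dominate the norms of the slopes of `q`.
  set v : ℝ → ℝ := variationOnFromTo q (uIcc a b) a with hv_def
  have hv : MonotoneOn v (uIcc a b) := variationOnFromTo.monotoneOn hbv left_mem_uIcc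
  have hvq : ∀ x ∈ uIcc a b, ∀ y ∈ uIcc a b, ‖q y - q x‖ ≤ |v y - v x| := by
    have main : ∀ x ∈ uIcc a b, ∀ y ∈ uIcc a b, x ≤ y → ‖q y - q x‖ ≤ |v y - v x| := by
      intro x hx y hy hxy
      have h1 : v y - v x = variationOnFromTo q (uIcc a b) x y :=
        variationOnFromTo.sub_right hbv left_mem_uIcc hy hx
      rw [h1, abs_of_nonneg (variationOnFromTo.nonneg_of_le _ _ hxy),
        variationOnFromTo.eq_of_le _ _ hxy, ← dist_eq_norm, dist_edist]
      refine ENNReal.toReal_mono (hbv x y hx hy) ?_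
      exact eVariationOn.edist_le q ⟨hy, right_mem_Icc.2 hxy⟩ ⟨hx, left_mem_Icc.2 hxy⟩
    intro x hx y hy
    rcases le_total x y with h | h
    · exact main x hx y hy h
    · rw [norm_sub_rev, abs_sub_comm]; exact main y hy x hx h
  have hcoord : ∀ k, AbsolutelyContinuousOnInterval (fun s => (inner ℝ (q s) (e k) : ℝ)) a b := by
    intro k
    refine AbsolutelyContinuousOnInterval.comp_lipschitz hq (K := ‖e k‖₊) fun x _ y _ => ?_
    rw [Real.dist_eq, ← inner_sub_left, dist_eq_norm, coe_nnnorm, mul_comm]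
    exact abs_real_inner_le_norm _ _
  have hvd : ∀ᵐ s, s ∈ uIcc a b → DifferentiableWithinAt ℝ v (uIcc a b) s :=
    hv.ae_differentiableWithinAt_of_mem
  have hkd : ∀ᵐ s, ∀ k, s ∈ uIcc a b →
      DifferentiableAt ℝ (fun s => (inner ℝ (q s) (e k) : ℝ)) s :=
    ae_all_iff.2 fun k => (hcoord k).ae_differentiableAt
  -- Where `v` and the countably many coordinates are all differentiable, the slopes of `q` stay
  -- bounded and have a weak limit along some ultrafilter. This limit is the candidate for the
  -- derivative.
  have hex : ∀ᵐ s, s ∈ Ioo a b → ∃ y : E, ‖y‖ ≤ ‖deriv v s‖ ∧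
      ∀ k, (inner ℝ y (e k) : ℝ) = deriv (fun s => (inner ℝ (q s) (e k) : ℝ)) s := by
    filter_upwards [hvd, hkd] with s h1 h2 hs
    have hsm : s ∈ uIcc a b := by rw [uIcc_of_le hab]; exact Ioo_subset_Icc_self hs
    have hnhds : uIcc a b ∈ 𝓝 s := by
      rw [uIcc_of_le hab]; exact Icc_mem_nhds hs.1 hs.2
    have hv' : HasDerivAt v (deriv v s) s := ((h1 hsm).differentiableAt hnhds).hasDerivAt
    have hslope := (hasDerivAt_iff_tendsto_slope.1 hv').norm
    have : (𝓝[≠] s).NeBot := inferInstance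
    set l := Ultrafilter.of (𝓝[≠] s)
    have hl : (l : Filter ℝ) ≤ 𝓝[≠] s := Ultrafilter.of_le _
    have hbd : ∀ᶠ r in 𝓝[≠] s, ‖slope q s r‖ ≤ ‖slope v s r‖ := by
      filter_upwards [mem_nhdsWithin_of_mem_nhds hnhds] with r hr
      rw [slope_def_module, slope_def_module, norm_smul, norm_smul]
      exact mul_le_mul_of_nonneg_left (hvq s hsm r hr) (norm_nonneg _)
    obtain ⟨y, -, hy⟩ := exists_weak_limit l (fun r => slope q s r) (‖deriv v s‖ + 1) (by
      have h3 : ∀ᶠ r in 𝓝[≠] s, ‖slope v s r‖ ≤ ‖deriv v s‖ + 1 :=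
        hslope.eventually_le_const (by linarith)
      filter_upwards [hl hbd, hl h3] with r h4 h5
      exact h4.trans h5)
    refine ⟨y, ?_, fun k => ?_⟩
    -- Weak compactness only gives the bound `‖deriv v s‖ + 1`; testing the limit against itself
    -- removes the `1`.
    · have h3 : ‖y‖ ^ 2 ≤ ‖deriv v s‖ * ‖y‖ := by
        rw [← real_inner_self_eq_norm_sq]
        refine le_of_tendsto_of_tendsto (hy y) ((hslope.mono_left hl).mul_const ‖y‖) ?_
        filter_upwards [hl hbd] with r h4
        exact (real_inner_le_norm _ _).trans (by gcongr)
      by_contra hlt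
      push Not at hlt
      nlinarith [norm_nonneg y, norm_nonneg (deriv v s)]
    · refine tendsto_nhds_unique (hy (e k)) ?_
      have h3 := (hasDerivAt_iff_tendsto_slope.1 (h2 k hsm).hasDerivAt).mono_left hl
      refine h3.congr fun r => ?_
      rw [slope_def_module, slope_def_module, ← inner_sub_left, real_inner_smul_left, smul_eq_mul]
  classical
  let G : Set ℝ := {s | ∃ y : E, ‖y‖ ≤ ‖deriv v s‖ ∧
      ∀ k, (inner ℝ y (e k) : ℝ) = deriv (fun s => (inner ℝ (q s) (e k) : ℝ)) s}
  -- `G` need not be measurable, so it is shrunk to a measurable subset of full measure. Choosing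
  -- the candidates there and `0` elsewhere gives measurable coordinates.
  obtain ⟨G', hG'sub, hG'm, hG'n⟩ : ∃ G' ⊆ G, MeasurableSet G' ∧ ∀ᵐ s, s ∈ Ioo a b → s ∈ G' := by
    have hG : G ∈ ae (volume.restrict (Ioo a b)) :=
      (ae_restrict_iff' measurableSet_Ioo).2 hex
    refine ⟨(toMeasurable (volume.restrict (Ioo a b)) Gᶜ)ᶜ,
      compl_subset_comm.1 (subset_toMeasurable _ _), (measurableSet_toMeasurable _ _).compl,
      (ae_restrict_iff' measurableSet_Ioo).1 ?_⟩
    rw [ae_iff]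
    simp only [mem_compl_iff, not_not, ofPred_mem_eq]
    rw [measure_toMeasurable]
    exact hG
  let f : ℝ → E := fun s => if h : s ∈ G' then (hG'sub h).choose else 0
  have hf1 : ∀ s, ‖f s‖ ≤ ‖deriv v s‖ := by
    intro s
    by_cases h : s ∈ G'
    · simp only [f, h, dite_true]
      exact (hG'sub h).choose_spec.1
    · simp [f, h]
  have hf2 : ∀ s ∈ G', ∀ k, (inner ℝ (f s) (e k) : ℝ) = deriv (fun s => (inner ℝ (q s) (e k) : ℝ)) s := by
    intro s h
    simp only [f, h, dite_true]
    exact (hG'sub h).choose_spec.2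
  have hfm : Measurable f := by
    refine measurable_of_inner he fun k => ?_
    have : (fun s => (inner ℝ (f s) (e k) : ℝ)) =
        G'.indicator (deriv fun s => (inner ℝ (q s) (e k) : ℝ)) := by
      ext s
      by_cases h : s ∈ G'
      · rw [hf2 s h k, indicator_of_mem h]
      · simp [f, h]
    rw [this]
    exact (measurable_deriv _).indicator hG'm
  have hfi : IntervalIntegrable f volume a b :=
    (hv.intervalIntegrable_deriv).mono_fun hfm.aestronglyMeasurable (.of_forall hf1)
  -- The scalar fundamental theorem of calculus in each coordinate identifies `q` with a primitive
  -- of `f`; strong differentiability then follows from Lebesgue differentiation of the Bochner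
  -- integral.
  have hfq : ∀ s ∈ uIcc a b, q s = q a + ∫ τ in a..s, f τ := by
    intro s hs
    have hsub : uIcc a s ⊆ uIcc a b := uIcc_subset_uIcc left_mem_uIcc hs
    have hfis := hfi.mono_set hsub
    rw [← sub_eq_zero]
    refine he.eq_zero_of_inner_right ℝ fun k => ?_
    have h1 := (innerSL ℝ (e k)).intervalIntegral_comp_comm hfis
    simp only [innerSL_apply_apply] at h1
    rw [inner_sub_right, inner_add_right, ← h1, sub_eq_zero, add_comm, ← sub_eq_iff_eq_add]
    have h2 := ((hcoord k).mono hsub).integral_deriv_eq_sub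
    simp only [real_inner_comm (e k)] at h2 ⊢
    rw [← h2]
    refine intervalIntegral.integral_congr_ae ?_
    have hb : ∀ᵐ τ : ℝ, τ ≠ b := by simp [ae_iff]
    filter_upwards [hG'n, hb] with τ h3 h4 h5
    rw [uIcc_of_le hab] at hs
    rw [uIoc_of_le hs.1] at h5
    rw [real_inner_comm, hf2 τ (h3 ⟨h5.1, lt_of_le_of_ne (h5.2.trans hs.2) h4⟩) k]
    simp only [real_inner_comm (e k)]
  filter_upwards [ae_restrict_mem measurableSet_Ioo,
    ae_restrict_of_ae hfi.ae_hasDerivAt_integral] with s hs hd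
  have hsm : s ∈ uIcc a b := by rw [uIcc_of_le hab]; exact Ioo_subset_Icc_self hs
  have h1 := (hd hsm a left_mem_uIcc).const_add (q a)
  refine (h1.congr_of_eventuallyEq ?_).differentiableAt
  filter_upwards [Ioo_mem_nhds hs.1 hs.2] with r hr
  exact hfq r (by rw [uIcc_of_le hab]; exact Ioo_subset_Icc_self hr)

end Hilbert

/-! ### Composition with monotone absolutely continuous functions -/

/-- Change of variables for monotone functions: the integral of `f'` over the differentiability
points sent into a measurable null hull of `B` is the measure of their image, which is zero. As `f'
≥ 0`, it vanishes almost everywhere there. -/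
theorem Monotone.ae_hasDerivAt_zero_of_mem {f : ℝ → ℝ} (hf : Monotone f) {B : Set ℝ}
    (hB : volume B = 0) : ∀ᵐ s, f s ∈ B → HasDerivAt f 0 s := by
  set B' := toMeasurable volume B
  have hB' : volume B' = 0 := by rw [measure_toMeasurable, hB]
  set A : Set ℝ := {s | DifferentiableAt ℝ f s} ∩ f ⁻¹' B'
  have hA : MeasurableSet A :=
    (measurableSet_of_differentiableAt ℝ f).inter (hf.measurable (measurableSet_toMeasurable _ _))
  have h0 : ∫⁻ x in A, ENNReal.ofReal (deriv f x) = 0 := by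
    rw [lintegral_deriv_eq_volume_image_of_monotoneOn hA
      (fun x hx => hx.1.hasDerivAt.hasDerivWithinAt) (hf.monotoneOn _)]
    exact measure_mono_null (image_subset_iff.2 inter_subset_right) hB'
  rw [lintegral_eq_zero_iff (measurable_deriv f).ennreal_ofReal] at h0
  filter_upwards [hf.ae_differentiableAt, (ae_restrict_iff' hA).1 h0] with s h1 h2 h3
  have h4 : deriv f s = 0 := by
    have := h2 ⟨h1, subset_toMeasurable _ _ h3⟩
    simp only [Pi.zero_apply, ENNReal.ofReal_eq_zero] at this
    exact le_antisymm this hf.deriv_nonneg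
  rw [← h4]
  exact h1.hasDerivAt

theorem MonotoneOn.ae_hasDerivAt_zero_of_mem {f : ℝ → ℝ} {a b : ℝ} (hab : a ≤ b)
    (hf : MonotoneOn f (Icc a b)) {B : Set ℝ} (hB : volume B = 0) :
    ∀ᵐ s ∂(volume.restrict (Ioo a b)), f s ∈ B → HasDerivAt f 0 s := by
  have hg : Monotone (IccExtend hab (fun x : Icc a b => f x)) := by
    refine Monotone.IccExtend hab fun x y hxy => hf x.2 y.2 hxy
  filter_upwards [ae_restrict_mem measurableSet_Ioo,
    ae_restrict_of_ae (Monotone.ae_hasDerivAt_zero_of_mem hg hB)] with s hs h1 h2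
  have heq : ∀ r ∈ Ioo a b, IccExtend hab (fun x : Icc a b => f x) r = f r := fun r hr => by
    rw [IccExtend_of_mem hab _ (Ioo_subset_Icc_self hr)]
  rw [← heq s hs] at h2
  refine (h1 h2).congr_of_eventuallyEq ?_
  filter_upwards [Ioo_mem_nhds hs.1 hs.2] with r hr
  exact (heq r hr).symm

/-- Primitives of integrable functions map null sets to null sets. -/
theorem volume_image_primitive_eq_zero {k : ℝ → ℝ} (hk : Integrable k) (hk0 : ∀ s, 0 ≤ k s)
    {N : Set ℝ} (hN : volume N = 0) : volume ((fun s => ∫ τ in (0 : ℝ)..s, k τ) '' N) = 0 := by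
  set V : ℝ → ℝ := fun s => ∫ τ in (0 : ℝ)..s, k τ with hV
  have hii : ∀ a b : ℝ, IntervalIntegrable k volume a b := fun a b => hk.intervalIntegrable
  have hsub : ∀ a b, V b - V a = ∫ τ in a..b, k τ := fun a b =>
    intervalIntegral.integral_interval_sub_left (hii _ _) (hii _ _)
  have hmono : Monotone V := fun a b hab => by
    rw [← sub_nonneg, hsub]
    exact intervalIntegral.integral_nonneg hab fun _ _ => hk0 _
  have hcont : Continuous V := intervalIntegral.continuous_primitive hii 0
  let f : StieltjesFunction ℝ := ⟨V, hmono, fun x => hcont.continuousWithinAt⟩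
  -- Comparing outer measures avoids any measurability of `N` or of its image; on half-open
  -- intervals the comparison is monotonicity of `V`.
  have hle : OuterMeasure.comap V (volume : Measure ℝ).toOuterMeasure ≤ f.outer := by
    refine OuterMeasure.le_ofFunction.2 fun s => ?_
    rw [f.length_eq]
    refine le_iInf fun a => le_iInf fun b => le_iInf fun h => ?_
    rw [OuterMeasure.comap_apply]
    have h' : s ⊆ Ioc a b := by simpa [botSet] using h
    refine (measure_mono (image_mono h')).trans ?_
    refine (measure_mono (t := Icc (V a) (V b)) ?_).trans ?_
    · rintro _ ⟨x, hx, rfl⟩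
      exact ⟨hmono hx.1.le, hmono hx.2⟩
    · simp [f]
  -- The Stieltjes measure of `V` has density `k`, so it does not charge Lebesgue null sets.
  have hmeas : f.measure = volume.withDensity fun s => ENNReal.ofReal (k s) := by
    have : IsLocallyFiniteMeasure (volume.withDensity fun s => ENNReal.ofReal (k s)) := by
      have := isFiniteMeasure_withDensity_ofReal hk.2
      infer_instance
    refine Measure.ext_of_Ioc _ _ fun a b hab => ?_
    rw [f.measure_Ioc, withDensity_apply _ measurableSet_Ioc,
      ← ofReal_integral_eq_lintegral_ofReal hk.integrableOn (.of_forall hk0)]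
    change ENNReal.ofReal (V b - V a) = _
    rw [hsub, intervalIntegral.integral_of_le hab.le]
  have h1 : volume (V '' N) ≤ f.outer N := by
    have := hle N
    rwa [OuterMeasure.comap_apply] at this
  have h2 : f.outer N = f.measure N := by
    rw [StieltjesFunction.measure]; rfl
  rw [h2, hmeas] at h1
  exact le_antisymm (h1.trans (withDensity_absolutelyContinuous _ _ hN).le) bot_le

/-- Composition of absolutely continuous functions fails in general. A monotone inner function works
because it carries families of disjoint intervals to families of disjoint intervals, while its own
absolute continuity keeps the total length small. -/
theorem AbsolutelyContinuousOnInterval.comp_monotoneOn {X : Type*} [PseudoMetricSpace X]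
    {f : ℝ → X} {t : ℝ → ℝ} {a b c d : ℝ} (hf : AbsolutelyContinuousOnInterval f c d)
    (ht : AbsolutelyContinuousOnInterval t a b) (hm : MonotoneOn t (uIcc a b))
    (hmaps : MapsTo t (uIcc a b) (uIcc c d)) :
    AbsolutelyContinuousOnInterval (f ∘ t) a b := by
  unfold AbsolutelyContinuousOnInterval at hf ht
  have key : Tendsto (fun E : ℕ × (ℕ → ℝ × ℝ) => (E.1, fun i => (t (E.2 i).1, t (E.2 i).2)))
      (AbsolutelyContinuousOnInterval.totalLengthFilter ⊓
        𝓟 (AbsolutelyContinuousOnInterval.disjWithin a b))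
      (AbsolutelyContinuousOnInterval.totalLengthFilter ⊓
        𝓟 (AbsolutelyContinuousOnInterval.disjWithin c d)) := by
    refine tendsto_inf.2 ⟨tendsto_comap_iff.2 ht, tendsto_principal.2 ?_⟩
    rw [eventually_inf_principal]
    filter_upwards with E hE
    refine ⟨fun i hi => ⟨hmaps (hE.1 i hi).1, hmaps (hE.1 i hi).2⟩, fun i hi j hj hij => ?_⟩
    have h1 := hE.2 hi hj hij
    have hi' := hE.1 i hi
    have hj' := hE.1 j hj
    have hmin : ∀ x ∈ uIcc a b, ∀ y ∈ uIcc a b, min (t x) (t y) = t (min x y) := fun x hx y hy =>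
      (hm.map_min hx hy).symm
    have hmax : ∀ x ∈ uIcc a b, ∀ y ∈ uIcc a b, max (t x) (t y) = t (max x y) := fun x hx y hy =>
      (hm.map_max hx hy).symm
    have memmin : ∀ x ∈ uIcc a b, ∀ y ∈ uIcc a b, min x y ∈ uIcc a b := fun x hx y hy => by
      rcases min_choice x y with h | h <;> rw [h] <;> assumption
    have memmax : ∀ x ∈ uIcc a b, ∀ y ∈ uIcc a b, max x y ∈ uIcc a b := fun x hx y hy => by
      rcases max_choice x y with h | h <;> rw [h] <;> assumption
    simp only [Function.onFun, uIoc, Set.disjoint_left, mem_Ioc, not_and, not_le] at h1 ⊢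
    rw [hmin _ hi'.1 _ hi'.2, hmax _ hi'.1 _ hi'.2, hmin _ hj'.1 _ hj'.2, hmax _ hj'.1 _ hj'.2]
    rintro x ⟨hx1, hx2⟩ hx3
    by_contra hx4
    push Not at hx4
    set i1 := min (E.2 i).1 (E.2 i).2
    set i2 := max (E.2 i).1 (E.2 i).2
    set j1 := min (E.2 j).1 (E.2 j).2
    set j2 := max (E.2 j).1 (E.2 j).2
    have mi1 : i1 ∈ uIcc a b := memmin _ hi'.1 _ hi'.2
    have mi2 : i2 ∈ uIcc a b := memmax _ hi'.1 _ hi'.2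
    have mj1 : j1 ∈ uIcc a b := memmin _ hj'.1 _ hj'.2
    have mj2 : j2 ∈ uIcc a b := memmax _ hj'.1 _ hj'.2
    have hlt1 : i1 < i2 := by
      by_contra h; push Not at h; exact absurd (hm mi2 mi1 h) (by linarith)
    have hlt2 : j1 < j2 := by
      by_contra h; push Not at h; exact absurd (hm mj2 mj1 h) (by linarith)
    have hlt3 : i1 < j2 := by
      by_contra h; push Not at h; exact absurd (hm mj2 mi1 h) (by linarith)
    have hlt4 : j1 < i2 := by
      by_contra h; push Not at h; exact absurd (hm mi2 mj1 h) (by linarith)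
    -- If the image intervals met, then `min i2 j2` would lie in both source intervals.
    exact absurd (h1 ⟨lt_min hlt1 hlt3 |>.trans_le le_rfl, min_le_left i2 j2⟩
      (lt_min hlt4 hlt2)) (not_lt.2 (min_le_right i2 j2))
  exact hf.comp key

/-! ### Functions of class `H¹` in time along a parameterized curve -/

section Time

variable {X : Type*} [NormedAddCommGroup X] [NormedSpace ℝ X] [CompleteSpace X]

/-- Taking `k = ‖v'‖`, extended by zero, reduces questions on the vector-valued `v` to the monotone
scalar function `∫ k`, whose increments dominate those of `v`. -/
theorem IsH1InTime.exists_primitive {T : ℝ} (hT : 0 < T) {v : ℝ → X} (hv : IsH1InTime T v) :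
    ∃ k : ℝ → ℝ, Integrable k ∧ (∀ s, 0 ≤ k s) ∧
      (∀ x ∈ Icc 0 T, ∀ y ∈ Icc 0 T,
        ‖v x - v y‖ ≤ |(∫ τ in (0 : ℝ)..x, k τ) - ∫ τ in (0 : ℝ)..y, k τ|) ∧
      ∀ᵐ s ∂(volume.restrict (Ioo 0 T)), DifferentiableAt ℝ v s := by
  obtain ⟨v', hv', hvv⟩ := hv
  have hi : Integrable v' (volume.restrict (Ioc 0 T)) := hv'.integrable (by norm_num)
  have hii : IntervalIntegrable v' volume 0 T :=
    (intervalIntegrable_iff_integrableOn_Ioc_of_le hT.le).2 hi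
  have hki : Integrable ((Ioc 0 T).indicator fun s => ‖v' s‖) :=
    (integrable_indicator_iff measurableSet_Ioc).2 hi.norm
  refine ⟨(Ioc 0 T).indicator fun s => ‖v' s‖, hki, fun s => indicator_nonneg (fun _ _ => norm_nonneg _) s, ?_, ?_⟩
  · have main : ∀ x ∈ Icc 0 T, ∀ y ∈ Icc 0 T, y ≤ x → ‖v x - v y‖ ≤
        |(∫ τ in (0 : ℝ)..x, (Ioc 0 T).indicator (fun s => ‖v' s‖) τ) -
          ∫ τ in (0 : ℝ)..y, (Ioc 0 T).indicator (fun s => ‖v' s‖) τ| := by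
      intro x hx y hy hyx
      have hx' : IntervalIntegrable v' volume 0 x := hii.mono_set (by
        rw [uIcc_of_le hx.1, uIcc_of_le hT.le]; exact Icc_subset_Icc_right hx.2)
      have hy' : IntervalIntegrable v' volume 0 y := hii.mono_set (by
        rw [uIcc_of_le hy.1, uIcc_of_le hT.le]; exact Icc_subset_Icc_right hy.2)
      rw [hvv x hx, hvv y hy, add_sub_add_left_eq_sub,
        intervalIntegral.integral_interval_sub_left hx' hy',
        intervalIntegral.integral_interval_sub_left hki.intervalIntegrable hki.intervalIntegrable]
      refine (intervalIntegral.norm_integral_le_integral_norm hyx).trans ((le_of_eq ?_).trans (le_abs_self _))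
      refine intervalIntegral.integral_congr_ae (.of_forall fun τ hτ => ?_)
      rw [uIoc_of_le hyx] at hτ
      have hmem : τ ∈ Ioc 0 T := ⟨hy.1.trans_lt hτ.1, hτ.2.trans hx.2⟩
      rw [indicator_of_mem hmem]
    intro x hx y hy
    rcases le_total y x with h | h
    · exact main x hx y hy h
    · rw [norm_sub_rev, abs_sub_comm]; exact main y hy x hx h
  · filter_upwards [ae_restrict_mem measurableSet_Ioo,
      ae_restrict_of_ae hii.ae_hasDerivAt_integral] with s hs hd
    have hsm : s ∈ uIcc 0 T := by rw [uIcc_of_le hT.le]; exact Ioo_subset_Icc_self hs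
    refine (((hd hsm 0 left_mem_uIcc).const_add (v 0)).congr_of_eventuallyEq ?_).differentiableAt
    filter_upwards [Ioo_mem_nhds hs.1 hs.2] with r hr
    exact hvv r (Ioo_subset_Icc_self hr)

/-- Let `N` be the null set of times where `v` may fail to be differentiable, and `V` the dominating
primitive. Both `N` and `V '' N` are null, so for almost every `s` with `t s ∈ N` the derivatives of
`t` and of `V ∘ t` vanish. The increments of `V ∘ t` dominate those of `v ∘ t`, whose derivative
therefore vanishes too, in agreement with the formula. -/
theorem IsH1InTime.along_curve {T S : ℝ} (hT : 0 < T) (hS : 0 < S) {v : ℝ → X}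
    (hv : IsH1InTime T v) {t : ℝ → ℝ} (ht : AbsolutelyContinuousOnInterval t 0 S)
    (hm : MonotoneOn t (Icc 0 S)) (hmaps : MapsTo t (Icc 0 S) (Icc 0 T)) :
    AbsolutelyContinuousOnInterval (fun s => v (t s)) 0 S ∧
    ∀ᵐ s ∂(volume.restrict (Ioo 0 S)),
      HasDerivAt (fun s => v (t s)) (deriv t s • deriv v (t s)) s ∧
      (DifferentiableAt ℝ v (t s) ∨ deriv t s = 0) := by
  obtain ⟨k, hk, hk0, hkv, hkd⟩ := hv.exists_primitive hT
  set V : ℝ → ℝ := fun s => ∫ τ in (0 : ℝ)..s, k τ with hV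
  have hVm : Monotone V := fun a b hab => by
    rw [← sub_nonneg, hV]
    simp only
    rw [intervalIntegral.integral_interval_sub_left hk.intervalIntegrable hk.intervalIntegrable]
    exact intervalIntegral.integral_nonneg hab fun _ _ => hk0 _
  have hm' : MonotoneOn t (uIcc 0 S) := by rwa [uIcc_of_le hS.le]
  have hVac : AbsolutelyContinuousOnInterval V 0 T :=
    hk.intervalIntegrable.absolutelyContinuousOnInterval_intervalIntegral (by simp)
  have hVt : AbsolutelyContinuousOnInterval (V ∘ t) 0 S :=
    AbsolutelyContinuousOnInterval.comp_monotoneOn hVac ht hm'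
      (by rwa [uIcc_of_le hS.le, uIcc_of_le hT.le])
  refine ⟨AbsolutelyContinuousOnInterval.comp_lipschitz hVt (K := 1) fun x hx y hy => ?_, ?_⟩
  · rw [uIcc_of_le hS.le] at hx hy
    rw [dist_eq_norm, Real.dist_eq, NNReal.coe_one, one_mul]
    exact hkv _ (hmaps hx) _ (hmaps hy)
  -- The endpoints `0` and `T` are put into `N`, since nothing is known on `v` outside `[0,T]`.
  set N : Set ℝ := {r | r ∈ Ioo 0 T → ¬ DifferentiableAt ℝ v r} ∩ Icc 0 T with hN
  have hN0 : volume N = 0 := by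
    have h1 := (ae_restrict_iff' measurableSet_Ioo).1 hkd
    have h2 : ∀ᵐ r : ℝ, r ≠ 0 := by simp [ae_iff]
    have h3 : ∀ᵐ r : ℝ, r ≠ T := by simp [ae_iff]
    have : ∀ᵐ r, r ∉ N := by
      filter_upwards [h1, h2, h3] with r h1 h2 h3 h4
      have : r ∈ Ioo 0 T := ⟨lt_of_le_of_ne h4.2.1 (Ne.symm h2), lt_of_le_of_ne h4.2.2 h3⟩
      exact h4.1 this (h1 this)
    simpa [ae_iff] using this
  have hVtm : MonotoneOn (V ∘ t) (Icc 0 S) := hVm.comp_monotoneOn hm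
  have htd : ∀ᵐ s ∂(volume.restrict (Ioo 0 S)), DifferentiableAt ℝ t s := by
    rw [ae_restrict_iff' measurableSet_Ioo]
    filter_upwards [ht.ae_differentiableAt] with s h1 h2
    exact h1 (by rw [uIcc_of_le hS.le]; exact Ioo_subset_Icc_self h2)
  filter_upwards [ae_restrict_mem measurableSet_Ioo, htd,
    MonotoneOn.ae_hasDerivAt_zero_of_mem hS.le hm hN0,
    MonotoneOn.ae_hasDerivAt_zero_of_mem hS.le hVtm (volume_image_primitive_eq_zero hk hk0 hN0)]
    with s hs h1 h2 h3
  by_cases hd : DifferentiableAt ℝ v (t s)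
  · exact ⟨HasDerivAt.scomp s hd.hasDerivAt h1.hasDerivAt, Or.inl hd⟩
  · have hsN : t s ∈ N := ⟨fun _ => hd, hmaps (Ioo_subset_Icc_self hs)⟩
    have h4 := (h2 hsN).deriv
    refine ⟨?_, Or.inr h4⟩
    rw [h4, zero_smul]
    have h5 := h3 ⟨t s, hsN, rfl⟩
    rw [hasDerivAt_iff_isLittleO] at h5 ⊢
    simp only [smul_zero, sub_zero] at h5 ⊢
    refine Asymptotics.IsBigO.trans_isLittleO (Asymptotics.IsBigO.of_bound 1 ?_) h5
    filter_upwards [Ioo_mem_nhds hs.1 hs.2] with r hr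
    rw [one_mul]
    exact hkv _ (hmaps (Ioo_subset_Icc_self hr)) _ (hmaps (Ioo_subset_Icc_self hs))

end Time

/-! ### Square integrable functions -/

section L2

variable {X : Type*} [MeasurableSpace X] {ρ : Measure X} {E : Type*} [NormedAddCommGroup E]

theorem Lp.norm_eq_sqrt_integral (f : Lp E 2 ρ) : ‖f‖ = Real.sqrt (∫ x, ‖f x‖ ^ 2 ∂ρ) := by
  rw [Lp.norm_def, (Lp.memLp f).eLpNorm_eq_integral_rpow_norm (by norm_num) (by norm_num),
    ENNReal.toReal_ofReal (by positivity), Real.sqrt_eq_rpow]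
  norm_num

theorem Lp.norm_sq_eq_integral (f : Lp E 2 ρ) : ‖f‖ ^ 2 = ∫ x, ‖f x‖ ^ 2 ∂ρ := by
  rw [Lp.norm_eq_sqrt_integral, Real.sq_sqrt (integral_nonneg fun _ => by positivity)]

theorem integral_norm_mul_norm_le {f g : X → E} (hf : MemLp f 2 ρ) (hg : MemLp g 2 ρ) :
    ∫ x, ‖f x‖ * ‖g x‖ ∂ρ ≤ Real.sqrt (∫ x, ‖f x‖ ^ 2 ∂ρ) * Real.sqrt (∫ x, ‖g x‖ ^ 2 ∂ρ) := by
  have := integral_mul_norm_le_Lp_mul_Lq (f := f) (g := g) Real.HolderConjugate.two_two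
    (by simpa using hf) (by simpa using hg)
  simpa [Real.sqrt_eq_rpow] using this

theorem integrable_norm_mul_norm {E' : Type*} [NormedAddCommGroup E'] {f : X → E} {g : X → E'}
    (hf : MemLp f 2 ρ) (hg : MemLp g 2 ρ) : Integrable (fun x => ‖f x‖ * ‖g x‖) ρ :=
  hf.norm.integrable_mul hg.norm

theorem integral_norm_mul_norm_le' {E' : Type*} [NormedAddCommGroup E'] {f : X → E} {g : X → E'}
    (hf : MemLp f 2 ρ) (hg : MemLp g 2 ρ) :
    ∫ x, ‖f x‖ * ‖g x‖ ∂ρ ≤ Real.sqrt (∫ x, ‖f x‖ ^ 2 ∂ρ) * Real.sqrt (∫ x, ‖g x‖ ^ 2 ∂ρ) := by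
  simpa using integral_norm_mul_norm_le hf.norm hg.norm

end L2

/-! ### Averages with respect to a kernel -/

/-- The rescaled kernel `h⁻ⁿ φ((y - x)/h)`. -/
def kern {n : ℕ} (φ : Vec n → ℝ) (x : Vec n) (h : ℝ) (y : Vec n) : ℝ :=
  (h ^ n)⁻¹ * φ (h⁻¹ • (y - x))

section Kernel

variable {n : ℕ} {φ : Vec n → ℝ}

theorem IsTestFun.bounded (hφ : IsTestFun φ) : ∃ A, 0 ≤ A ∧ ∀ y, |φ y| ≤ A := by
  obtain ⟨A, hA⟩ := hφ.2.exists_bound_of_continuous hφ.1.continuous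
  exact ⟨A, (norm_nonneg _).trans (hA 0), hA⟩

theorem IsTestFun.bounded_support (hφ : IsTestFun φ) : ∃ R, 0 < R ∧ ∀ y, φ y ≠ 0 → ‖y‖ ≤ R := by
  obtain ⟨R, hR0, hR⟩ := hφ.2.isCompact.isBounded.exists_pos_norm_le
  exact ⟨R, hR0, fun y hy => hR y (subset_tsupport _ hy)⟩

theorem IsTestFun.continuous_kern (hφ : IsTestFun φ) (x : Vec n) (h : ℝ) : Continuous (kern φ x h) := by
  have := hφ.1.continuous
  unfold kern
  fun_prop

/-- The components of `y ↦ h⁻ⁿ φ((y - x)/h) (y - x)/h` are test functions. -/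
theorem IsTestFun.kern_mul_coord (hφ : IsTestFun φ) (x : Vec n) {h : ℝ} (hh : 0 < h) (j : Fin n) :
    IsTestFun (fun y => kern φ x h y * (h⁻¹ • (y - x)) j) := by
  constructor
  · have h1 : ContDiff ℝ ∞ fun y : Vec n => h⁻¹ • (y - x) := by fun_prop
    have h2 : ContDiff ℝ ∞ fun y : Vec n => (h⁻¹ • (y - x)) j :=
      (EuclideanSpace.proj (𝕜 := ℝ) j).contDiff.comp h1
    exact (contDiff_const.mul (hφ.1.comp h1)).mul h2
  · have h1 : HasCompactSupport fun y : Vec n => φ (h⁻¹ • (y - x)) := by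
      have := hφ.2.comp_homeomorph
        ((Homeomorph.subRight x).trans (Homeomorph.smulOfNeZero h⁻¹ (inv_pos.2 hh).ne'))
      exact this
    exact (h1.mul_left (f := fun _ => (h ^ n)⁻¹)).mul_right

theorem tsupport_kern_subset (x : Vec n) {h : ℝ} (hh : 0 < h) {g : Vec n → ℝ} {Ω : Set (Vec n)}
    (hΩ : ∀ y ∈ tsupport φ, x + h • y ∈ Ω) :
    tsupport (fun y => kern φ x h y * g y) ⊆ Ω := by
  have hK : IsClosed ((fun y : Vec n => h⁻¹ • (y - x)) ⁻¹' tsupport φ) :=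
    (isClosed_tsupport φ).preimage (by fun_prop)
  refine (closure_minimal ?_ hK).trans ?_
  · intro y hy
    refine subset_tsupport _ ?_
    intro h0
    apply hy
    simp [kern, h0]
  · intro y hy
    have := hΩ _ hy
    rwa [smul_inv_smul₀ hh.ne', add_sub_cancel] at this

theorem kern_eq_zero (x : Vec n) {h : ℝ} (hh : 0 < h) {Ω : Set (Vec n)}
    (hΩ : ∀ y ∈ tsupport φ, x + h • y ∈ Ω) {y : Vec n} (hy : y ∉ Ω) : kern φ x h y = 0 := by
  have := tsupport_kern_subset x hh (g := fun _ => 1) hΩ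
  by_contra h0
  exact hy (this (subset_tsupport _ (by simpa using h0)))

theorem integral_kern_mul (x : Vec n) {h : ℝ} (hh : 0 < h) (g : Vec n → ℝ) :
    ∫ y, kern φ x h y * g (h⁻¹ • (y - x)) = ∫ y, φ y * g y := by
  have h1 : ∀ y, kern φ x h y * g (h⁻¹ • (y - x)) =
      (fun y => (h ^ n)⁻¹ * (φ (h⁻¹ • y) * g (h⁻¹ • y))) (y - x) := fun y => by
    simp only [kern]; ring
  simp_rw [h1]
  rw [integral_sub_right_eq_self (fun y => (h ^ n)⁻¹ * (φ (h⁻¹ • y) * g (h⁻¹ • y))),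
    integral_const_mul,
    Measure.integral_comp_inv_smul volume (fun y => φ y * g y), finrank_euclideanSpace_fin,
    abs_of_pos (by positivity), smul_eq_mul, ← mul_assoc, inv_mul_cancel₀ (by positivity), one_mul]

theorem setIntegral_kern_mul (x : Vec n) {h : ℝ} (hh : 0 < h) {Ω : Set (Vec n)}
    (hΩ : ∀ y ∈ tsupport φ, x + h • y ∈ Ω) (g : Vec n → ℝ) :
    ∫ y in Ω, kern φ x h y * g (h⁻¹ • (y - x)) = ∫ y, φ y * g y := by
  rw [← integral_kern_mul x hh g]
  refine setIntegral_eq_integral_of_forall_compl_eq_zero fun y hy => ?_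
  rw [kern_eq_zero x hh hΩ hy, zero_mul]

theorem IsTestFun.memLp_kern (hφ : IsTestFun φ) (x : Vec n) {h : ℝ} (hh : 0 < h) (p : ℝ≥0∞) (Ω : Set (Vec n)) :
    MemLp (kern φ x h) p (volume.restrict Ω) := by
  refine (Continuous.memLp_of_hasCompactSupport (hφ.continuous_kern x h) ?_).restrict Ω
  have h1 : HasCompactSupport fun y : Vec n => φ (h⁻¹ • (y - x)) :=
    hφ.2.comp_homeomorph
      ((Homeomorph.subRight x).trans (Homeomorph.smulOfNeZero h⁻¹ (inv_pos.2 hh).ne'))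
  exact h1.mul_left (f := fun _ => (h ^ n)⁻¹)

theorem setIntegral_kern_sq_le (hφ : IsTestFun φ) (x : Vec n) {h : ℝ} (hh : 0 < h) (Ω : Set (Vec n)) :
    ∫ y in Ω, kern φ x h y ^ 2 ≤ (h ^ n)⁻¹ * ∫ y, φ y ^ 2 := by
  have h0 : Integrable (fun y => kern φ x h y ^ 2) := by
    have := (hφ.memLp_kern x hh 2 univ).integrable_sq
    rwa [Measure.restrict_univ] at this
  refine (setIntegral_le_integral h0 (.of_forall fun y => sq_nonneg _)).trans (le_of_eq ?_)
  have := integral_kern_mul (φ := φ) x hh (fun y => (h ^ n)⁻¹ * φ y)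
  calc ∫ y, kern φ x h y ^ 2 = ∫ y, kern φ x h y * ((h ^ n)⁻¹ * φ (h⁻¹ • (y - x))) := by
        refine integral_congr_ae (.of_forall fun y => ?_)
        simp only [kern]; ring
    _ = _ := by
      rw [this, ← integral_const_mul]
      refine integral_congr_ae (.of_forall fun y => ?_)
      simp only; ring

/-- The derivative of the averages `∫ z(y) h⁻ⁿ φ((y - x)/h) dy` with respect to `h`. -/
theorem hasDerivAt_average (hφ : IsTestFun φ) {Ω : Set (Vec n)} {x : Vec n} {h : ℝ} (hh : 0 < h)
    (hΩ : ∀ y ∈ tsupport φ, x + h • y ∈ Ω) {z : Vec n → ℝ} {ζ : Vec n → Vec n}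
    (hz : Integrable z (volume.restrict Ω)) (hz2 : MemLp z 2 (volume.restrict Ω))
    (hζ : MemLp ζ 2 (volume.restrict Ω)) (hw : ∀ j, IsWeakPd Ω j z (fun x => ζ x j)) :
    HasDerivAt (fun h => ∫ y in Ω, z y * kern φ x h y)
      (∑ j, ∫ y in Ω, ζ y j * (kern φ x h y * (h⁻¹ • (y - x)) j)) h := by
  obtain ⟨A, hA0, hA⟩ := hφ.bounded
  have hfd : Continuous (fderiv ℝ φ) := hφ.1.continuous_fderiv (by simp)
  -- `y ↦ Dφ(y) y` is continuous with compact support. Its bound `B`, with the bound `A` of `φ`,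
  -- dominates the derivative of the kernel for scales larger than `h / 2`.
  obtain ⟨B, hB⟩ : ∃ B, ∀ y, ‖fderiv ℝ φ y y‖ ≤ B := by
    have hc : HasCompactSupport (fun y => fderiv ℝ φ y y) := by
      refine (hφ.2.fderiv ℝ).mono' ?_
      intro y hy
      refine subset_tsupport _ ?_
      intro h0
      apply hy
      simp [h0]
    exact hc.exists_bound_of_continuous (hfd.clm_apply continuous_id)
  have hB0 : 0 ≤ B := (norm_nonneg _).trans (hB 0)
  let k' : ℝ → Vec n → ℝ := fun r y => -((r ^ (n + 1))⁻¹ *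
    (fderiv ℝ φ (r⁻¹ • (y - x)) (r⁻¹ • (y - x)) + n * φ (r⁻¹ • (y - x))))
  have hk' : ∀ y, ∀ r, 0 < r → HasDerivAt (fun r => kern φ x r y) (k' r y) r := by
    intro y r hr
    have h1 : HasDerivAt (fun r : ℝ => (r ^ n)⁻¹) (-(n * r ^ (n - 1)) / (r ^ n) ^ 2) r :=
      (hasDerivAt_pow n r).inv (by positivity)
    have h2 : HasDerivAt (fun r : ℝ => r⁻¹ • (y - x)) ((-(r ^ 2)⁻¹) • (y - x)) r :=
      (hasDerivAt_inv hr.ne').smul_const (y - x)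
    have h3 : HasFDerivAt φ (fderiv ℝ φ (r⁻¹ • (y - x))) (r⁻¹ • (y - x)) :=
      (hφ.1.differentiable (by simp) _).hasFDerivAt
    have h4 := h1.mul (h3.comp_hasDerivAt r h2)
    refine HasDerivAt.congr_deriv (f := fun r => kern φ x r y) h4 ?_
    have h5 : (-(r ^ 2)⁻¹) • (y - x) = (-r⁻¹) • (r⁻¹ • (y - x)) := by
      rw [smul_smul]; congr 1; field_simp
    rw [h5, map_smul, smul_eq_mul]
    simp only [k', Function.comp]
    rcases n with _ | n
    · simp
    · simp only [Nat.add_sub_cancel]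
      field_simp
      ring
  have hmz : AEStronglyMeasurable z (volume.restrict Ω) := hz.1
  have hkc : ∀ r, Continuous (kern φ x r) := fun r => hφ.continuous_kern x r
  have hk'c : ∀ r, Continuous (k' r) := fun r => by
    have h1 : Continuous fun y : Vec n => r⁻¹ • (y - x) := by fun_prop
    have h2 := (hfd.comp h1).clm_apply h1
    have h3 := hφ.1.continuous.comp h1
    exact (continuous_const.mul (h2.add (continuous_const.mul h3))).neg
  have hmain := hasDerivAt_integral_of_dominated_loc_of_deriv_le (μ := volume.restrict Ω)
    (F := fun r y => z y * kern φ x r y) (F' := fun r y => z y * k' r y) (x₀ := h)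
    (s := Ioi (h / 2)) (bound := fun y => ‖z y‖ * (((h / 2) ^ (n + 1))⁻¹ * (B + n * A)))
    (Ioi_mem_nhds (by linarith))
    (.of_forall fun r => hmz.mul (hkc r).aestronglyMeasurable)
    (hz2.integrable_mul (hφ.memLp_kern x hh 2 Ω))
    (hmz.mul (hk'c h).aestronglyMeasurable)
    (.of_forall fun y r hr => by
      have hr' : 0 < r := (half_pos hh).trans hr
      rw [norm_mul]
      refine mul_le_mul_of_nonneg_left ?_ (norm_nonneg _)
      simp only [k', norm_neg, norm_mul]
      refine mul_le_mul ?_ ?_ (norm_nonneg _) (by positivity)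
      · rw [norm_inv, norm_pow, Real.norm_of_nonneg hr'.le]
        have : h / 2 ≤ r := le_of_lt hr
        gcongr
      · refine (norm_add_le _ _).trans (add_le_add (hB _) ?_)
        rw [norm_mul, Real.norm_natCast]
        exact mul_le_mul_of_nonneg_left (hA _) (by positivity))
    (hz.norm.mul_const _)
    (.of_forall fun y r hr => ((hk' y r ((half_pos hh).trans hr)).const_mul (z y)))
  -- The derivative of the kernel in the scale is minus the divergence in `y` of the field `kern φ x
  -- h y • (y - x)/h`. The definition of weak gradient then moves the divergence from the kernel
  -- onto `z`.
  have hpd : ∀ y, k' h y = - ∑ j, pd (fun y => kern φ x h y * (h⁻¹ • (y - x)) j) j y := by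
    intro y
    have h1 : HasFDerivAt (fun y : Vec n => h⁻¹ • (y - x))
        (h⁻¹ • ContinuousLinearMap.id ℝ (Vec n)) y :=
      ((hasFDerivAt_id y).sub_const x).const_smul h⁻¹
    have h3 : HasFDerivAt φ (fderiv ℝ φ (h⁻¹ • (y - x))) (h⁻¹ • (y - x)) :=
      (hφ.1.differentiable (by simp) _).hasFDerivAt
    have h2 : HasFDerivAt (kern φ x h) ((h ^ n)⁻¹ •
        (fderiv ℝ φ (h⁻¹ • (y - x))).comp (h⁻¹ • ContinuousLinearMap.id ℝ (Vec n))) y :=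
      (h3.comp y h1).const_mul _
    have h4 : ∀ j, pd (fun y => kern φ x h y * (h⁻¹ • (y - x)) j) j y =
        (h ^ (n + 1))⁻¹ * ((h⁻¹ • (y - x)) j * fderiv ℝ φ (h⁻¹ • (y - x)) (EuclideanSpace.single j 1)
          + φ (h⁻¹ • (y - x))) := by
      intro j
      have h5 : HasFDerivAt (fun y : Vec n => (h⁻¹ • (y - x)) j)
          ((EuclideanSpace.proj (𝕜 := ℝ) j).comp (h⁻¹ • ContinuousLinearMap.id ℝ (Vec n))) y :=
        (EuclideanSpace.proj (𝕜 := ℝ) j).hasFDerivAt.comp y h1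
      have h6 : HasFDerivAt (fun y => kern φ x h y * (h⁻¹ • (y - x)) j) _ y := h2.mul h5
      rw [pd, h6.fderiv]
      simp [kern]
      field_simp
      ring
    have h6 : ∀ (L : Vec n →L[ℝ] ℝ) (v : Vec n), L v = ∑ j, v j * L (EuclideanSpace.single j 1) := by
      intro L v
      conv_lhs => rw [← (EuclideanSpace.basisFun (Fin n) ℝ).sum_repr v]
      simp
    simp_rw [h4]
    rw [← Finset.mul_sum, Finset.sum_add_distrib, ← h6 (fderiv ℝ φ (h⁻¹ • (y - x))) (h⁻¹ • (y - x))]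
    simp [k']
  refine hmain.2.congr_deriv ?_
  have htest := fun j => hφ.kern_mul_coord x hh j
  have h7 : ∀ j, ∫ y in Ω, ζ y j * (kern φ x h y * (h⁻¹ • (y - x)) j) =
      - ∫ y in Ω, z y * pd (fun y => kern φ x h y * (h⁻¹ • (y - x)) j) j y := by
    intro j
    rw [hw j _ (htest j) (tsupport_kern_subset x hh hΩ), neg_neg]
  rw [Finset.sum_congr rfl fun j _ => h7 j, Finset.sum_neg_distrib, ← integral_finsetSum, ← integral_neg]
  · refine integral_congr_ae (.of_forall fun y => ?_)
    change z y * k' h y = _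
    rw [hpd, mul_neg, Finset.mul_sum]
  · intro j _
    exact hz2.integrable_mul ((htest j).memLp_pd j Ω)

end Kernel

/-! ### Averages against the Gagliardo seminorm, and their limits at small scales. -/

section Kernel

variable {n : ℕ} {φ : Vec n → ℝ}

theorem norm_sub_le_of_quot {m : ℝ} (hm : 0 < (n : ℝ) / 2 + m - 1) (ζ : Vec n → Vec n)
    (p : Vec n × Vec n) {d : ℝ} (hd : ‖p.1 - p.2‖ ≤ d) :
    ‖ζ p.1 - ζ p.2‖ ≤ d ^ ((n : ℝ) / 2 + m - 1) * ‖quot m ζ p‖ := by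
  rcases eq_or_ne p.1 p.2 with h | h
  · rw [h, sub_self, norm_zero]
    have : 0 ≤ d := (norm_nonneg _).trans hd
    positivity
  · have h0 : 0 < ‖p.1 - p.2‖ := norm_pos_iff.2 (sub_ne_zero.2 h)
    have h1 : 0 < ‖p.1 - p.2‖ ^ ((n : ℝ) / 2 + m - 1) := Real.rpow_pos_of_pos h0 _
    have h2 : ζ p.1 - ζ p.2 = ‖p.1 - p.2‖ ^ ((n : ℝ) / 2 + m - 1) • quot m ζ p := by
      rw [quot, smul_inv_smul₀ h1.ne']
    rw [h2, norm_smul, Real.norm_of_nonneg h1.le]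
    gcongr

/-- The derivative of the averages is controlled by the Gagliardo seminorm of the gradient. -/
theorem average_deriv_le (hφ : IsTestFun φ) (h1 : ∫ y, φ y = 1) (h0 : ∀ j, ∫ y, φ y * y j = 0)
    {R : ℝ} (hR : ∀ y, φ y ≠ 0 → ‖y‖ ≤ R) (hR0 : 0 < R)
    {Ω : Set (Vec n)} (hfin : IsFiniteMeasure (volume.restrict Ω)) {x : Vec n} {h : ℝ} (hh : 0 < h)
    (hΩ : ∀ y ∈ tsupport φ, x + h • y ∈ Ω) {m : ℝ} (hm : 0 < (n : ℝ) / 2 + m - 1)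
    {ζ : Vec n → Vec n} (hζ : MemLp ζ 2 (volume.restrict Ω))
    (Q : Lp (Vec n) 2 ((volume.restrict Ω).prod (volume.restrict Ω)))
    (hQ : (Q : Vec n × Vec n → Vec n) =ᵐ[(volume.restrict Ω).prod (volume.restrict Ω)] quot m ζ) :
    |∑ j, ∫ y in Ω, ζ y j * (kern φ x h y * (h⁻¹ • (y - x)) j)| ≤
      (2 * h * R) ^ ((n : ℝ) / 2 + m - 1) * R * ((h ^ n)⁻¹ * ∫ y, φ y ^ 2) * ‖Q‖ := by
  set K := kern φ x h with hK
  set w : Vec n → Vec n := fun y => h⁻¹ • (y - x) with hw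
  have hζj : ∀ j, MemLp (fun y => ζ y j) 2 (volume.restrict Ω) := fun j =>
    (EuclideanSpace.proj (𝕜 := ℝ) j).comp_memLp' hζ
  have hKm : MemLp K 2 (volume.restrict Ω) := hφ.memLp_kern x hh 2 Ω
  have hKw : ∀ j, MemLp (fun y => K y * w y j) 2 (volume.restrict Ω) := fun j => (hφ.kern_mul_coord x hh j).memLp Ω
  have i1 : ∫ y, K y ∂(volume.restrict Ω) = 1 := by
    have := setIntegral_kern_mul (φ := φ) x hh hΩ (fun _ => 1)
    simpa [h1] using this
  have i2 : ∀ j, ∫ y, K y * w y j ∂(volume.restrict Ω) = 0 := fun j => by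
    have := setIntegral_kern_mul (φ := φ) x hh hΩ (fun y => y j)
    rw [h0 j] at this
    exact this
  have hint1 : ∀ j, Integrable (fun p : Vec n × Vec n => (ζ p.1 j * (K p.1 * w p.1 j)) * K p.2)
      ((volume.restrict Ω).prod (volume.restrict Ω)) := fun j =>
    ((hζj j).integrable_mul (hKw j)).mul_prod (hKm.integrable (by norm_num))
  have hint2 : ∀ j, Integrable (fun p : Vec n × Vec n => (K p.1 * w p.1 j) * (ζ p.2 j * K p.2))
      ((volume.restrict Ω).prod (volume.restrict Ω)) := fun j =>
    ((hKw j).integrable (by norm_num)).mul_prod ((hζj j).integrable_mul hKm)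
  -- As `∫ K = 1` and `∫ K w_j = 0`, a term that integrates to zero can be subtracted: the sum
  -- becomes a double integral of `K K w · (ζ(x) - ζ(y))`, which sees only differences of the
  -- gradient.
  have key : ∑ j, ∫ y, ζ y j * (K y * w y j) ∂(volume.restrict Ω) =
      ∫ p, ∑ j, ((ζ p.1 j * (K p.1 * w p.1 j)) * K p.2 - (K p.1 * w p.1 j) * (ζ p.2 j * K p.2))
        ∂((volume.restrict Ω).prod (volume.restrict Ω)) := by
    refine Eq.trans ?_ (integral_finsetSum _ fun j _ => (hint1 j).sub (hint2 j)).symm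
    refine Finset.sum_congr rfl fun j _ => ?_
    simp only [Pi.sub_apply]
    rw [integral_sub (hint1 j) (hint2 j),
      integral_prod_mul (fun y => ζ y j * (K y * w y j)) K,
      integral_prod_mul (fun y => K y * w y j) (fun y => ζ y j * K y), i1, i2]
    ring
  have hKK : MemLp (fun p : Vec n × Vec n => K p.1 * K p.2) 2 ((volume.restrict Ω).prod (volume.restrict Ω)) := by
    have hc := hφ.continuous_kern x h
    have hc2 : Continuous fun p : Vec n × Vec n => K p.1 * K p.2 := by fun_prop
    rw [memLp_two_iff_integrable_sq hc2.aestronglyMeasurable]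
    have := hKm.integrable_sq.mul_prod hKm.integrable_sq
    refine this.congr (.of_forall fun p => ?_)
    simp only; ring
  have hint3 := integrable_norm_mul_norm (Lp.memLp Q) hKK
  have hRd : (0 : ℝ) ≤ (2 * h * R) ^ ((n : ℝ) / 2 + m - 1) * R := by positivity
  have bound : ∀ᵐ p ∂((volume.restrict Ω).prod (volume.restrict Ω)),
      ‖∑ j, ((ζ p.1 j * (K p.1 * w p.1 j)) * K p.2 - (K p.1 * w p.1 j) * (ζ p.2 j * K p.2))‖ ≤
        ((2 * h * R) ^ ((n : ℝ) / 2 + m - 1) * R) * (‖Q p‖ * ‖K p.1 * K p.2‖) := by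
    filter_upwards [hQ] with p hp
    have e1 : ∑ j, ((ζ p.1 j * (K p.1 * w p.1 j)) * K p.2 - (K p.1 * w p.1 j) * (ζ p.2 j * K p.2)) =
        (K p.1 * K p.2) * inner ℝ (w p.1) (ζ p.1 - ζ p.2) := by
      rw [PiLp.inner_apply, Finset.mul_sum]
      refine Finset.sum_congr rfl fun j _ => ?_
      simp
      ring
    rw [e1, norm_mul]
    by_cases hz : K p.1 * K p.2 = 0
    · rw [hz]; simp
    have hk1 : φ (w p.1) ≠ 0 := fun h => hz (by simp [hK, kern, hw] at h ⊢; simp [h])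
    have hk2 : φ (w p.2) ≠ 0 := fun h => hz (by simp [hK, kern, hw] at h ⊢; simp [h])
    have hw1 := hR _ hk1
    have hw2 := hR _ hk2
    -- Both points lie within distance `h R` of `x`.
    have hd : ‖p.1 - p.2‖ ≤ 2 * h * R := by
      have : p.1 - p.2 = h • (w p.1 - w p.2) := by
        simp only [hw]
        rw [← smul_sub, smul_inv_smul₀ hh.ne']
        abel
      rw [this, norm_smul, Real.norm_of_nonneg hh.le]
      have := norm_sub_le (w p.1) (w p.2)
      nlinarith
    have h3 := norm_sub_le_of_quot hm ζ p hd
    rw [← hp] at h3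
    calc ‖K p.1 * K p.2‖ * ‖(inner ℝ (w p.1) (ζ p.1 - ζ p.2) : ℝ)‖
        ≤ ‖K p.1 * K p.2‖ * (R * ((2 * h * R) ^ ((n : ℝ) / 2 + m - 1) * ‖Q p‖)) := by
          refine mul_le_mul_of_nonneg_left ?_ (norm_nonneg _)
          exact (norm_inner_le_norm _ _).trans (mul_le_mul hw1 h3 (norm_nonneg _) hR0.le)
      _ = _ := by ring
  rw [key, ← Real.norm_eq_abs]
  refine (norm_integral_le_of_norm_le (hint3.const_mul _) bound).trans ?_
  rw [integral_const_mul, mul_assoc _ _ ‖Q‖]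
  refine mul_le_mul_of_nonneg_left ?_ hRd
  refine (integral_norm_mul_norm_le' (Lp.memLp Q) hKK).trans ?_
  rw [← Lp.norm_eq_sqrt_integral, mul_comm]
  refine mul_le_mul_of_nonneg_right ?_ (norm_nonneg _)
  have e2 : ∫ p, ‖K p.1 * K p.2‖ ^ 2 ∂((volume.restrict Ω).prod (volume.restrict Ω)) = (∫ y, K y ^ 2 ∂(volume.restrict Ω)) ^ 2 := by
    rw [sq (∫ y, K y ^ 2 ∂(volume.restrict Ω)), ← integral_prod_mul (fun y => K y ^ 2) (fun y => K y ^ 2)]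
    refine integral_congr_ae (.of_forall fun p => ?_)
    simp only [norm_mul, Real.norm_eq_abs, mul_pow, sq_abs]
  rw [e2, Real.sqrt_sq (integral_nonneg fun _ => sq_nonneg _)]
  exact setIntegral_kern_sq_le hφ x hh Ω

/-- The averages converge at Lebesgue points. -/
theorem ae_tendsto_average (hφ : IsTestFun φ) (h1 : ∫ y, φ y = 1)
    {Ω : Set (Vec n)} (hmΩ : MeasurableSet Ω) {z : Vec n → ℝ} (hz : IntegrableOn z Ω) :
    ∀ᵐ x ∂(volume.restrict Ω), (∀ h ∈ Ioc (0 : ℝ) 1, ∀ y ∈ tsupport φ, x + h • y ∈ Ω) →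
      Tendsto (fun h => ∫ y in Ω, z y * kern φ x h y) (𝓝[>] 0) (𝓝 (z x)) := by
  obtain ⟨A, hA0, hA⟩ := hφ.bounded
  obtain ⟨R, hR0, hR⟩ := hφ.bounded_support
  have hzi : Integrable (Ω.indicator z) := (integrable_indicator_iff hmΩ).2 hz
  -- Convergence holds at the Lebesgue points of the extension of `z` by zero.
  have hleb := IsUnifLocDoublingMeasure.ae_tendsto_average_norm_sub (volume : Measure (Vec n))
    hzi.locallyIntegrable 1
  filter_upwards [ae_restrict_mem hmΩ, ae_restrict_of_ae hleb] with x hx hlx hsub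
  have hδ : Tendsto (fun h : ℝ => h * R) (𝓝[>] 0) (𝓝[>] 0) := by
    refine tendsto_nhdsWithin_iff.2 ⟨?_, ?_⟩
    · have : Tendsto (fun h : ℝ => h * R) (𝓝 0) (𝓝 (0 * R)) := (continuous_id.mul_const R).tendsto 0
      rw [zero_mul] at this
      exact this.mono_left nhdsWithin_le_nhds
    · filter_upwards [self_mem_nhdsWithin] with h hh
      exact mul_pos hh hR0
  have hlim := hlx (fun _ : ℝ => x) (fun h => h * R) hδ (by
    filter_upwards [self_mem_nhdsWithin] with h hh
    have : (0 : ℝ) < h := hh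
    simp only [one_mul]
    exact Metric.mem_closedBall_self (by positivity))
  -- The kernel is at most `A / hⁿ` and vanishes outside the ball of radius `h R`; `c` is this bound
  -- times the volume of the ball, in which the powers of `h` cancel.
  set c : ℝ := A * (R ^ n * (volume (Metric.ball (0 : Vec n) 1)).toReal) with hc
  have hlim2 := hlim.const_mul c
  rw [mul_zero] at hlim2
  rw [tendsto_iff_norm_sub_tendsto_zero]
  refine squeeze_zero' (.of_forall fun _ => norm_nonneg _) ?_ hlim2
  filter_upwards [Ioc_mem_nhdsGT (show (0 : ℝ) < 1 by norm_num)] with h hh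
  have hΩ := hsub h hh
  have hzx : Ω.indicator z x = z x := indicator_of_mem hx z
  set B := Metric.closedBall x (h * R) with hB
  have hBvol : (volume B).toReal = h ^ n * (R ^ n * (volume (Metric.ball (0 : Vec n) 1)).toReal) := by
    have hh0 := hh.1
    rw [hB, Measure.addHaar_closedBall _ _ (by positivity), ENNReal.toReal_mul,
      ENNReal.toReal_ofReal (by positivity), finrank_euclideanSpace_fin, mul_pow]
    ring
  have hKs : ∀ y, y ∉ B → kern φ x h y = 0 := by
    intro y hy
    by_contra h0
    apply hy
    have h2 : φ (h⁻¹ • (y - x)) ≠ 0 := fun h3 => h0 (by simp [kern, h3])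
    have h3 := hR _ h2
    rw [norm_smul, norm_inv, Real.norm_of_nonneg hh.1.le, inv_mul_le_iff₀ hh.1] at h3
    rwa [hB, mem_closedBall_iff_norm]
  have hKi : Integrable (kern φ x h) := by
    have := hφ.memLp_kern x hh.1 1 univ
    rw [Measure.restrict_univ] at this
    exact memLp_one_iff_integrable.1 this
  have hKb : ∀ y, ‖kern φ x h y‖ ≤ (h ^ n)⁻¹ * A := by
    intro y
    have := hh.1
    rw [kern, norm_mul, Real.norm_of_nonneg (by positivity)]
    exact mul_le_mul_of_nonneg_left (hA _) (by positivity)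
  have hK1 : ∫ y, kern φ x h y = 1 := by
    have := integral_kern_mul (φ := φ) x hh.1 (fun _ => 1)
    simpa [h1] using this
  have e1 : ∫ y in Ω, z y * kern φ x h y = ∫ y, Ω.indicator z y * kern φ x h y := by
    rw [← integral_indicator hmΩ]
    refine integral_congr_ae (.of_forall fun y => ?_)
    by_cases hy : y ∈ Ω <;> simp [hy]
  have hi1 : Integrable (fun y => Ω.indicator z y * kern φ x h y) :=
    hzi.mul_bdd (c := (h ^ n)⁻¹ * A) (hφ.continuous_kern x h).aestronglyMeasurable (.of_forall hKb)
  have e2 : (∫ y in Ω, z y * kern φ x h y) - z x =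
      ∫ y, (Ω.indicator z y - Ω.indicator z x) * kern φ x h y := by
    simp_rw [sub_mul]
    rw [integral_sub hi1 (hKi.const_mul _), integral_const_mul, hK1, mul_one, e1, hzx]
  have hBm : MeasurableSet B := Metric.isClosed_closedBall.measurableSet
  have e3 : ∫ y, (Ω.indicator z y - Ω.indicator z x) * kern φ x h y =
      ∫ y in B, (Ω.indicator z y - Ω.indicator z x) * kern φ x h y :=
    (setIntegral_eq_integral_of_forall_compl_eq_zero fun y hy => by rw [hKs y hy, mul_zero]).symm
  have hBfin : IsFiniteMeasure (volume.restrict B) :=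
    ⟨by rw [Measure.restrict_apply_univ]; exact (isCompact_closedBall _ _).measure_lt_top⟩
  rw [e2, e3]
  have hi2 : Integrable (fun y => ‖Ω.indicator z y - Ω.indicator z x‖) (volume.restrict B) :=
    (hzi.restrict.sub (integrable_const _)).norm
  refine (norm_integral_le_of_norm_le (hi2.const_mul ((h ^ n)⁻¹ * A)) (.of_forall fun y => ?_)).trans ?_
  · rw [norm_mul, mul_comm]
    exact mul_le_mul_of_nonneg_right (hKb y) (norm_nonneg _)
  · rw [integral_const_mul, setAverage_eq, smul_eq_mul, measureReal_def, hBvol, hc]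
    have h5 : (0 : ℝ) < h ^ n := pow_pos hh.1 _
    have h6 : 0 < R ^ n * (volume (Metric.ball (0 : Vec n) 1)).toReal := by
      refine mul_pos (by positivity) (ENNReal.toReal_pos ?_ ?_)
      · exact (Metric.measure_ball_pos _ _ one_pos).ne'
      · exact Metric.isBounded_ball.measure_lt_top.ne
    have h7 := right_ne_zero_of_mul h6.ne'
    refine le_of_eq ?_
    field_simp

end Kernel

/-! ### The embedding of `H^m(Ω)` into the bounded functions. -/

section Embedding

variable {n : ℕ}

/-- A bump `φ₀` at `a` and its dilation by `2` are combined with masses `2` and `-1`. The total mass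
is `1`, and the first moments cancel because dilation doubles them. The kernel changes sign, but it
is supported in a cone of directions off the origin, which a nonnegative kernel with vanishing first
moments could not be. -/
theorem exists_kernel (a : Vec n) {b : ℝ} (hb : 0 < b) : ∃ φ : Vec n → ℝ, IsTestFun φ ∧
    ∫ y, φ y = 1 ∧ (∀ j, ∫ y, φ y * y j = 0) ∧
    tsupport φ ⊆ Metric.closedBall a b ∪ (fun y => (2 : ℝ)⁻¹ • y) ⁻¹' Metric.closedBall a b := by
  let ψ : ContDiffBump a := ⟨b / 2, b, by linarith, by linarith⟩
  set φ₀ : Vec n → ℝ := ψ.normed volume with hφ₀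
  have hc : HasCompactSupport φ₀ := ψ.hasCompactSupport_normed
  have hs : ContDiff ℝ ∞ φ₀ := ψ.contDiff_normed
  have hi : ∫ y, φ₀ y = 1 := ψ.integral_normed
  have hcont := hs.continuous
  have hs2 : ContDiff ℝ ∞ fun y : Vec n => φ₀ ((2 : ℝ)⁻¹ • y) := hs.comp (by fun_prop)
  have hc2 : HasCompactSupport fun y : Vec n => φ₀ ((2 : ℝ)⁻¹ • y) :=
    hc.comp_homeomorph (Homeomorph.smulOfNeZero (2 : ℝ)⁻¹ (by norm_num))
  have hint : Integrable φ₀ := hcont.integrable_of_hasCompactSupport hc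
  have hint2 : Integrable fun y : Vec n => φ₀ ((2 : ℝ)⁻¹ • y) :=
    hs2.continuous.integrable_of_hasCompactSupport hc2
  have hj : ∀ j : Fin n, Continuous fun y : Vec n => y j := fun j => by fun_prop
  have hint3 : ∀ j, Integrable fun y : Vec n => φ₀ y * y j := fun j =>
    (hcont.mul (hj j)).integrable_of_hasCompactSupport hc.mul_right
  have hint4 : ∀ j, Integrable fun y : Vec n => φ₀ ((2 : ℝ)⁻¹ • y) * y j := fun j =>
    (hs2.continuous.mul (hj j)).integrable_of_hasCompactSupport hc2.mul_right
  refine ⟨fun y => 2 * φ₀ y - ((2 : ℝ) ^ n)⁻¹ * φ₀ ((2 : ℝ)⁻¹ • y), ⟨?_, ?_⟩, ?_, ?_, ?_⟩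
  · exact (contDiff_const.mul hs).sub (contDiff_const.mul hs2)
  · exact (hc.mul_left (f := fun _ => (2 : ℝ))).sub (hc2.mul_left (f := fun _ => ((2 : ℝ) ^ n)⁻¹))
  · rw [integral_sub (hint.const_mul _) (hint2.const_mul _), integral_const_mul, integral_const_mul,
      hi, Measure.integral_comp_inv_smul volume φ₀, hi, finrank_euclideanSpace_fin,
      abs_of_pos (by positivity)]
    simp
    norm_num
  · intro j
    have e1 : ∫ y : Vec n, φ₀ ((2 : ℝ)⁻¹ • y) * y j = 2 ^ n * (2 * ∫ y, φ₀ y * y j) := by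
      have e2 : ∀ y : Vec n, φ₀ ((2 : ℝ)⁻¹ • y) * y j =
          2 * (fun y : Vec n => φ₀ y * y j) ((2 : ℝ)⁻¹ • y) := fun y => by
        simp; ring
      simp_rw [e2]
      rw [integral_const_mul, Measure.integral_comp_inv_smul volume (fun y : Vec n => φ₀ y * y j),
        finrank_euclideanSpace_fin, abs_of_pos (by positivity), smul_eq_mul]
      ring
    simp_rw [sub_mul, mul_assoc]
    rw [integral_sub ((hint3 j).const_mul _) ((hint4 j).const_mul _), integral_const_mul,
      integral_const_mul, e1]
    field_simp
    ring
  · have h1 : tsupport φ₀ = Metric.closedBall a b := ψ.tsupport_normed_eq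
    have hcl : IsClosed (Metric.closedBall a b ∪
        (fun y : Vec n => (2 : ℝ)⁻¹ • y) ⁻¹' Metric.closedBall a b) :=
      Metric.isClosed_closedBall.union (Metric.isClosed_closedBall.preimage (by fun_prop))
    refine closure_minimal (fun y hy => ?_) hcl
    by_contra hn
    rw [mem_union, not_or] at hn
    apply hy
    have h2 : φ₀ y = 0 := by
      by_contra h; exact hn.1 (h1 ▸ subset_tsupport _ h)
    have h3 : φ₀ ((2 : ℝ)⁻¹ • y) = 0 := by
      by_contra h; exact hn.2 (h1 ▸ subset_tsupport _ h)
    simp [h2, h3]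

theorem norm_fst_le {Ω : Set (Vec n)} {m : ℝ} (z : Hm Ω m) : ‖z.1.fst‖ ≤ ‖z‖ := by
  have := WithLp.prod_norm_sq_eq_of_L2 z.1
  change _ ≤ ‖z.1‖
  nlinarith [norm_nonneg z.1, norm_nonneg z.1.fst, sq_nonneg ‖z.1.snd‖]

theorem norm_snd_le {Ω : Set (Vec n)} {m : ℝ} (z : Hm Ω m) : ‖z.1.snd‖ ≤ ‖z‖ := by
  have := WithLp.prod_norm_sq_eq_of_L2 z.1
  change _ ≤ ‖z.1‖
  nlinarith [norm_nonneg z.1, norm_nonneg z.1.snd, sq_nonneg ‖z.1.fst‖]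

set_option maxHeartbeats 1000000 in
/-- The pointwise bound of functions in `H^m(Ω)` on the set of those points at which the translated
and rescaled support of a fixed kernel stays in `Ω`. -/
theorem exists_bound_of_kernel {φ : Vec n → ℝ} (hφ : IsTestFun φ) (h1 : ∫ y, φ y = 1)
    (h0 : ∀ j, ∫ y, φ y * y j = 0) {Ω : Set (Vec n)} (hmΩ : MeasurableSet Ω)
    (hfin : IsFiniteMeasure (volume.restrict Ω)) {m : ℝ} (hm1 : 0 < (n : ℝ) / 2 + m - 1)
    (hm : (n : ℝ) / 2 < m) :
    ∃ C, 0 ≤ C ∧ ∀ z : Hm Ω m, ∀ᵐ x ∂(volume.restrict Ω),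
      (∀ h ∈ Ioc (0 : ℝ) 1, ∀ y ∈ tsupport φ, x + h • y ∈ Ω) → |damageFn z x| ≤ C * ‖z‖ := by
  obtain ⟨R, hR0, hR⟩ := hφ.bounded_support
  set a := (n : ℝ) / 2 + m - 1 with ha
  -- The derivative of the averages is of order `h^(θ - 1)`; the condition `m > n/2` makes this
  -- integrable at `h = 0`.
  set θ := m - (n : ℝ) / 2 with hθ
  have hθ0 : 0 < θ := by linarith
  have hI0 : 0 ≤ ∫ y, φ y ^ 2 := integral_nonneg fun _ => sq_nonneg _
  set D₀ := (2 * R) ^ a * R * ∫ y, φ y ^ 2 with hD₀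
  have hD₀0 : 0 ≤ D₀ := by positivity
  refine ⟨Real.sqrt (∫ y, φ y ^ 2) + D₀ / θ, by positivity, fun z => ?_⟩
  obtain ⟨ζ, hw, hQ⟩ := z.2
  have hzL : MemLp (z.1.fst : Vec n → ℝ) 2 (volume.restrict Ω) := Lp.memLp _
  have hzi : Integrable (z.1.fst : Vec n → ℝ) (volume.restrict Ω) := hzL.integrable (by norm_num)
  filter_upwards [ae_tendsto_average hφ h1 hmΩ hzi] with x hlim hsub
  have hlim := hlim hsub
  set f : ℝ → ℝ := fun h => ∫ y in Ω, z.1.fst y * kern φ x h y with hf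
  have hderiv : ∀ h ∈ Ioc (0 : ℝ) 1, HasDerivAt f
      (∑ j, ∫ y in Ω, ζ y j * (kern φ x h y * (h⁻¹ • (y - x)) j)) h := fun h hh =>
    hasDerivAt_average hφ hh.1 (hsub h hh) hzi hzL (Lp.memLp ζ) hw
  have hbd : ∀ h ∈ Ioc (0 : ℝ) 1,
      ‖∑ j, ∫ y in Ω, ζ y j * (kern φ x h y * (h⁻¹ • (y - x)) j)‖ ≤
        D₀ * ‖z.1.snd‖ * h ^ (θ - 1) := fun h hh => by
    refine (average_deriv_le hφ h1 h0 hR hR0 hfin hh.1 (hsub h hh) hm1 (Lp.memLp ζ)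
      z.1.snd hQ).trans (le_of_eq ?_)
    have e1 : (2 * h * R) ^ a = h ^ a * (2 * R) ^ a := by
      rw [← Real.mul_rpow hh.1.le (by positivity)]; ring_nf
    have e2 : h ^ (θ - 1) = h ^ a * (h ^ n)⁻¹ := by
      rw [← Real.rpow_natCast, ← Real.rpow_neg hh.1.le, ← Real.rpow_add hh.1]
      congr 1
      rw [hθ, ha]; ring
    generalize ‖z.1.snd‖ = N
    rw [← ha, e1, e2, hD₀]
    ring
  have hdiff : ∀ h ∈ Ioc (0 : ℝ) 1, ‖f 1 - f h‖ ≤ D₀ / θ * ‖z.1.snd‖ := by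
    intro h hh
    -- A comparison function replaces integration in the scale, so no integrability of the
    -- derivative is needed. The resulting bound is uniform in `h`, since `1 - h ^ θ ≤ 1`.
    have key := image_norm_le_of_norm_deriv_right_le_deriv_boundary' (f := fun r => f r - f h)
      (a := h) (b := 1) (f' := fun r => ∑ j, ∫ y in Ω, ζ y j * (kern φ x r y * (r⁻¹ • (y - x)) j))
      (B := fun r => D₀ * ‖z.1.snd‖ * ((r ^ θ - h ^ θ) / θ))
      (B' := fun r => D₀ * ‖z.1.snd‖ * r ^ (θ - 1))
      (fun r hr => ((hderiv r ⟨hh.1.trans_le hr.1, hr.2⟩).continuousAt.continuousWithinAt.sub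
        continuousWithinAt_const))
      (fun r hr => ((hderiv r ⟨hh.1.trans_le hr.1, hr.2.le⟩).sub_const _).hasDerivWithinAt)
      (by simp)
      (fun r hr => by
        have hr0 : r ≠ 0 := (hh.1.trans_le hr.1).ne'
        exact (continuousAt_const.mul (((Real.continuousAt_rpow_const r θ (Or.inl hr0)).sub
          continuousAt_const).div_const _)).continuousWithinAt)
      (fun r hr => by
        have hr0 : r ≠ 0 := (hh.1.trans_le hr.1).ne'
        have h2 := (((Real.hasDerivAt_rpow_const (x := r) (p := θ) (Or.inl hr0)).sub_const
          (h ^ θ)).div_const θ).const_mul (D₀ * ‖z.1.snd‖)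
        refine (h2.congr_deriv ?_).hasDerivWithinAt
        field_simp)
      (fun r hr => hbd r ⟨hh.1.trans_le hr.1, hr.2.le⟩)
      (right_mem_Icc.2 hh.2)
    refine key.trans ?_
    have h3 : 0 ≤ h ^ θ := Real.rpow_nonneg hh.1.le _
    have h4 : (1 : ℝ) ^ θ - h ^ θ ≤ 1 := by rw [Real.one_rpow]; linarith
    calc D₀ * ‖z.1.snd‖ * (((1 : ℝ) ^ θ - h ^ θ) / θ) ≤ D₀ * ‖z.1.snd‖ * (1 / θ) := by gcongr
      _ = _ := by ring
  have h5 : ‖f 1 - z.1.fst x‖ ≤ D₀ / θ * ‖z.1.snd‖ := by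
    refine le_of_tendsto ((tendsto_const_nhds.sub hlim).norm) ?_
    filter_upwards [Ioc_mem_nhdsGT (show (0 : ℝ) < 1 by norm_num)] with h hh
    exact hdiff h hh
  have h6 : ‖f 1‖ ≤ ‖z.1.fst‖ * Real.sqrt (∫ y, φ y ^ 2) := by
    have hK := hφ.memLp_kern x one_pos 2 Ω
    refine (norm_integral_le_integral_norm _).trans ?_
    simp_rw [norm_mul]
    refine (integral_norm_mul_norm_le' hzL hK).trans ?_
    refine mul_le_mul (Lp.norm_eq_sqrt_integral z.1.fst).ge (Real.sqrt_le_sqrt ?_)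
      (Real.sqrt_nonneg _) (norm_nonneg _)
    simp only [Real.norm_eq_abs, sq_abs]
    simpa using setIntegral_kern_sq_le hφ x one_pos Ω
  have h7 : |damageFn z x| ≤ ‖f 1‖ + ‖f 1 - z.1.fst x‖ := by
    have := (norm_sub_norm_le (z.1.fst x) (f 1)).trans_eq (norm_sub_rev _ _)
    change ‖z.1.fst x‖ ≤ _
    linarith
  have h8 := norm_fst_le z
  have h9 := norm_snd_le z
  calc |damageFn z x| ≤ ‖z.1.fst‖ * Real.sqrt (∫ y, φ y ^ 2) + D₀ / θ * ‖z.1.snd‖ := by linarith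
    _ ≤ ‖z‖ * Real.sqrt (∫ y, φ y ^ 2) + D₀ / θ * ‖z‖ := by gcongr
    _ = _ := by ring

/-- The interior cone condition. -/
theorem IsBoundedLipschitzDomain.cone {Ω : Set (Vec n)} (hΩ : IsBoundedLipschitzDomain Ω)
    {x₀ : Vec n} (hx₀ : x₀ ∈ closure Ω) : ∃ (r : ℝ) (a : Vec n) (b : ℝ), 0 < r ∧ 0 < b ∧
      ∀ x ∈ Ω ∩ Metric.ball x₀ r, ∀ h ∈ Ioc (0 : ℝ) 2, ∀ y ∈ Metric.closedBall a b,
        x + h • y ∈ Ω := by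
  by_cases hx : x₀ ∈ Ω
  · obtain ⟨r, hr, hsub⟩ := Metric.isOpen_iff.1 hΩ.isOpen x₀ hx
    refine ⟨r / 2, 0, r / 8, by linarith, by linarith, fun x hx h hh y hy => hsub ?_⟩
    have h1 := Metric.mem_ball.1 hx.2
    have h2 := mem_closedBall_zero_iff.1 hy
    have h3 : ‖h • y‖ ≤ 2 * (r / 8) := by
      rw [norm_smul, Real.norm_of_nonneg hh.1.le]
      exact mul_le_mul hh.2 h2 (norm_nonneg _) (by norm_num)
    rw [dist_eq_norm] at h1
    rw [mem_ball_iff_norm]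
    calc ‖x + h • y - x₀‖ = ‖(x - x₀) + h • y‖ := by congr 1; abel
      _ ≤ ‖x - x₀‖ + ‖h • y‖ := norm_add_le _ _
      _ < r := by linarith
  · have hfr : x₀ ∈ frontier Ω := by
      rw [hΩ.isOpen.frontier_eq]; exact ⟨hx₀, hx⟩
    obtain ⟨e, g, L, r, he, hg, hr, hiff⟩ := hΩ.lipschitz_boundary x₀ hfr
    -- The opening `b` is chosen with `b (2L + 2) = σ`. A displacement `h • y` rises along `e` by at
    -- least `h (σ - b) = h b (2L + 1)`, while the graph rises by at most `h L · 2b`. Its length is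
    -- at most `2 (σ + b) ≤ r / 4`, so the point stays in the chart.
    set σ := r / 16 with hσ
    have hσ0 : 0 < σ := by positivity
    have hL : (0 : ℝ) ≤ L := L.2
    set b := σ / (2 * L + 2) with hb
    have hb0 : 0 < b := by positivity
    have hbσ : b * (2 * L + 2) = σ := by rw [hb]; field_simp
    refine ⟨r / 2, σ • e, b, by linarith, hb0, fun x hx h hh y hy => ?_⟩
    have hy1 : ‖y - σ • e‖ ≤ b := mem_closedBall_iff_norm.1 hy
    have hy2 : ‖y‖ ≤ σ + b := by
      have h1 := norm_add_le (σ • e) (y - σ • e)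
      rw [add_sub_cancel, norm_smul, he, Real.norm_of_nonneg hσ0.le] at h1
      linarith
    have hbs : b ≤ σ := by nlinarith
    have h1 := Metric.mem_ball.1 hx.2
    rw [dist_eq_norm] at h1
    have hxb : x ∈ Metric.ball x₀ r := Metric.ball_subset_ball (by linarith) hx.2
    have h3 : ‖h • y‖ ≤ 2 * (σ + b) := by
      rw [norm_smul, Real.norm_of_nonneg hh.1.le]
      exact mul_le_mul hh.2 hy2 (norm_nonneg _) (by norm_num)
    have hxy : x + h • y ∈ Metric.ball x₀ r := by
      rw [mem_ball_iff_norm]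
      calc ‖x + h • y - x₀‖ = ‖(x - x₀) + h • y‖ := by congr 1; abel
        _ ≤ ‖x - x₀‖ + ‖h • y‖ := norm_add_le _ _
        _ < r := by linarith
    rw [hiff _ hxy]
    have h4 := (hiff x hxb).1 hx.1
    have hee : (inner ℝ e e : ℝ) = 1 := by rw [real_inner_self_eq_norm_sq, he]; norm_num
    have h5 : (inner ℝ e (y - σ • e) : ℝ) = inner ℝ e y - σ := by
      rw [inner_sub_right, real_inner_smul_right, hee, mul_one]
    have h6 : |(inner ℝ e (y - σ • e) : ℝ)| ≤ b :=
      (abs_real_inner_le_norm _ _).trans (by rw [he, one_mul]; exact hy1)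
    have h7 : ‖y - (inner ℝ e y : ℝ) • e‖ ≤ 2 * b := by
      have : y - (inner ℝ e y : ℝ) • e = (y - σ • e) - (inner ℝ e (y - σ • e) : ℝ) • e := by
        rw [h5, sub_smul]; abel
      rw [this]
      refine (norm_sub_le _ _).trans ?_
      rw [norm_smul, he, mul_one, Real.norm_eq_abs]
      linarith
    have h8 : x + h • y - (inner ℝ e (x + h • y) : ℝ) • e =
        (x - (inner ℝ e x : ℝ) • e) + h • (y - (inner ℝ e y : ℝ) • e) := by
      rw [inner_add_right, real_inner_smul_right, add_smul, smul_sub, mul_smul]; abel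
    have h9 := hg.dist_le_mul (x + h • y - (inner ℝ e (x + h • y) : ℝ) • e)
      (x - (inner ℝ e x : ℝ) • e)
    rw [Real.dist_eq, dist_eq_norm, h8, add_sub_cancel_left, norm_smul,
      Real.norm_of_nonneg hh.1.le] at h9
    have h10 := (abs_le.1 h9).2
    rw [h8, inner_add_right, real_inner_smul_right]
    rw [h5] at h6
    have h11 := (abs_le.1 h6).1
    have h12 : (L : ℝ) * (h * ‖y - (inner ℝ e y : ℝ) • e‖) ≤ L * (h * (2 * b)) := by
      have := hh.1.le; gcongr
    have h13 : h * (L * (2 * b)) < h * (inner ℝ e y : ℝ) := by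
      refine mul_lt_mul_of_pos_left ?_ hh.1
      nlinarith
    linarith

/-- The embedding of `H^m(Ω)` into the bounded functions. -/
theorem IsBoundedLipschitzDomain.exists_bound {Ω : Set (Vec n)} (hΩ : IsBoundedLipschitzDomain Ω)
    {m : ℝ} (hm1 : 0 < (n : ℝ) / 2 + m - 1) (hm : (n : ℝ) / 2 < m) :
    ∃ C, 0 ≤ C ∧ ∀ z : Hm Ω m, ∀ᵐ x ∂(volume.restrict Ω), |damageFn z x| ≤ C * ‖z‖ := by
  have hfin : IsFiniteMeasure (volume.restrict Ω) :=
    ⟨by rw [Measure.restrict_apply_univ]; exact hΩ.isBounded.measure_lt_top⟩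
  have hmΩ := hΩ.isOpen.measurableSet
  have hcpt : IsCompact (closure Ω) := hΩ.isBounded.isCompact_closure
  have hloc : ∀ x₀ ∈ closure Ω, ∃ r > 0, ∃ C, 0 ≤ C ∧ ∀ z : Hm Ω m, ∀ᵐ x ∂(volume.restrict Ω),
      x ∈ Metric.ball x₀ r → |damageFn z x| ≤ C * ‖z‖ := by
    intro x₀ hx₀
    obtain ⟨r, a, b, hr, hb, hcone⟩ := hΩ.cone hx₀
    obtain ⟨φ, hφ, h1, h0, hs⟩ := exists_kernel a hb
    obtain ⟨C, hC, hz⟩ := exists_bound_of_kernel hφ h1 h0 hmΩ hfin hm1 hm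
    refine ⟨r, hr, C, hC, fun z => ?_⟩
    filter_upwards [hz z, ae_restrict_mem hmΩ] with x hx hxΩ hxr
    refine hx fun h hh y hy => ?_
    rcases hs hy with h2 | h2
    · exact hcone x ⟨hxΩ, hxr⟩ h ⟨hh.1, hh.2.trans (by norm_num)⟩ y h2
    -- On the dilated half of the support, `h • y = (2h) • (y/2)`; this is why the cone condition is
    -- stated for scales up to `2`.
    · have := hcone x ⟨hxΩ, hxr⟩ (2 * h) ⟨by linarith [hh.1], by linarith [hh.2]⟩ _ h2
      rwa [smul_smul, mul_comm (2 : ℝ) h, mul_assoc, mul_inv_cancel₀ (by norm_num), mul_one] at this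
  choose! r hr C hC hz using hloc
  obtain ⟨t, ht, hcover⟩ := hcpt.elim_nhds_subcover (fun x => Metric.ball x (r x))
    fun x hx => Metric.ball_mem_nhds x (hr x hx)
  refine ⟨∑ x ∈ t, C x, Finset.sum_nonneg fun x hx => hC x (ht x hx), fun z => ?_⟩
  have hall : ∀ᵐ x ∂(volume.restrict Ω), ∀ x₀ ∈ t, x ∈ Metric.ball x₀ (r x₀) →
      |damageFn z x| ≤ C x₀ * ‖z‖ :=
    (Finset.eventually_all t).2 fun x₀ hx₀ => hz x₀ (ht x₀ hx₀) z
  filter_upwards [hall, ae_restrict_mem hmΩ] with x hx hxΩ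
  obtain ⟨x₀, hx₀, hxb⟩ := mem_iUnion₂.1 (hcover (subset_closure hxΩ))
  refine (hx x₀ hx₀ hxb).trans ?_
  gcongr
  exact Finset.single_le_sum (f := C) (fun y hy => hC y (ht y hy)) hx₀

end Embedding

/-! ### Completeness of the state space -/

section Complete

variable {n : ℕ}

theorem continuous_integral_mul {X : Type*} [MeasurableSpace X] {ρ : Measure X} {E : Type*}
    [NormedAddCommGroup E] [NormedSpace ℝ E] (L : E →L[ℝ] ℝ) {g : X → ℝ} (hg : MemLp g 2 ρ) :
    Continuous fun u : Lp E 2 ρ => ∫ x, L (u x) * g x ∂ρ := by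
  have h : (fun u : Lp E 2 ρ => ∫ x, L (u x) * g x ∂ρ) = fun u =>
      ((ContinuousLinearMap.mul ℝ ℝ).comp L).lpPairing ρ 2 2 u hg.toLp := by
    ext u
    rw [ContinuousLinearMap.lpPairing_eq_integral]
    refine integral_congr_ae ?_
    filter_upwards [hg.coeFn_toLp] with x hx
    simp [hx]
  rw [h]
  fun_prop

theorem isClosed_H1 (Ω : Set (Vec n)) : IsClosed (H1 Ω : Set (WithLp 2
    (Lp (Vec n) 2 (volume.restrict Ω) × Lp (Mat n) 2 (volume.restrict Ω)))) := by
  have h : (H1 Ω : Set (WithLp 2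
      (Lp (Vec n) 2 (volume.restrict Ω) × Lp (Mat n) 2 (volume.restrict Ω)))) =
      ⋂ (i : Fin n) (j : Fin n) (φ : Vec n → ℝ) (_ : IsTestFun φ) (_ : tsupport φ ⊆ Ω),
        {u | ∫ x in Ω, u.fst x i * pd φ j x = - ∫ x in Ω, u.snd x (i, j) * φ x} := by
    ext u
    simp only [mem_iInter]
    rfl
  rw [h]
  refine isClosed_iInter fun i => isClosed_iInter fun j => isClosed_iInter fun φ =>
    isClosed_iInter fun hφ => isClosed_iInter fun _ => isClosed_eq ?_ ?_
  · exact (continuous_integral_mul (EuclideanSpace.proj (𝕜 := ℝ) i) (hφ.memLp_pd j Ω)).comp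
      (WithLp.fstL 2 ℝ _ _).continuous
  · exact ((continuous_integral_mul (EuclideanSpace.proj (𝕜 := ℝ) (i, j)) (hφ.memLp Ω)).comp
      (WithLp.sndL 2 ℝ _ _).continuous).neg

instance (Ω : Set (Vec n)) : CompleteSpace (H1 Ω) := (isClosed_H1 Ω).completeSpace_coe

theorem isClosed_H1Dir (Ω Γ : Set (Vec n)) : IsClosed (H1Dir Ω Γ : Set (H1 Ω)) :=
  (Submodule.isClosed_topologicalClosure _).preimage
    (ContinuousLinearMap.inl ℝ (H1 Ω) (Lp (Vec n) 2 (surfaceMeasure Γ))).continuous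

instance (Ω Γ : Set (Vec n)) : CompleteSpace (H1Dir Ω Γ) := (isClosed_H1Dir Ω Γ).completeSpace_coe

/-- The gradient is bounded in `L²(Ω)` by the function and the difference quotient of its gradient. -/
theorem exists_gradient_bound {Ω : Set (Vec n)} (hΩ : IsOpen Ω) (hne : Ω.Nonempty)
    (hb : Bornology.IsBounded Ω) {m : ℝ} (hm : 0 < (n : ℝ) / 2 + m - 1) :
    ∃ C : ℝ, ∀ (z : Lp ℝ 2 (volume.restrict Ω)) (ζ : Lp (Vec n) 2 (volume.restrict Ω))
      (Q : Lp (Vec n) 2 ((volume.restrict Ω).prod (volume.restrict Ω))),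
      (∀ j, IsWeakPd Ω j (fun x => z x) (fun x => ζ x j)) →
      (Q : Vec n × Vec n → Vec n) =ᵐ[(volume.restrict Ω).prod (volume.restrict Ω)] quot m ζ →
      ‖ζ‖ ≤ C * (‖z‖ + ‖Q‖) := by
  have hmΩ := hΩ.measurableSet
  have hfin : IsFiniteMeasure (volume.restrict Ω) :=
    ⟨by rw [Measure.restrict_apply_univ]; exact hb.measure_lt_top⟩
  set ρ := volume.restrict Ω with hρ
  obtain ⟨x₀, hx₀⟩ := hne
  obtain ⟨r, hr, hball⟩ := Metric.isOpen_iff.1 hΩ x₀ hx₀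
  let ψ : ContDiffBump x₀ := ⟨r / 4, r / 2, by linarith, by linarith⟩
  set φ : Vec n → ℝ := ψ.normed volume with hφ₀
  have hφ : IsTestFun φ := ⟨ψ.contDiff_normed, ψ.hasCompactSupport_normed⟩
  have hsupp : tsupport φ ⊆ Ω := by
    rw [show tsupport φ = Metric.closedBall x₀ (r / 2) from ψ.tsupport_normed_eq]
    exact (Metric.closedBall_subset_ball (by linarith)).trans hball
  have hφm : MemLp φ 2 ρ := hφ.memLp Ω
  have hφ1 : ∫ y, φ y ∂ρ = 1 := by
    have h1 : ∫ y, φ y = 1 := ψ.integral_normed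
    rw [← h1]
    refine setIntegral_eq_integral_of_forall_compl_eq_zero fun y hy => ?_
    by_contra h
    exact hy (hsupp (subset_tsupport _ h))
  obtain ⟨d, hd⟩ := Metric.isBounded_iff.1 hb
  have hd0 : 0 ≤ d := dist_nonneg.trans (hd hx₀ hx₀)
  set a := (n : ℝ) / 2 + m - 1 with ha
  set I := Real.sqrt (∫ y, ‖φ y‖ ^ 2 ∂ρ) with hI
  set J := ∑ j, Real.sqrt (∫ y, ‖pd φ j y‖ ^ 2 ∂ρ) with hJ
  set v := Real.sqrt (ρ.real univ) with hv
  refine ⟨d ^ a * I + v * J, fun z ζ Q hw hQ => ?_⟩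
  have hζ := Lp.memLp ζ
  have hζi : Integrable ζ ρ := hζ.integrable (by norm_num)
  have hφi : Integrable φ ρ := hφm.integrable (by norm_num)
  have hφζ : Integrable (fun y => φ y • ζ y) ρ := by
    obtain ⟨A, -, hA⟩ := hφ.bounded
    exact hζi.bdd_smul A hφm.1 (.of_forall hA)
  -- A Poincaré argument: `c` is a weighted mean of the gradient, with a weight compactly supported
  -- in `Ω`. An integration by parts bounds it by `‖z‖`.
  set c : Vec n := ∫ y, φ y • ζ y ∂ρ with hc
  have hcb : ‖c‖ ≤ ‖z‖ * J := by
    have h1 : ∀ j, |c j| ≤ ‖z‖ * Real.sqrt (∫ y, ‖pd φ j y‖ ^ 2 ∂ρ) := by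
      intro j
      have h2 : c j = - ∫ y, z y * pd φ j y ∂ρ := by
        rw [hw j φ hφ hsupp, neg_neg]
        have := (EuclideanSpace.proj (𝕜 := ℝ) j).integral_comp_comm hφζ
        rw [← hc] at this
        change EuclideanSpace.proj (𝕜 := ℝ) j c = _
        rw [← this]
        refine integral_congr_ae (.of_forall fun y => ?_)
        simp [mul_comm]
      rw [h2, abs_neg, ← Real.norm_eq_abs]
      refine (norm_integral_le_integral_norm _).trans ?_
      simp_rw [norm_mul]
      rw [Lp.norm_eq_sqrt_integral]
      exact integral_norm_mul_norm_le' (Lp.memLp z) (hφ.memLp_pd j Ω)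
    calc ‖c‖ ≤ ∑ j, |c j| := by
          rw [EuclideanSpace.norm_eq]
          have := Finset.sum_nonneg fun j (_ : j ∈ Finset.univ) => abs_nonneg (c j)
          refine Real.sqrt_le_iff.2 ⟨this, ?_⟩
          simp only [Real.norm_eq_abs]
          exact Finset.sum_sq_le_sq_sum_of_nonneg fun j _ => abs_nonneg _
      _ ≤ _ := by
          rw [hJ, Finset.mul_sum]
          exact Finset.sum_le_sum fun j _ => h1 j
  have hQi : Integrable (fun p => ‖Q p‖ ^ 2) (ρ.prod ρ) := (Lp.memLp Q).integrable_norm_pow (by norm_num)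
  set G : Vec n → ℝ := fun x => ∫ y, ‖Q (x, y)‖ ^ 2 ∂ρ with hG
  have hGi : Integrable G ρ := hQi.integral_prod_left
  -- Only the oscillation `ζ - c` remains. It is controlled by the difference quotient, as distances
  -- in `Ω` are at most `d`.
  have hpt : ∀ᵐ x ∂ρ, ‖ζ x - c‖ ≤ d ^ a * I * Real.sqrt (G x) := by
    have hQ' := Measure.ae_ae_of_ae_prod hQ
    have hm' : ∀ᵐ x ∂ρ, AEStronglyMeasurable (fun y => Q (x, y)) ρ :=
      (Lp.aestronglyMeasurable Q).prodMk_left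
    filter_upwards [hQ', hm', hQi.prod_right_ae, ae_restrict_mem hmΩ] with x hx hxm hxi hxΩ
    have hxQ : MemLp (fun y => Q (x, y)) 2 ρ := (memLp_two_iff_integrable_sq_norm hxm).2 hxi
    have h1 : ζ x - c = ∫ y, φ y • (ζ x - ζ y) ∂ρ := by
      simp_rw [smul_sub]
      rw [integral_sub (hφi.smul_const _) hφζ, integral_smul_const, hφ1, one_smul]
    have hint := integrable_norm_mul_norm hφm hxQ
    rw [h1]
    refine (norm_integral_le_of_norm_le (hint.const_mul (d ^ a)) ?_).trans ?_
    · filter_upwards [hx, ae_restrict_mem hmΩ] with y hy hyΩ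
      have h2 := norm_sub_le_of_quot hm ζ (x, y) (d := d) (by
        rw [← dist_eq_norm]; exact hd hxΩ hyΩ)
      rw [← hy] at h2
      rw [norm_smul]
      calc ‖φ y‖ * ‖ζ x - ζ y‖ ≤ ‖φ y‖ * (d ^ a * ‖Q (x, y)‖) :=
            mul_le_mul_of_nonneg_left h2 (norm_nonneg _)
        _ = _ := by ring
    · rw [integral_const_mul, mul_assoc]
      exact mul_le_mul_of_nonneg_left (integral_norm_mul_norm_le' hφm hxQ) (by positivity)
  have hcm : MemLp (fun _ : Vec n => c) 2 ρ := memLp_const c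
  have h3 : ‖ζ - hcm.toLp‖ ≤ d ^ a * I * ‖Q‖ := by
    have hI0 : 0 ≤ I := Real.sqrt_nonneg _
    refine le_of_sq_le_sq ?_ (by positivity)
    rw [Lp.norm_sq_eq_integral, mul_pow, Lp.norm_sq_eq_integral, integral_prod _ hQi,
      ← integral_const_mul]
    refine integral_mono_ae ((Lp.memLp _).integrable_norm_pow (by norm_num)) (hGi.const_mul _) ?_
    filter_upwards [hpt, Lp.coeFn_sub ζ hcm.toLp, hcm.coeFn_toLp] with x h1 h2 h4
    rw [h2, Pi.sub_apply, h4]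
    have hG0 : 0 ≤ G x := integral_nonneg fun _ => by positivity
    calc ‖ζ x - c‖ ^ 2 ≤ (d ^ a * I * Real.sqrt (G x)) ^ 2 := by gcongr
      _ = _ := by rw [mul_pow, Real.sq_sqrt hG0]
  have h4 : ‖hcm.toLp‖ ≤ v * ‖c‖ := by
    refine le_of_sq_le_sq ?_ (by positivity)
    rw [Lp.norm_sq_eq_integral, mul_pow, hv, Real.sq_sqrt measureReal_nonneg]
    refine le_of_eq ?_
    rw [integral_congr_ae (g := fun _ => ‖c‖ ^ 2)]
    · simp
    · filter_upwards [hcm.coeFn_toLp] with x hx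
      rw [hx]
  have h5 : ‖ζ‖ ≤ ‖ζ - hcm.toLp‖ + ‖hcm.toLp‖ := by
    have := norm_add_le (ζ - hcm.toLp) hcm.toLp
    rwa [sub_add_cancel] at this
  have hv0 : 0 ≤ v := Real.sqrt_nonneg _
  have hI0 : 0 ≤ I := Real.sqrt_nonneg _
  have hJ0 : 0 ≤ J := Finset.sum_nonneg fun _ _ => Real.sqrt_nonneg _
  have h6 : v * ‖c‖ ≤ v * (‖z‖ * J) := by gcongr
  have h7 : 0 ≤ d ^ a * I * ‖z‖ := by positivity
  have h8 : 0 ≤ v * J * ‖Q‖ := by positivity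
  nlinarith

/-- The gradient is not part of the stored pair, so its convergence has to be recovered: the
gradient bound makes the gradients a Cauchy sequence. The weak derivatives pass to the limit in
`L²`, and the formula for the quotient passes to the limit along an almost everywhere convergent
subsequence. -/
theorem isClosed_Hm {Ω : Set (Vec n)} (hΩ : IsOpen Ω) (hne : Ω.Nonempty)
    (hb : Bornology.IsBounded Ω) {m : ℝ} (hm : 0 < (n : ℝ) / 2 + m - 1) :
    IsClosed (Hm Ω m : Set (WithLp 2 (Lp ℝ 2 (volume.restrict Ω) ×
      Lp (Vec n) 2 ((volume.restrict Ω).prod (volume.restrict Ω))))) := by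
  obtain ⟨C, hC⟩ := exists_gradient_bound hΩ hne hb hm
  refine IsSeqClosed.isClosed fun z z₀ hz hlim => ?_
  choose ζ hw hQ using hz
  have hbound : ∀ k l, ‖ζ k - ζ l‖ ≤ C * (‖(z k).fst - (z l).fst‖ + ‖(z k).snd - (z l).snd‖) := by
    intro k l
    refine hC _ _ _ (fun j => ?_) ?_
    · have := ((hw k j).add (Lp.memLp _) (memLp_coord _ _) (MemLp.const_mul (Lp.memLp _) (-1))
        (MemLp.const_mul (memLp_coord _ _) (-1)) ((hw l j).smul (-1)))
      refine this.congr ?_ ?_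
      · filter_upwards [Lp.coeFn_sub (z k).fst (z l).fst] with x hx
        rw [hx, Pi.sub_apply]; ring
      · filter_upwards [Lp.coeFn_sub (ζ k) (ζ l)] with x hx
        rw [hx, Pi.sub_apply, PiLp.sub_apply]; ring
    · have ha := Lp.coeFn_sub (ζ k) (ζ l)
      filter_upwards [Lp.coeFn_sub (z k).snd (z l).snd, hQ k, hQ l,
        Measure.quasiMeasurePreserving_fst.ae_eq_comp ha,
        Measure.quasiMeasurePreserving_snd.ae_eq_comp ha] with xy h1 h2 h3 h4 h5
      simp only [Function.comp_apply, Pi.sub_apply] at h1 h4 h5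
      rw [h1, h2, h3]
      simp only [quot, h4, h5]
      rw [← smul_sub]
      congr 1
      abel
  have hf : Tendsto (fun k => (z k).fst) atTop (𝓝 z₀.fst) :=
    ((WithLp.fstL 2 ℝ _ _).continuous.tendsto z₀).comp hlim
  have hs : Tendsto (fun k => (z k).snd) atTop (𝓝 z₀.snd) :=
    ((WithLp.sndL 2 ℝ _ _).continuous.tendsto z₀).comp hlim
  have hcauchy : CauchySeq ζ := by
    have hC' : ∀ k l, dist (ζ k) (ζ l) ≤ |C| * (dist (z k).fst (z l).fst + dist (z k).snd (z l).snd) := by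
      intro k l
      rw [dist_eq_norm, dist_eq_norm, dist_eq_norm]
      refine (hbound k l).trans ?_
      gcongr
      exact le_abs_self C
    rw [cauchySeq_iff_tendsto_dist_atTop_0]
    have h1 := cauchySeq_iff_tendsto_dist_atTop_0.1 hf.cauchySeq
    have h2 := cauchySeq_iff_tendsto_dist_atTop_0.1 hs.cauchySeq
    refine squeeze_zero (fun _ => dist_nonneg) (fun p => hC' p.1 p.2) ?_
    simpa using (h1.add h2).const_mul |C|
  obtain ⟨ζ₀, hζ₀⟩ := cauchySeq_tendsto_of_complete hcauchy
  refine ⟨ζ₀, fun j φ hφ hsφ => ?_, ?_⟩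
  · have h1 := ((continuous_integral_mul (ContinuousLinearMap.id ℝ ℝ) (hφ.memLp_pd j Ω)).tendsto
      z₀.fst).comp hf
    have h2 := ((continuous_integral_mul (EuclideanSpace.proj (𝕜 := ℝ) j) (hφ.memLp Ω)).tendsto
      ζ₀).comp hζ₀
    exact tendsto_nhds_unique h1 (h2.neg.congr fun k => (hw k j φ hφ hsφ).symm)
  · obtain ⟨u, hu, hau⟩ := (tendstoInMeasure_of_tendsto_Lp hζ₀).exists_seq_tendsto_ae
    obtain ⟨u', hu', hau'⟩ :=
      (tendstoInMeasure_of_tendsto_Lp (hs.comp hu.tendsto_atTop)).exists_seq_tendsto_ae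
    have hQall : ∀ᵐ p ∂((volume.restrict Ω).prod (volume.restrict Ω)), ∀ k,
        (z k).snd p = quot m (ζ k) p := ae_all_iff.2 hQ
    filter_upwards [hau', hQall, Measure.quasiMeasurePreserving_fst.ae hau,
      Measure.quasiMeasurePreserving_snd.ae hau] with p h1 h2 h3 h4
    have h5 : Tendsto (fun k => quot m (ζ (u (u' k))) p) atTop (𝓝 (quot m ζ₀ p)) := by
      have := ((h3.sub h4).comp hu'.tendsto_atTop).const_smul
        (‖p.1 - p.2‖ ^ ((n : ℝ) / 2 + m - 1))⁻¹
      exact this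
    refine tendsto_nhds_unique h1 (h5.congr fun k => ?_)
    exact (h2 _).symm

end Complete

/-! ### Continuous differentiability from a quadratic estimate -/

section Quadratic

variable {X Y : Type*} [NormedAddCommGroup X] [NormedSpace ℝ X] [NormedAddCommGroup Y]
  [NormedSpace ℝ Y]

/-- No continuity of `D` is assumed: a remainder that is quadratic uniformly in the base point
forces `D` to be locally Lipschitz. This is seen by expanding `Φ (x + v)` from `x` and from `y`,
with `v` as long as `x - y`. -/
theorem contDiffAt_one_of_quadratic {Φ : X → Y} {D : X → X →L[ℝ] Y} {x₀ : X} {C r : ℝ} (hr : 0 < r)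
    (h : ∀ x ∈ Metric.ball x₀ r, ∀ y ∈ Metric.ball x₀ r, ‖Φ y - Φ x - D x (y - x)‖ ≤ C * ‖y - x‖ ^ 2) :
    ContDiffAt ℝ 1 Φ x₀ := by
  have hC : ∀ x ∈ Metric.ball x₀ r, ∀ y ∈ Metric.ball x₀ r,
      ‖Φ y - Φ x - D x (y - x)‖ ≤ |C| * ‖y - x‖ ^ 2 := fun x hx y hy =>
    (h x hx y hy).trans (by gcongr; exact le_abs_self C)
  refine contDiffAt_one_iff.2 ⟨D, Metric.ball x₀ (r / 2), Metric.ball_mem_nhds _ (by linarith), ?_, ?_⟩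
  · have hlip : ∀ x ∈ Metric.ball x₀ (r / 2), ∀ y ∈ Metric.ball x₀ (r / 2), dist x y < r / 2 →
        ‖D x - D y‖ ≤ 6 * |C| * dist x y := by
      intro x hx y hy hxy
      rcases eq_or_ne x y with rfl | hne
      · simp
      set s := ‖x - y‖ with hs
      have hs0 : 0 < s := norm_pos_iff.2 (sub_ne_zero.2 hne)
      have hsr : s < r / 2 := by rwa [hs, ← dist_eq_norm]
      have hxb : x ∈ Metric.ball x₀ r := Metric.ball_subset_ball (by linarith) hx
      have hyb : y ∈ Metric.ball x₀ r := Metric.ball_subset_ball (by linarith) hy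
      have key : ∀ v : X, ‖v‖ = s → ‖(D x - D y) v‖ ≤ 6 * |C| * s * ‖v‖ := by
        intro v hv
        have hxv : x + v ∈ Metric.ball x₀ r := by
          rw [mem_ball_iff_norm]
          have h1 := mem_ball_iff_norm.1 hx
          calc ‖x + v - x₀‖ = ‖(x - x₀) + v‖ := by congr 1; abel
            _ ≤ ‖x - x₀‖ + ‖v‖ := norm_add_le _ _
            _ < r := by linarith
        have e1 := hC x hxb (x + v) hxv
        have e2 := hC y hyb (x + v) hxv
        have e3 := hC y hyb x hxb
        rw [add_sub_cancel_left, hv] at e1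
        have h2 : ‖x + v - y‖ ≤ 2 * s := by
          calc ‖x + v - y‖ = ‖(x - y) + v‖ := by congr 1; abel
            _ ≤ ‖x - y‖ + ‖v‖ := norm_add_le _ _
            _ = 2 * s := by rw [hv, ← hs]; ring
        have e2' : ‖Φ (x + v) - Φ y - D y (x + v - y)‖ ≤ |C| * (2 * s) ^ 2 :=
          e2.trans (by gcongr)
        -- With `‖v‖ = ‖x - y‖ = s`, the three remainders are at most `4`, `1` and `1` times `|C|
        -- s²`; hence the constant `6`.
        have heq : (D x - D y) v = (Φ (x + v) - Φ y - D y (x + v - y)) -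
            (Φ (x + v) - Φ x - D x v) - (Φ x - Φ y - D y (x - y)) := by
          have : x + v - y = (x - y) + v := by abel
          rw [this, map_add, sub_apply]
          abel
        rw [heq, hv]
        refine (norm_sub_le _ _).trans ?_
        have := norm_sub_le (Φ (x + v) - Φ y - D y (x + v - y)) (Φ (x + v) - Φ x - D x v)
        nlinarith
      rw [dist_eq_norm, ← hs]
      refine ContinuousLinearMap.opNorm_le_bound _ (by positivity) fun v => ?_
      rcases eq_or_ne v 0 with rfl | hv
      · simp
      have hv0 : 0 < ‖v‖ := norm_pos_iff.2 hv
      have := key ((s / ‖v‖) • v) (by rw [norm_smul, Real.norm_of_nonneg (by positivity)]; field_simp)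
      rw [map_smul, norm_smul, norm_smul, Real.norm_of_nonneg (by positivity)] at this
      have h3 : 0 < s / ‖v‖ := by positivity
      have h4 : s / ‖v‖ * ‖(D x - D y) v‖ ≤ s / ‖v‖ * (6 * |C| * s * ‖v‖) := by linarith
      exact le_of_mul_le_mul_left h4 h3
    refine Metric.continuousOn_iff.2 fun x hx ε hε => ?_
    refine ⟨min (r / 2) (ε / (6 * |C| + 1)), by positivity, fun y hy hyx => ?_⟩
    rw [dist_eq_norm]
    refine (hlip y hy x hx (hyx.trans_le (min_le_left _ _))).trans_lt ?_
    have h1 := hyx.trans_le (min_le_right _ _)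
    rw [lt_div_iff₀ (by positivity)] at h1
    nlinarith [dist_nonneg (x := y) (y := x)]
  · intro x hx
    have hxb : x ∈ Metric.ball x₀ r := Metric.ball_subset_ball (by linarith) hx
    rw [hasFDerivAt_iff_isLittleO]
    have h1 : (fun y => Φ y - Φ x - D x (y - x)) =O[𝓝 x] fun y => ‖y - x‖ ^ 2 := by
      refine Asymptotics.IsBigO.of_bound |C| ?_
      filter_upwards [Metric.isOpen_ball.mem_nhds hxb] with y hy
      rw [norm_pow, norm_norm]
      exact hC x hxb y hy
    refine h1.trans_isLittleO ?_
    have h2 : (fun v : X => ‖v‖ ^ 2) =o[𝓝 0] fun v => v := by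
      have := Asymptotics.isLittleO_norm_pow_id (E' := X) (n := 2) (by norm_num)
      exact this
    have h3 : Tendsto (fun y => y - x) (𝓝 x) (𝓝 0) := by
      have : Tendsto (fun y => y - x) (𝓝 x) (𝓝 (x - x)) := (continuous_id.sub continuous_const).tendsto x
      rwa [sub_self] at this
    exact h2.comp_tendsto h3

/-- Mean value inequality for `x ↦ f x - x • f' a`, whose derivative between `a` and `b` is at most
`L |b - a|`. -/
theorem norm_taylor_le {f f' : ℝ → Y} {s : Set ℝ} (hs : Convex ℝ s)
    (hf : ∀ x ∈ s, HasDerivWithinAt f (f' x) s x) {L : NNReal} (hL : LipschitzOnWith L f' s)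
    {a b : ℝ} (ha : a ∈ s) (hb : b ∈ s) : ‖f b - f a - (b - a) • f' a‖ ≤ L * |b - a| ^ 2 := by
  have hsub : uIcc a b ⊆ s := by
    rw [← segment_eq_uIcc]; exact hs.segment_subset ha hb
  have key := (convex_uIcc a b).norm_image_sub_le_of_norm_hasDerivWithin_le
    (f := fun x => f x - x • f' a) (f' := fun x => f' x - (1 : ℝ) • f' a) (C := L * |b - a|)
    (fun x hx => ((hf x (hsub hx)).mono hsub).sub ((hasDerivWithinAt_id x _).smul_const _))
    (fun x hx => by
      rw [one_smul]
      refine (hL.norm_sub_le (hsub hx) ha).trans ?_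
      gcongr
      exact abs_sub_left_of_mem_uIcc hx)
    left_mem_uIcc right_mem_uIcc
  calc ‖f b - f a - (b - a) • f' a‖ = ‖f b - b • f' a - (f a - a • f' a)‖ := by
        congr 1; rw [sub_smul]; abel
    _ ≤ L * |b - a| * ‖b - a‖ := key
    _ = _ := by rw [Real.norm_eq_abs]; ring

end Quadratic

/-! ### Superposition operators on `L^∞` -/

section Superposition

variable {X : Type*} [MeasurableSpace X] {ρ : Measure X}
variable {Y : Type*} [NormedAddCommGroup Y]

theorem memLp_top_comp_projIcc {lo hi : ℝ} (h : lo ≤ hi) {f : ℝ → Y} (hf : ContinuousOn f (Icc lo hi))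
    {z : X → ℝ} (hz : AEStronglyMeasurable z ρ) :
    MemLp (fun x => f (projIcc lo hi h (z x))) ⊤ ρ := by
  have hc : Continuous fun s => f (projIcc lo hi h s) :=
    hf.comp_continuous (continuous_subtype_val.comp continuous_projIcc) fun s => (projIcc lo hi h s).2
  obtain ⟨M, hM⟩ := isCompact_Icc.exists_bound_of_continuousOn hf
  exact memLp_top_of_bound (hc.comp_aestronglyMeasurable hz) M
    (.of_forall fun x => hM _ (projIcc lo hi h (z x)).2)

/-- The superposition operator `z ↦ f(z)`, with `f` frozen outside of an interval. -/
def superpos (ρ : Measure X) {lo hi : ℝ} (h : lo ≤ hi) {f : ℝ → Y} (hf : ContinuousOn f (Icc lo hi))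
    (z : Lp ℝ ⊤ ρ) : Lp Y ⊤ ρ :=
  (memLp_top_comp_projIcc h hf (Lp.aestronglyMeasurable z)).toLp

theorem coeFn_superpos {lo hi : ℝ} (h : lo ≤ hi) {f : ℝ → Y}
    (hf : ContinuousOn f (Icc lo hi)) (z : Lp ℝ ⊤ ρ) :
    (superpos ρ h hf z : X → Y) =ᵐ[ρ] fun x => f (projIcc lo hi h (z x)) :=
  (memLp_top_comp_projIcc h hf (Lp.aestronglyMeasurable z)).coeFn_toLp

theorem Lp.ae_norm_le_top (z : Lp Y ⊤ ρ) : ∀ᵐ x ∂ρ, ‖z x‖ ≤ ‖z‖ := by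
  filter_upwards [ae_le_eLpNormEssSup (f := (z : X → Y)) (μ := ρ)] with x hx
  have h1 := Lp.enorm_def z
  rw [eLpNorm_exponent_top] at h1
  rw [← h1] at hx
  exact enorm_le_iff_norm_le.1 hx

theorem Lp.norm_le_top {z : Lp Y ⊤ ρ} {M : ℝ} (hM : 0 ≤ M) (h : ∀ᵐ x ∂ρ, ‖z x‖ ≤ M) : ‖z‖ ≤ M := by
  rw [Lp.norm_def, eLpNorm_exponent_top]
  refine ENNReal.toReal_le_of_le_ofReal hM ?_
  refine eLpNormEssSup_le_of_ae_bound h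

/-- In `L^∞` a ball of radius `r` moves the values by less than `r` almost everywhere, so the
freezing of `f` outside the interval is invisible near `z₀`. This would fail in `L²`. -/
theorem mem_Icc_of_mem_ball {lo hi r : ℝ} {z₀ z : Lp ℝ ⊤ ρ}
    (hz₀ : ∀ᵐ x ∂ρ, lo + r ≤ z₀ x ∧ z₀ x ≤ hi - r) (hz : z ∈ Metric.ball z₀ r) :
    ∀ᵐ x ∂ρ, z x ∈ Icc lo hi := by
  filter_upwards [hz₀, Lp.ae_norm_le_top (z - z₀), Lp.coeFn_sub z z₀] with x h1 h2 h3
  rw [h3, Pi.sub_apply, Real.norm_eq_abs] at h2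
  have h4 := abs_le.1 (h2.trans (mem_ball_iff_norm.1 hz).le)
  constructor <;> linarith [h4.1, h4.2]

/-- The scalar Taylor estimate has the same constant at almost every point, so it is a quadratic
estimate in the norm of `L^∞`. The candidate derivative is multiplication by `f'(z)`. -/
theorem contDiffAt_superpos [NormedSpace ℝ Y] {lo hi : ℝ} (h : lo ≤ hi) {f f' : ℝ → Y} (hf : ContinuousOn f (Icc lo hi))
    (hd : ∀ s ∈ Icc lo hi, HasDerivWithinAt f (f' s) (Icc lo hi) s) {L : NNReal}
    (hL : LipschitzOnWith L f' (Icc lo hi)) {r : ℝ} (hr : 0 < r) {z₀ : Lp ℝ ⊤ ρ}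
    (hz₀ : ∀ᵐ x ∂ρ, lo + r ≤ z₀ x ∧ z₀ x ≤ hi - r) :
    ContDiffAt ℝ 1 (superpos ρ h hf) z₀ := by
  refine contDiffAt_one_of_quadratic (C := L) (D := fun z =>
    ((ContinuousLinearMap.lsmul ℝ ℝ (E := Y)).holderL ρ ⊤ ⊤ ⊤).flip (superpos ρ h hL.continuousOn z))
    hr fun z hz y hy => ?_
  refine Lp.norm_le_top (by positivity) ?_
  rw [ContinuousLinearMap.flip_apply, ContinuousLinearMap.holderL_apply_apply]
  set A := superpos ρ h hf y
  set B := superpos ρ h hf z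
  set D := (ContinuousLinearMap.lsmul ℝ ℝ (E := Y)).holder ⊤ (y - z) (superpos ρ h hL.continuousOn z)
  filter_upwards [mem_Icc_of_mem_ball hz₀ hz, mem_Icc_of_mem_ball hz₀ hy, Lp.ae_norm_le_top (y - z),
    Lp.coeFn_sub y z, coeFn_superpos h hf y, coeFn_superpos h hf z,
    coeFn_superpos h hL.continuousOn z, Lp.coeFn_sub (A - B) D, Lp.coeFn_sub A B,
    (ContinuousLinearMap.lsmul ℝ ℝ (E := Y)).coeFn_holder (r := ⊤) (y - z)
      (superpos ρ h hL.continuousOn z)] with x h1 h2 h3 h4 h5 h6 h7 h8 h9 h10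
  rw [h8, Pi.sub_apply, h9, Pi.sub_apply, h5, h6, h10, h7, h4]
  rw [h4, Real.norm_eq_abs] at h3
  simp only [Pi.sub_apply, ContinuousLinearMap.lsmul_apply] at h3 ⊢
  rw [projIcc_of_mem h h1, projIcc_of_mem h h2]
  refine (norm_taylor_le (convex_Icc _ _) hd hL h1 h2).trans ?_
  gcongr

end Superposition

/-! ### Generic facts on `L^p` spaces -/

section Generic

variable {X : Type*} [MeasurableSpace X] {ρ : Measure X}

theorem exists_top_embedding {Z : Type*} [NormedAddCommGroup Z] [NormedSpace ℝ Z] [IsFiniteMeasure ρ]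
    (d : Z →L[ℝ] Lp ℝ 2 ρ) {C : ℝ} (hC0 : 0 ≤ C) (hC : ∀ z, ∀ᵐ x ∂ρ, |d z x| ≤ C * ‖z‖) :
    ∃ j : Z →L[ℝ] Lp ℝ ⊤ ρ, ∀ z, (j z : X → ℝ) =ᵐ[ρ] d z := by
  have hmem : ∀ z, MemLp (d z) ⊤ ρ := fun z =>
    memLp_top_of_bound (Lp.aestronglyMeasurable _) (C * ‖z‖) (hC z)
  refine ⟨LinearMap.mkContinuous
    { toFun := fun z => (hmem z).toLp
      map_add' := fun z z' => ?_
      map_smul' := fun c z => ?_ } C fun z => ?_, fun z => (hmem z).coeFn_toLp⟩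
  · refine Lp.ext ?_
    filter_upwards [(hmem (z + z')).coeFn_toLp, (hmem z).coeFn_toLp, (hmem z').coeFn_toLp,
      Lp.coeFn_add (hmem z).toLp (hmem z').toLp, Lp.coeFn_add (d z) (d z')] with x h1 h2 h3 h4 h5
    rw [h1, h4, Pi.add_apply, h2, h3, map_add, h5, Pi.add_apply]
  · refine Lp.ext ?_
    filter_upwards [(hmem (c • z)).coeFn_toLp, (hmem z).coeFn_toLp,
      Lp.coeFn_smul c (hmem z).toLp, Lp.coeFn_smul c (d z)] with x h1 h2 h3 h4
    rw [h1, RingHom.id_apply, h3, Pi.smul_apply, h2, map_smul, h4, Pi.smul_apply]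
  · refine Lp.norm_le_top (by positivity) ?_
    filter_upwards [(hmem z).coeFn_toLp, hC z] with x h1 h2
    change ‖((hmem z).toLp : X → ℝ) x‖ ≤ _
    rw [h1]
    exact h2

/-- The quadratic form `∫ A e : e` of an operator-valued `L^∞` function. -/
theorem inner_holderL_eq_integral {E : Type*} [NormedAddCommGroup E] [InnerProductSpace ℝ E]
    (A : Lp (E →L[ℝ] E) ⊤ ρ) (e : Lp E 2 ρ) {a : X → E →L[ℝ] E} {ε : X → E} (ha : A =ᵐ[ρ] a)
    (he : e =ᵐ[ρ] ε) :
    inner ℝ ((ContinuousLinearMap.id ℝ (E →L[ℝ] E)).holderL ρ ⊤ 2 2 A e) e =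
      ∫ x, inner ℝ (a x (ε x)) (ε x) ∂ρ := by
  rw [L2.inner_def, ContinuousLinearMap.holderL_apply_apply]
  refine integral_congr_ae ?_
  filter_upwards [ha, he, (ContinuousLinearMap.id ℝ (E →L[ℝ] E)).coeFn_holder (r := 2) A e]
    with x h1 h2 h3
  rw [h3, h1, h2]
  rfl

theorem lpPairing_const_one [IsFiniteMeasure ρ] (f : Lp ℝ ⊤ ρ) {φ : X → ℝ} (hf : f =ᵐ[ρ] φ) :
    (ContinuousLinearMap.mul ℝ ℝ).lpPairing ρ ⊤ 1 f (memLp_const (1 : ℝ)).toLp = ∫ x, φ x ∂ρ := by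
  rw [ContinuousLinearMap.lpPairing_eq_integral]
  refine integral_congr_ae ?_
  filter_upwards [hf, (memLp_const (1 : ℝ) : MemLp _ 1 ρ).coeFn_toLp] with x h1 h2
  rw [h1, h2]
  simp

/-- Once the damage enters through `L^∞`, each term composes a `C¹` map with bounded multilinear
ones: the Hölder product `L^∞ × L² → L²`, scalar products, the duality with the load, and the
pairing with the constant `1`. -/
theorem contDiffAt_energy_form [IsFiniteMeasure ρ] {S E V V' U : Type*} [NormedAddCommGroup S]
    [NormedSpace ℝ S] [NormedAddCommGroup E] [InnerProductSpace ℝ E] [CompleteSpace E]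
    [NormedAddCommGroup V] [InnerProductSpace ℝ V]
    [NormedAddCommGroup V'] [InnerProductSpace ℝ V'] [NormedAddCommGroup U] [NormedSpace ℝ U]
    (j : S →L[ℝ] Lp ℝ ⊤ ρ) (e : S →L[ℝ] Lp E 2 ρ) (p : S →L[ℝ] V) (ζ : S →L[ℝ] V')
    (ℓ : S →L[ℝ] StrongDual ℝ U) (u : S →L[ℝ] U) (μ : ℝ) {NC : Lp ℝ ⊤ ρ → Lp (E →L[ℝ] E) ⊤ ρ}
    {NW : Lp ℝ ⊤ ρ → Lp ℝ ⊤ ρ} {x₀ : S} (hNC : ContDiffAt ℝ 1 NC (j x₀))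
    (hNW : ContDiffAt ℝ 1 NW (j x₀)) :
    ContDiffAt ℝ 1 (fun x =>
      (inner ℝ ((ContinuousLinearMap.id ℝ (E →L[ℝ] E)).holderL ρ ⊤ 2 2 (NC (j x)) (e x)) (e x) / 2
        + μ / 2 * ‖p x‖ ^ 2) + inner ℝ (ζ x) (ζ x) / 2 - ℓ x (u x)
      + (ContinuousLinearMap.mul ℝ ℝ).lpPairing ρ ⊤ 1 (NW (j x)) (memLp_const (1 : ℝ)).toLp) x₀ := by
  have c3 := ContDiffAt.comp x₀ hNC j.contDiff.contDiffAt
  have c4 := ContDiffAt.comp x₀ hNW j.contDiff.contDiffAt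
  have c2 : ContDiffAt ℝ 1 e x₀ := e.contDiff.contDiffAt
  have c5 : ContDiffAt ℝ 1 ζ x₀ := ζ.contDiff.contDiffAt
  refine ((((((((ContinuousLinearMap.contDiff _).contDiffAt.comp x₀ c3).clm_apply c2).inner ℝ
    c2).div_const 2).add (contDiffAt_const.mul (p.contDiff.contDiffAt.norm_sq ℝ))).add
    ((c5.inner ℝ c5).div_const 2)).sub (ℓ.contDiff.contDiffAt.clm_apply u.contDiff.contDiffAt)).add
    (((ContinuousLinearMap.contDiff _).contDiffAt.comp x₀ c4).clm_apply contDiffAt_const)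

theorem coe_add_coe_lintegral {a b : ℝ} {l : ℝ≥0∞} (hl : l = ENNReal.ofReal b) (hb : 0 ≤ b) :
    (a : EReal) + (l : EReal) = ((a + b : ℝ) : EReal) := by
  rw [hl, EReal.coe_ennreal_ofReal, max_eq_left hb, EReal.coe_add]

end Generic

/-! ### Differentiability of the energy -/

/-- The symmetric part as a continuous linear map. -/
def symPartL (n : ℕ) : Mat n →L[ℝ] SymMat n :=
  LinearMap.toContinuousLinearMap
    { toFun := symPart
      map_add' := fun A B => by
        refine Subtype.ext (PiLp.ext fun ij => ?_)
        change (A ij + B ij + (A ij.swap + B ij.swap)) / 2 =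
          (A ij + A ij.swap) / 2 + (B ij + B ij.swap) / 2
        ring
      map_smul' := fun c A => by
        refine Subtype.ext (PiLp.ext fun ij => ?_)
        change (c * A ij + c * A ij.swap) / 2 = c * ((A ij + A ij.swap) / 2)
        ring }

/-- The inclusion of deviatoric into symmetric matrices as a continuous linear map. -/
def devToSymL (n : ℕ) : DevMat n →L[ℝ] SymMat n :=
  LinearMap.toContinuousLinearMap
    { toFun := devToSym
      map_add' := fun _ _ => rfl
      map_smul' := fun _ _ => rfl }

instance (n : ℕ) : CompleteSpace (SymMat n) := FiniteDimensional.complete ℝ _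

instance (n : ℕ) : CompleteSpace (DevMat n) := FiniteDimensional.complete ℝ _

/-- The function underlying an element of `H^m(Ω)`, as a continuous linear map. -/
def damageL {n : ℕ} (Ω : Set (Vec n)) (m : ℝ) : Hm Ω m →L[ℝ] Lp ℝ 2 (volume.restrict Ω) :=
  (WithLp.fstL 2 ℝ _ _).comp (Hm Ω m).subtypeL

/-- The difference quotient of the gradient of an element of `H^m(Ω)`. -/
def quotL {n : ℕ} (Ω : Set (Vec n)) (m : ℝ) :
    Hm Ω m →L[ℝ] Lp (Vec n) 2 ((volume.restrict Ω).prod (volume.restrict Ω)) :=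
  (WithLp.sndL 2 ℝ _ _).comp (Hm Ω m).subtypeL

/-- The strain as a map into `L²`. -/
def strainL {n : ℕ} (Ω : Set (Vec n)) : H1 Ω →L[ℝ] Lp (SymMat n) 2 (volume.restrict Ω) :=
  ((symPartL n).compLpL 2 (volume.restrict Ω)).comp ((WithLp.sndL 2 ℝ _ _).comp (H1 Ω).subtypeL)

theorem coeFn_strainL {n : ℕ} {Ω : Set (Vec n)} (u : H1 Ω) :
    (strainL Ω u : Vec n → SymMat n) =ᵐ[volume.restrict Ω] strain u := by
  filter_upwards [(symPartL n).coeFn_compLp (p := 2) (μ := volume.restrict Ω) u.1.snd] with x hx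
  exact hx

namespace Model

variable {n : ℕ} (P : Model n)

/-- The energy as a function of the boundary datum, the load and the state. -/
def energyFn (x : H1 P.Ω × StrongDual ℝ (H1 P.Ω) × P.State) : ℝ :=
  ((∫ y in P.Ω, inner ℝ
      (P.C (damageFn x.2.2.2.1 y) (strain (x.2.2.1.1 + x.1) y - devToSym (x.2.2.2.2 y)))
      (strain (x.2.2.1.1 + x.1) y - devToSym (x.2.2.2.2 y))) / 2
    + ∫ y in P.Ω, P.μ / 2 * ‖x.2.2.2.2 y‖ ^ 2)
    + am x.2.2.2.1 x.2.2.2.1 / 2 - x.2.1 (x.2.2.1.1 + x.1)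
    + ∫ y in P.Ω, P.W (damageFn x.2.2.2.1 y)

/-- The total displacement. -/
def displL : H1 P.Ω × StrongDual ℝ (H1 P.Ω) × P.State →L[ℝ] H1 P.Ω :=
  ((H1Dir P.Ω P.ΓD).subtypeL.comp (ContinuousLinearMap.fst ℝ _ _)).comp
      ((ContinuousLinearMap.snd ℝ _ _).comp (ContinuousLinearMap.snd ℝ _ _))
    + ContinuousLinearMap.fst ℝ _ _

/-- The damage variable. -/
def damageVarL : H1 P.Ω × StrongDual ℝ (H1 P.Ω) × P.State →L[ℝ] Hm P.Ω P.m :=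
  (ContinuousLinearMap.fst ℝ _ _).comp ((ContinuousLinearMap.snd ℝ _ _).comp
    ((ContinuousLinearMap.snd ℝ _ _).comp (ContinuousLinearMap.snd ℝ _ _)))

/-- The plastic strain. -/
def plasticL : H1 P.Ω × StrongDual ℝ (H1 P.Ω) × P.State →L[ℝ] Lp (DevMat n) 2 P.vol :=
  (ContinuousLinearMap.snd ℝ _ _).comp ((ContinuousLinearMap.snd ℝ _ _).comp
    ((ContinuousLinearMap.snd ℝ _ _).comp (ContinuousLinearMap.snd ℝ _ _)))

/-- The load. -/
def loadL : H1 P.Ω × StrongDual ℝ (H1 P.Ω) × P.State →L[ℝ] StrongDual ℝ (H1 P.Ω) :=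
  (ContinuousLinearMap.fst ℝ _ _).comp (ContinuousLinearMap.snd ℝ _ _)

/-- The elastic strain as an element of `L²`. -/
def elasticL : H1 P.Ω × StrongDual ℝ (H1 P.Ω) × P.State →L[ℝ] Lp (SymMat n) 2 P.vol :=
  (strainL P.Ω).comp P.displL - ((devToSymL n).compLpL 2 P.vol).comp P.plasticL

theorem coeFn_elasticL (x : H1 P.Ω × StrongDual ℝ (H1 P.Ω) × P.State) :
    (P.elasticL x : Vec n → SymMat n) =ᵐ[P.vol]
      fun y => strain (x.2.2.1.1 + x.1) y - devToSym (x.2.2.2.2 y) :=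
  (Lp.coeFn_sub _ _).trans ((coeFn_strainL _).sub ((devToSymL n).coeFn_compLp _))

variable {P}

namespace Standing

theorem isFiniteMeasure (hP : P.Standing) : IsFiniteMeasure P.vol :=
  ⟨by rw [Measure.restrict_apply_univ]; exact hP.domain.isBounded.measure_lt_top⟩

theorem dim_pos (hP : P.Standing) : (1 : ℝ) ≤ (n : ℝ) / 2 := by
  rcases hP.dim with rfl | rfl <;> norm_num

theorem exponent_pos (hP : P.Standing) : 0 < (n : ℝ) / 2 + P.m - 1 := by
  have := hP.dim_pos
  have := hP.order
  linarith

theorem exists_embedding (hP : P.Standing) : ∃ j : Hm P.Ω P.m →L[ℝ] Lp ℝ ⊤ P.vol,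
    ∀ z, (j z : Vec n → ℝ) =ᵐ[P.vol] damageFn z := by
  have := hP.isFiniteMeasure
  obtain ⟨C, hC0, hC⟩ := hP.domain.exists_bound hP.exponent_pos hP.order
  exact exists_top_embedding (damageL P.Ω P.m) hC0 hC

/-- The damage variables of states in the domain are bounded away from `0` and `∞`, uniformly in a
neighbourhood. -/
theorem exists_interval_of_mem_domain (j : Hm P.Ω P.m →L[ℝ] Lp ℝ ⊤ P.vol)
    (hj : ∀ z, (j z : Vec n → ℝ) =ᵐ[P.vol] damageFn z) {q : P.State} (hq : q ∈ P.domain) :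
    ∃ lo hi r : ℝ, 0 < lo ∧ lo ≤ hi ∧ 0 < r ∧
      (∀ᵐ x ∂P.vol, lo + r ≤ j q.2.1 x ∧ j q.2.1 x ≤ hi - r) ∧
      ∀ᶠ q' in 𝓝 q, ∀ᵐ x ∂P.vol, damageFn q'.2.1 x ∈ Icc lo hi := by
  obtain ⟨c, hc, hcz⟩ := hq
  -- If `z ≥ c`, a margin `c / 2` on each side keeps nearby damage variables in `[c / 2, ‖z‖ + c]`,
  -- with the norm of `L^∞`.
  refine ⟨c / 2, ‖j q.2.1‖ + c, c / 2, by linarith, by linarith [norm_nonneg (j q.2.1)], by linarith, ?_, ?_⟩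
  · filter_upwards [hcz, hj q.2.1, Lp.ae_norm_le_top (j q.2.1)] with x h1 h2 h3
    rw [← h2] at h1
    refine ⟨by linarith, ?_⟩
    have := (le_abs_self _).trans h3
    linarith
  · have hcont : Continuous fun q' : P.State => j q'.2.1 := by fun_prop
    filter_upwards [hcont.continuousAt.preimage_mem_nhds (Metric.ball_mem_nhds (j q.2.1) (half_pos hc))]
      with q' hq'
    have h0 : ∀ᵐ x ∂P.vol, c / 2 + c / 2 ≤ j q.2.1 x ∧ j q.2.1 x ≤ (‖j q.2.1‖ + c) - c / 2 := by
      filter_upwards [hcz, hj q.2.1, Lp.ae_norm_le_top (j q.2.1)] with x h1 h2 h3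
      rw [← h2] at h1
      refine ⟨by linarith, ?_⟩
      have := (le_abs_self _).trans h3
      linarith
    filter_upwards [mem_Icc_of_mem_ball h0 hq', hj q'.2.1] with x h1 h2
    rwa [← h2]

theorem continuousOn_C (hP : P.Standing) {lo hi : ℝ} (hlo : 0 < lo) : ContinuousOn P.C (Icc lo hi) := by
  obtain ⟨C', L, hd, -⟩ := hP.elastic_smooth
  exact fun s hs => ((hd s (hlo.le.trans hs.1)).continuousWithinAt).mono fun x hx => hlo.le.trans hx.1

theorem continuousOn_W (hP : P.Standing) {lo hi : ℝ} (hlo : 0 < lo) : ContinuousOn P.W (Icc lo hi) :=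
  hP.W_smooth.continuousOn.mono fun _ hx => hlo.trans_le hx.1

theorem integrable_W (hP : P.Standing) {q : P.State} (hq : q ∈ P.domain) :
    Integrable (fun y => P.W (damageFn q.2.1 y)) P.vol := by
  have := hP.isFiniteMeasure
  obtain ⟨j, hj⟩ := hP.exists_embedding
  obtain ⟨lo, hi, r, hlo, hle, -, -, hev⟩ := exists_interval_of_mem_domain j hj hq
  have h1 := memLp_top_comp_projIcc (ρ := P.vol) hle (hP.continuousOn_W hlo)
    (Lp.aestronglyMeasurable (damageFn q.2.1))
  refine (h1.integrable le_top).congr ?_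
  filter_upwards [hev.self_of_nhds] with x hx
  rw [projIcc_of_mem hle hx]

/-- Above a positive constant the density is never `+∞` and its integral is finite, so the energy is
real. Time enters only through the data `w t` and `F t`, which are treated as independent variables.
-/
theorem energy_eq (hP : P.Standing) {q : P.State} (hq : q ∈ P.domain) (t : ℝ) :
    P.energy t q = ((P.energyFn (P.w t, P.F t, q) : ℝ) : EReal) := by
  obtain ⟨c, hc, hcz⟩ := hq
  have h1 : ∫⁻ x in P.Ω, P.Wext (damageFn q.2.1 x) =
      ENNReal.ofReal (∫ x in P.Ω, P.W (damageFn q.2.1 x)) := by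
    rw [ofReal_integral_eq_lintegral_ofReal (hP.integrable_W ⟨c, hc, hcz⟩)]
    · refine lintegral_congr_ae ?_
      filter_upwards [hcz] with x hx
      rw [Wext, if_pos (hc.trans_le hx)]
    · filter_upwards [hcz] with x hx
      exact hP.W_nonneg _ (hc.trans_le hx)
  have h2 : 0 ≤ ∫ x in P.Ω, P.W (damageFn q.2.1 x) :=
    integral_nonneg_of_ae (by filter_upwards [hcz] with x hx using hP.W_nonneg _ (hc.trans_le hx))
  exact coe_add_coe_lintegral h1 h2

theorem eventually_mem_domain (hP : P.Standing) {q : P.State} (hq : q ∈ P.domain) : ∀ᶠ q' in 𝓝 q, q' ∈ P.domain := by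
  obtain ⟨j, hj⟩ := hP.exists_embedding
  obtain ⟨lo, hi, r, hlo, hle, -, -, hev⟩ := exists_interval_of_mem_domain j hj hq
  filter_upwards [hev] with q' hq'
  exact ⟨lo, hlo, hq'.mono fun x hx => hx.1⟩

end Standing

end Model

namespace Model

variable {n : ℕ} {P : Model n}

namespace Standing

theorem contDiffAt_superpos_C (hP : P.Standing) {lo hi r : ℝ} (hlo : 0 < lo) (hle : lo ≤ hi) (hr : 0 < r)
    {g : Lp ℝ ⊤ P.vol} (hint : ∀ᵐ x ∂P.vol, lo + r ≤ g x ∧ g x ≤ hi - r) :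
    ContDiffAt ℝ 1 (superpos P.vol hle (hP.continuousOn_C hlo)) g := by
  have := hP.isFiniteMeasure
  have hsub : Icc lo hi ⊆ Ici 0 := fun s hs => hlo.le.trans hs.1
  obtain ⟨C', L, hCd, hCL⟩ := hP.elastic_smooth
  exact contDiffAt_superpos hle _ (fun s hs => (hCd s (hsub hs)).mono hsub) (hCL.mono hsub) hr hint

/-- `W'` is of class `C¹` on `(0,∞)`, hence Lipschitz on compact subintervals; the blow-up at `0`
plays no role there. -/
theorem contDiffAt_superpos_W (hP : P.Standing) {lo hi r : ℝ} (hlo : 0 < lo) (hle : lo ≤ hi) (hr : 0 < r)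
    {g : Lp ℝ ⊤ P.vol} (hint : ∀ᵐ x ∂P.vol, lo + r ≤ g x ∧ g x ≤ hi - r) :
    ContDiffAt ℝ 1 (superpos P.vol hle (hP.continuousOn_W hlo)) g := by
  have := hP.isFiniteMeasure
  have hsub : Icc lo hi ⊆ Ioi 0 := fun s hs => hlo.trans_le hs.1
  have hWd : ContDiffOn ℝ 1 (deriv P.W) (Ioi 0) := by
    have h2 : ContDiffOn ℝ (1 + 1) P.W (Ioi 0) := by
      have := hP.W_smooth
      norm_num
      exact this
    exact ((contDiffOn_succ_iff_deriv_of_isOpen isOpen_Ioi).1 h2).2.2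
  obtain ⟨K, hK⟩ := (hWd.mono hsub).exists_lipschitzOnWith (by norm_num) (convex_Icc lo hi) isCompact_Icc
  exact contDiffAt_superpos hle _ (fun s hs => by
    have h1 := (hP.W_smooth.differentiableOn (by norm_num)) s (hsub hs)
    exact (h1.differentiableAt (Ioi_mem_nhds (hsub hs))).hasDerivAt.hasDerivWithinAt) hK hr hint

set_option maxHeartbeats 1000000 in
theorem contDiffAt_energyFn_of_interval (hP : P.Standing)
    {x₀ : H1 P.Ω × StrongDual ℝ (H1 P.Ω) × P.State} (j : Hm P.Ω P.m →L[ℝ] Lp ℝ ⊤ P.vol)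
    (hj : ∀ z, (j z : Vec n → ℝ) =ᵐ[P.vol] damageFn z) {lo hi r : ℝ} (hlo : 0 < lo) (hle : lo ≤ hi)
    (hr : 0 < r) (hint : ∀ᵐ x ∂P.vol, lo + r ≤ j x₀.2.2.2.1 x ∧ j x₀.2.2.2.1 x ≤ hi - r)
    (hev : ∀ᶠ q' in 𝓝 x₀.2.2, ∀ᵐ x ∂P.vol, damageFn q'.2.1 x ∈ Icc lo hi) :
    ContDiffAt ℝ 1 P.energyFn x₀ := by
  have := hP.isFiniteMeasure
  have hNC := hP.contDiffAt_superpos_C hlo hle hr hint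
  have hNW := hP.contDiffAt_superpos_W hlo hle hr hint
  have hΦ := contDiffAt_energy_form (j.comp P.damageVarL) P.elasticL P.plasticL
    ((quotL P.Ω P.m).comp P.damageVarL) P.loadL P.displL P.μ (x₀ := x₀) hNC hNW
  -- The frozen superpositions give the true energy for all states near `x₀`, which suffices for
  -- differentiability.
  refine hΦ.congr_of_eventuallyEq ?_
  have hcont : Tendsto (fun x : H1 P.Ω × StrongDual ℝ (H1 P.Ω) × P.State => x.2.2) (𝓝 x₀) (𝓝 x₀.2.2) := by
    exact (continuous_snd.comp continuous_snd).tendsto x₀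
  filter_upwards [hcont.eventually hev] with x hx
  have hN : ∀ {Y : Type} [NormedAddCommGroup Y] {f : ℝ → Y} (hf : ContinuousOn f (Icc lo hi)),
      (superpos P.vol hle hf (j x.2.2.2.1) : Vec n → Y) =ᵐ[P.vol] fun y => f (damageFn x.2.2.2.1 y) := by
    intro Y _ f hf
    filter_upwards [hx, coeFn_superpos hle hf (j x.2.2.2.1), hj x.2.2.2.1] with y h1 h2 h3
    rw [h2, h3, projIcc_of_mem hle h1]
  have e1 := inner_holderL_eq_integral _ _ (hN (hP.continuousOn_C hlo)) (P.coeFn_elasticL x)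
  have e2 : P.μ / 2 * ‖x.2.2.2.2‖ ^ 2 = ∫ y in P.Ω, P.μ / 2 * ‖x.2.2.2.2 y‖ ^ 2 := by
    rw [integral_const_mul, Lp.norm_sq_eq_integral]
  have e3 := lpPairing_const_one _ (hN (hP.continuousOn_W hlo))
  exact congrArg₂ (· + ·) (congrArg₂ (· - ·) (congrArg₂ (· + ·) (congrArg₂ (· + ·)
    (congrArg (· / 2) e1.symm) e2.symm) rfl) rfl) e3.symm

theorem contDiffAt_energyFn (hP : P.Standing) {x₀ : H1 P.Ω × StrongDual ℝ (H1 P.Ω) × P.State}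
    (hx₀ : x₀.2.2 ∈ P.domain) : ContDiffAt ℝ 1 P.energyFn x₀ := by
  have h1 := hP.exists_embedding
  obtain ⟨j, hj⟩ := h1
  have h2 := exists_interval_of_mem_domain j hj hx₀
  obtain ⟨lo, hi, r, hlo, hle, hr, hint, hev⟩ := h2
  exact hP.contDiffAt_energyFn_of_interval j hj hlo hle hr hint hev

end Standing

end Model

/-! ### The chain rule along absolutely continuous curves -/

theorem AbsolutelyContinuousOnInterval.of_dist_le_add {X Y Z : Type*} [PseudoMetricSpace X]
    [PseudoMetricSpace Y] [PseudoMetricSpace Z] {f : ℝ → X} {g : ℝ → Y} {h : ℝ → Z} {a b : ℝ}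
    (hf : AbsolutelyContinuousOnInterval f a b) (hg : AbsolutelyContinuousOnInterval g a b)
    (hh : ∀ x ∈ uIcc a b, ∀ y ∈ uIcc a b, dist (h x) (h y) ≤ dist (f x) (f y) + dist (g x) (g y)) :
    AbsolutelyContinuousOnInterval h a b := by
  unfold AbsolutelyContinuousOnInterval at hf hg ⊢
  refine squeeze_zero' (.of_forall fun _ => Finset.sum_nonneg fun _ _ => dist_nonneg) ?_
    (by simpa using hf.add hg)
  rw [eventually_inf_principal]
  filter_upwards with E hE
  rw [← Finset.sum_add_distrib]
  exact Finset.sum_le_sum fun i hi => hh _ (hE.1 i hi).1 _ (hE.1 i hi).2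

theorem AbsolutelyContinuousOnInterval.prodMk {X Y : Type*} [PseudoMetricSpace X]
    [PseudoMetricSpace Y] {f : ℝ → X} {g : ℝ → Y} {a b : ℝ}
    (hf : AbsolutelyContinuousOnInterval f a b) (hg : AbsolutelyContinuousOnInterval g a b) :
    AbsolutelyContinuousOnInterval (fun s => (f s, g s)) a b :=
  AbsolutelyContinuousOnInterval.of_dist_le_add hf hg fun _ _ _ _ =>
    max_le_add_of_nonneg dist_nonneg dist_nonneg

theorem AbsolutelyContinuousOnInterval.exists_monotoneOn {X : Type*}
    [NormedAddCommGroup X] {q : ℝ → X} {a b : ℝ}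
    (hq : AbsolutelyContinuousOnInterval q a b) :
    ∃ v : ℝ → ℝ, MonotoneOn v (uIcc a b) ∧
      ∀ x ∈ uIcc a b, ∀ y ∈ uIcc a b, dist (q x) (q y) ≤ |v y - v x| := by
  have hbv : LocallyBoundedVariationOn q (uIcc a b) :=
    BoundedVariationOn.locallyBoundedVariationOn (AbsolutelyContinuousOnInterval.boundedVariationOn hq)
  set v : ℝ → ℝ := variationOnFromTo q (uIcc a b) a with hv_def
  have main : ∀ x ∈ uIcc a b, ∀ y ∈ uIcc a b, x ≤ y → dist (q x) (q y) ≤ |v y - v x| := by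
    intro x hx y hy hxy
    have h1 : v y - v x = variationOnFromTo q (uIcc a b) x y :=
      variationOnFromTo.sub_right hbv left_mem_uIcc hy hx
    rw [h1, abs_of_nonneg (variationOnFromTo.nonneg_of_le _ _ hxy),
      variationOnFromTo.eq_of_le _ _ hxy, dist_edist]
    refine ENNReal.toReal_mono (hbv x y hx hy) ?_
    exact eVariationOn.edist_le q ⟨hx, left_mem_Icc.2 hxy⟩ ⟨hy, right_mem_Icc.2 hxy⟩
  refine ⟨v, variationOnFromTo.monotoneOn hbv left_mem_uIcc, fun x hx y hy => ?_⟩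
  rcases le_total x y with h | h
  · exact main x hx y hy h
  · rw [dist_comm, abs_sub_comm]; exact main y hy x hx h

/-- The variation function has an integrable derivative that dominates `‖deriv q‖`. Where `q` is not
differentiable `deriv q` is `0` by default, so the bound needs no differentiability theorem. -/
theorem AbsolutelyContinuousOnInterval.intervalIntegrable_deriv_of_normedSpace {E : Type*}
    [NormedAddCommGroup E] [NormedSpace ℝ E] [CompleteSpace E] {q : ℝ → E} {a b : ℝ} (hab : a ≤ b)
    (hq : AbsolutelyContinuousOnInterval q a b) : IntervalIntegrable (deriv q) volume a b := by
  obtain ⟨v, hv, hvq⟩ := AbsolutelyContinuousOnInterval.exists_monotoneOn hq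
  refine hv.intervalIntegrable_deriv.mono_fun (aestronglyMeasurable_deriv _ _) ?_
  have hb : ∀ᵐ τ : ℝ, τ ≠ b := by simp [ae_iff]
  rw [uIoc_of_le hab]
  filter_upwards [ae_restrict_mem measurableSet_Ioc,
    ae_restrict_of_ae hv.ae_differentiableWithinAt_of_mem, ae_restrict_of_ae hb] with s hs h1 hsb
  have hs' : s ∈ Ioo a b := ⟨hs.1, lt_of_le_of_ne hs.2 hsb⟩
  have hsm : s ∈ uIcc a b := by rw [uIcc_of_le hab]; exact Ioo_subset_Icc_self hs'
  have hnhds : uIcc a b ∈ 𝓝 s := by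
    rw [uIcc_of_le hab]; exact Icc_mem_nhds hs'.1 hs'.2
  by_cases hd : DifferentiableAt ℝ q s
  · have hv' : HasDerivAt v (deriv v s) s := ((h1 hsm).differentiableAt hnhds).hasDerivAt
    refine le_of_tendsto_of_tendsto (hasDerivAt_iff_tendsto_slope.1 hd.hasDerivAt).norm
      (hasDerivAt_iff_tendsto_slope.1 hv').norm ?_
    filter_upwards [mem_nhdsWithin_of_mem_nhds hnhds] with r hr
    rw [slope_def_module, slope_def_module, norm_smul, norm_smul, ← dist_eq_norm, dist_comm]
    exact mul_le_mul_of_nonneg_left (hvq s hsm r hr) (norm_nonneg _)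
  · rw [deriv_zero_of_not_differentiableAt hd, norm_zero]
    exact norm_nonneg _

/-- A `C¹` map is locally Lipschitz, hence Lipschitz on the compact range of the curve. -/
theorem AbsolutelyContinuousOnInterval.comp_contDiffAt {E : Type*} [NormedAddCommGroup E] [NormedSpace ℝ E] {Φ : E → ℝ}
    {c : ℝ → E} {a b : ℝ} (hc : AbsolutelyContinuousOnInterval c a b)
    (hΦ : ∀ s ∈ uIcc a b, ContDiffAt ℝ 1 Φ (c s)) :
    AbsolutelyContinuousOnInterval (fun s => Φ (c s)) a b := by
  have hcomp : IsCompact (c '' uIcc a b) := isCompact_uIcc.image_of_continuousOn hc.continuousOn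
  obtain ⟨K, hK⟩ := LocallyLipschitzOn.exists_lipschitzOnWith_of_compact (f := Φ) hcomp (by
    rintro _ ⟨s, hs, rfl⟩
    obtain ⟨K, t, ht, hK⟩ := (hΦ s hs).exists_lipschitzOnWith
    exact ⟨K, t, mem_nhdsWithin_of_mem_nhds ht, hK⟩)
  exact AbsolutelyContinuousOnInterval.comp_lipschitz hc fun x hx y hy =>
    hK.dist_le_mul _ (mem_image_of_mem c hx) _ (mem_image_of_mem c hy)

/-! ### The chain rule for energies depending on time through data of class `H¹`. -/

section ChainRule

variable {A B Q : Type*} [NormedAddCommGroup A] [NormedSpace ℝ A] [NormedAddCommGroup B]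
  [NormedSpace ℝ B] [NormedAddCommGroup Q] [NormedSpace ℝ Q] {Φ : A × B × Q → ℝ} {En : ℝ → Q → ℝ}
  {Dm : Set Q} {a : ℝ → A} {b : ℝ → B}

theorem fderiv_state_eq (hΦ : ∀ x : A × B × Q, x.2.2 ∈ Dm → ContDiffAt ℝ 1 Φ x)
    (hDm : ∀ q ∈ Dm, ∀ᶠ q' in 𝓝 q, q' ∈ Dm) (hEn : ∀ q ∈ Dm, ∀ t, En t q = Φ (a t, b t, q)) {q : Q}
    (hq : q ∈ Dm) (t : ℝ) :
    fderiv ℝ (En t) q = (fderiv ℝ Φ (a t, b t, q)).comp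
      ((ContinuousLinearMap.inr ℝ A (B × Q)).comp (ContinuousLinearMap.inr ℝ B Q)) := by
  have h1 : HasFDerivAt Φ (fderiv ℝ Φ (a t, b t, q)) (a t, b t, q) :=
    ((hΦ (a t, b t, q) hq).differentiableAt (by norm_num)).hasFDerivAt
  have h2 : HasFDerivAt (fun q' : Q => (a t, b t, q'))
      ((ContinuousLinearMap.inr ℝ A (B × Q)).comp (ContinuousLinearMap.inr ℝ B Q)) q :=
    (hasFDerivAt_prodMk_right (a t) (b t, q)).comp q (hasFDerivAt_prodMk_right (b t) q)
  refine HasFDerivAt.fderiv ((h1.comp q h2).congr_of_eventuallyEq ?_)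
  filter_upwards [hDm q hq] with q' hq' using hEn q' hq' t

variable [CompleteSpace A] [CompleteSpace B] [CompleteSpace Q]

/-- Data and state form a single absolutely continuous curve `c` in `A × B × Q`, along which `Φ` is
absolutely continuous. Its derivative splits by linearity of `fderiv ℝ Φ` into the part of the data,
which is the power, and the part of the state. -/
theorem chain_rule {T S : ℝ} (hT : 0 < T) (hS : 0 < S)
    (hΦ : ∀ x : A × B × Q, x.2.2 ∈ Dm → ContDiffAt ℝ 1 Φ x)
    (hDm : ∀ q ∈ Dm, ∀ᶠ q' in 𝓝 q, q' ∈ Dm) (hEn : ∀ q ∈ Dm, ∀ t, En t q = Φ (a t, b t, q))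
    (ha : IsH1InTime T a) (hb : IsH1InTime T b) {t : ℝ → ℝ} {q : ℝ → Q}
    (ht : AbsolutelyContinuousOnInterval t 0 S) (hm : MonotoneOn t (Icc 0 S))
    (hmaps : MapsTo t (Icc 0 S) (Icc 0 T)) (hq : AbsolutelyContinuousOnInterval q 0 S)
    (hqd : ∀ᵐ s ∂(volume.restrict (Ioo 0 S)), DifferentiableAt ℝ q s)
    (hqD : ∀ s ∈ Icc 0 S, q s ∈ Dm) :
    ContinuousOn (fun s => fderiv ℝ (En (t s)) (q s)) (Icc 0 S) ∧
    IntervalIntegrable (fun s => fderiv ℝ (En (t s)) (q s) (deriv q s)) volume 0 S ∧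
    IntervalIntegrable (fun s => deriv (fun τ => En τ (q s)) (t s) * deriv t s) volume 0 S ∧
    ∀ s ∈ Icc 0 S, En (t s) (q s) = En (t 0) (q 0)
      + (∫ τ in (0 : ℝ)..s, deriv (fun r => En r (q τ)) (t τ) * deriv t τ)
      + ∫ τ in (0 : ℝ)..s, fderiv ℝ (En (t τ)) (q τ) (deriv q τ) := by
  obtain ⟨haA, had⟩ := ha.along_curve hT hS ht hm hmaps
  obtain ⟨hbA, hbd⟩ := hb.along_curve hT hS ht hm hmaps
  set c : ℝ → A × B × Q := fun s => (a (t s), b (t s), q s) with hc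
  have hcA : AbsolutelyContinuousOnInterval c 0 S :=
    AbsolutelyContinuousOnInterval.prodMk haA (AbsolutelyContinuousOnInterval.prodMk hbA hq)
  have huIcc : uIcc 0 S = Icc 0 S := uIcc_of_le hS.le
  have hΦc : ∀ s ∈ Icc 0 S, ContDiffAt ℝ 1 Φ (c s) := fun s hs => hΦ (c s) (hqD s hs)
  have hΦA : AbsolutelyContinuousOnInterval (fun s => Φ (c s)) 0 S :=
    AbsolutelyContinuousOnInterval.comp_contDiffAt hcA (by rwa [huIcc])
  have hfd : ContinuousOn (fun s => fderiv ℝ Φ (c s)) (Icc 0 S) := fun s hs =>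
    ContinuousAt.comp_continuousWithinAt (g := fderiv ℝ Φ) (f := c)
      ((hΦc s hs).continuousAt_fderiv (by norm_num)) ((huIcc ▸ hcA.continuousOn) s hs)
  have hD : ∀ s ∈ Icc 0 S, fderiv ℝ (En (t s)) (q s) = (fderiv ℝ Φ (c s)).comp
      ((ContinuousLinearMap.inr ℝ A (B × Q)).comp (ContinuousLinearMap.inr ℝ B Q)) :=
    fun s hs => fderiv_state_eq hΦ hDm hEn (hqD s hs) (t s)
  have hcont : ContinuousOn (fun s => fderiv ℝ (En (t s)) (q s)) (Icc 0 S) :=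
    (hfd.clm_comp continuousOn_const).congr hD
  have hqI := AbsolutelyContinuousOnInterval.intervalIntegrable_deriv_of_normedSpace hS.le hq
  have hqI' : IntegrableOn (deriv q) (Icc 0 S) :=
    ((intervalIntegrable_iff_integrableOn_Icc_of_le hS.le).1 hqI)
  obtain ⟨M, hM⟩ := isCompact_Icc.exists_bound_of_continuousOn hcont
  have hI : IntervalIntegrable (fun s => fderiv ℝ (En (t s)) (q s) (deriv q s)) volume 0 S := by
    rw [intervalIntegrable_iff_integrableOn_Icc_of_le hS.le]
    refine (hqI'.norm.const_mul M).mono' ?_ ?_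
    · exact (ContinuousLinearMap.apply ℝ ℝ : Q →L[ℝ] _).flip.aestronglyMeasurable_comp₂
        (hcont.aestronglyMeasurable measurableSet_Icc) (aestronglyMeasurable_deriv _ _)
    · filter_upwards [ae_restrict_mem measurableSet_Icc] with s hs
      exact ((fderiv ℝ (En (t s)) (q s)).le_opNorm _).trans
        (mul_le_mul_of_nonneg_right (hM s hs) (norm_nonneg _))
  have hder : ∀ᵐ s ∂(volume.restrict (Ioo 0 S)), deriv (fun s => Φ (c s)) s =
      deriv (fun τ => En τ (q s)) (t s) * deriv t s + fderiv ℝ (En (t s)) (q s) (deriv q s) := by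
    filter_upwards [had, hbd, hqd, ae_restrict_mem measurableSet_Ioo] with s h1 h2 h3 hs
    have hs' := Ioo_subset_Icc_self hs
    have hF : HasFDerivAt Φ (fderiv ℝ Φ (c s)) (c s) :=
      ((hΦc s hs').differentiableAt (by norm_num)).hasFDerivAt
    have h4 : HasDerivAt c (deriv t s • deriv a (t s), deriv t s • deriv b (t s), deriv q s) s :=
      h1.1.prodMk (h2.1.prodMk h3.hasDerivAt)
    have h5 : deriv (fun s => Φ (c s)) s = fderiv ℝ Φ (c s)
        (deriv t s • deriv a (t s), deriv t s • deriv b (t s), deriv q s) :=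
      (hF.comp_hasDerivAt s h4).deriv
    have h6 : ((deriv t s • deriv a (t s), deriv t s • deriv b (t s), deriv q s) : A × B × Q) =
        deriv t s • (deriv a (t s), deriv b (t s), (0 : Q)) +
        ((ContinuousLinearMap.inr ℝ A (B × Q)).comp (ContinuousLinearMap.inr ℝ B Q)) (deriv q s) := by
      simp
    rw [h5, h6, map_add, map_smul, smul_eq_mul, hD s hs', ContinuousLinearMap.comp_apply, mul_comm]
    congr 1
    -- If `t'(s) = 0`, the power vanishes whatever value `deriv` takes at a time where the data may
    -- be irregular. Otherwise the data are differentiable at `t s`.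
    by_cases h0 : deriv t s = 0
    · rw [h0, mul_zero, mul_zero]
    have h7 : HasDerivAt (fun τ => ((a τ, b τ, q s) : A × B × Q))
        (deriv a (t s), deriv b (t s), (0 : Q)) (t s) :=
      (h1.2.resolve_right h0).hasDerivAt.prodMk
        ((h2.2.resolve_right h0).hasDerivAt.prodMk (hasDerivAt_const _ _))
    have h8 : (fun τ => En τ (q s)) = fun τ => Φ (a τ, b τ, q s) :=
      funext fun τ => hEn _ (hqD s hs') τ
    have h9 : HasDerivAt (fun τ => Φ (a τ, b τ, q s))
        (fderiv ℝ Φ (c s) (deriv a (t s), deriv b (t s), (0 : Q))) (t s) :=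
      HasFDerivAt.comp_hasDerivAt (t s) hF h7
    rw [h8, h9.deriv]
  have hder' : ∀ᵐ s, s ∈ Ioc 0 S → deriv (fun s => Φ (c s)) s =
      deriv (fun τ => En τ (q s)) (t s) * deriv t s + fderiv ℝ (En (t s)) (q s) (deriv q s) := by
    have hb : ∀ᵐ τ : ℝ, τ ≠ S := by simp [ae_iff]
    filter_upwards [(ae_restrict_iff' measurableSet_Ioo).1 hder, hb] with s h1 h2 h3
    exact h1 ⟨h3.1, lt_of_le_of_ne h3.2 h2⟩
  -- The power agrees almost everywhere with a difference of two integrable functions, so the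
  -- measurability of `∂_t E` along the curve need not be examined.
  have hP : IntervalIntegrable (fun s => deriv (fun τ => En τ (q s)) (t s) * deriv t s) volume 0 S := by
    refine (hΦA.intervalIntegrable_deriv.sub hI).congr_ae ?_
    rw [uIoc_of_le hS.le]
    filter_upwards [(ae_restrict_iff' measurableSet_Ioc).2 hder'] with s hs
    simp only [hs]
    ring
  refine ⟨hcont, hI, hP, fun s hs => ?_⟩
  have hsub : uIcc 0 s ⊆ uIcc 0 S := uIcc_subset_uIcc left_mem_uIcc (huIcc ▸ hs)
  have e1 := (hΦA.mono hsub).integral_deriv_eq_sub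
  rw [hEn _ (hqD s hs), hEn _ (hqD 0 (left_mem_Icc.2 hS.le)), add_assoc,
    ← intervalIntegral.integral_add (hP.mono_set hsub) (hI.mono_set hsub), ← sub_eq_iff_eq_add', ← e1]
  refine intervalIntegral.integral_congr_ae ?_
  rw [uIoc_of_le hs.1]
  filter_upwards [hder'] with τ h1 h2 using h1 (Ioc_subset_Ioc_right hs.2 h2)

end ChainRule

/-! ### Separability of the state space and the chain rule for the energy. -/

instance (n : ℕ) : SecondCountableTopology (DevMat n) :=
  have : ProperSpace (DevMat n) := FiniteDimensional.proper ℝ _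
  inferInstance

instance {n : ℕ} {Ω : Set (Vec n)} : SecondCountableTopology (Lp (DevMat n) 2 (volume.restrict Ω)) :=
  have : Fact ((2 : ℝ≥0∞) ≠ ⊤) := ⟨by norm_num⟩
  Lp.SecondCountableTopology

instance {n : ℕ} {Ω : Set (Vec n)} {m : ℝ} : SecondCountableTopology (Hm Ω m) :=
  have : Fact ((2 : ℝ≥0∞) ≠ ⊤) := ⟨by norm_num⟩
  have : SecondCountableTopology (Lp ℝ 2 (volume.restrict Ω)) := Lp.SecondCountableTopology
  have : MeasurableSpace.CountablyGenerated (Vec n × Vec n) := inferInstance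
  have : SFinite ((volume.restrict Ω).prod (volume.restrict Ω)) := inferInstance
  have : SecondCountableTopology (Lp (Vec n) 2 ((volume.restrict Ω).prod (volume.restrict Ω))) :=
    Lp.SecondCountableTopology
  have : SecondCountableTopology (WithLp 2 (Lp ℝ 2 (volume.restrict Ω) ×
    Lp (Vec n) 2 ((volume.restrict Ω).prod (volume.restrict Ω)))) := WithLp.secondCountableTopology _ _ _
  TopologicalSpace.Subtype.secondCountableTopology _

instance {n : ℕ} {Ω : Set (Vec n)} : SecondCountableTopology (H1 Ω) :=
  have : Fact ((2 : ℝ≥0∞) ≠ ⊤) := ⟨by norm_num⟩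
  have : SecondCountableTopology (Lp (Vec n) 2 (volume.restrict Ω)) := Lp.SecondCountableTopology
  have : SecondCountableTopology (Lp (Mat n) 2 (volume.restrict Ω)) := Lp.SecondCountableTopology
  have : SecondCountableTopology (WithLp 2 (Lp (Vec n) 2 (volume.restrict Ω) ×
    Lp (Mat n) 2 (volume.restrict Ω))) := WithLp.secondCountableTopology _ _ _
  TopologicalSpace.Subtype.secondCountableTopology _

instance {n : ℕ} {Ω Γ : Set (Vec n)} : SecondCountableTopology (H1Dir Ω Γ) :=
  TopologicalSpace.Subtype.secondCountableTopology _

/-- The product carries the maximum norm and is not a Hilbert space, so the differentiability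
theorem is applied to each component. -/
theorem ae_differentiableAt_prod_of_absolutelyContinuous {U Z V : Type*} [NormedAddCommGroup U]
    [InnerProductSpace ℝ U] [NormedAddCommGroup Z] [InnerProductSpace ℝ Z] [NormedAddCommGroup V]
    [InnerProductSpace ℝ V] [CompleteSpace U] [CompleteSpace Z] [CompleteSpace V]
    [SecondCountableTopology U] [SecondCountableTopology Z] [SecondCountableTopology V]
    {q : ℝ → U × Z × V} {a b : ℝ} (hab : a ≤ b) (hq : AbsolutelyContinuousOnInterval q a b) :
    ∀ᵐ s ∂(volume.restrict (Ioo a b)), DifferentiableAt ℝ q s := by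
  have h1 := ae_differentiableAt_of_absolutelyContinuous hab
    (AbsolutelyContinuousOnInterval.comp_lipschitz hq (g := fun s => (q s).1) (K := 1)
      fun x _ y _ => by rw [NNReal.coe_one, one_mul]; exact le_max_left _ _)
  have h2 := ae_differentiableAt_of_absolutelyContinuous hab
    (AbsolutelyContinuousOnInterval.comp_lipschitz hq (g := fun s => (q s).2.1) (K := 1)
      fun x _ y _ => by
        rw [NNReal.coe_one, one_mul]; exact (le_max_left _ _).trans (le_max_right _ _))
  have h3 := ae_differentiableAt_of_absolutelyContinuous hab
    (AbsolutelyContinuousOnInterval.comp_lipschitz hq (g := fun s => (q s).2.2) (K := 1)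
      fun x _ y _ => by
        rw [NNReal.coe_one, one_mul]; exact (le_max_right _ _).trans (le_max_right _ _))
  filter_upwards [h1, h2, h3] with s h1 h2 h3 using h1.prodMk (h2.prodMk h3)

theorem toReal_eq_of_eq_coe {x : EReal} {r : ℝ} (h : x = (r : EReal)) : x.toReal = r := by
  rw [h, EReal.toReal_coe]

namespace Model

variable {n : ℕ} {P : Model n}

namespace Standing

theorem completeSpace_Hm (hP : P.Standing) : CompleteSpace (Hm P.Ω P.m) :=
  (isClosed_Hm hP.domain.isOpen hP.domain.isConnected.nonempty hP.domain.isBounded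
    hP.exponent_pos).completeSpace_coe

theorem toReal_energy_eq (hP : P.Standing) {q : P.State} (hq : q ∈ P.domain) (t : ℝ) :
    (P.energy t q).toReal = P.energyFn (P.w t, P.F t, q) :=
  toReal_eq_of_eq_coe (hP.energy_eq hq t)

set_option maxHeartbeats 1000000 in
theorem energy_chain_rule (hP : P.Standing) {S : ℝ} (hS : 0 < S) {t : ℝ → ℝ} {q : ℝ → P.State}
    (hc : P.IsCurve S t q) (hdom : ∀ s ∈ Icc 0 S, q s ∈ P.domain) :
    ContinuousOn (fun s => P.DqE (t s) (q s)) (Icc 0 S) ∧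
    IntervalIntegrable (fun s => P.DqE (t s) (q s) (deriv q s)) volume 0 S ∧
    IntervalIntegrable (P.power t q) volume 0 S ∧
    ∀ s ∈ Icc 0 S, (P.energy (t s) (q s)).toReal = (P.energy (t 0) (q 0)).toReal
      + (∫ τ in (0 : ℝ)..s, P.power t q τ) + ∫ τ in (0 : ℝ)..s, P.DqE (t τ) (q τ) (deriv q τ) := by
  have := hP.completeSpace_Hm
  have h1 : ∀ x : H1 P.Ω × StrongDual ℝ (H1 P.Ω) × P.State, x.2.2 ∈ P.domain →
      ContDiffAt ℝ 1 P.energyFn x := fun _ hx => hP.contDiffAt_energyFn hx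
  have h2 : ∀ q ∈ P.domain, ∀ᶠ q' in 𝓝 q, q' ∈ P.domain := fun _ hx => hP.eventually_mem_domain hx
  have h3 : ∀ q ∈ P.domain, ∀ t, (P.energy t q).toReal = P.energyFn (P.w t, P.F t, q) :=
    fun _ hx t => hP.toReal_energy_eq hx t
  have h4 := ae_differentiableAt_prod_of_absolutelyContinuous (U := H1Dir P.Ω P.ΓD)
    (Z := Hm P.Ω P.m) (V := Lp (DevMat n) 2 P.vol) hS.le hc.ac_q
  have h5 := chain_rule (En := fun t q => (P.energy t q).toReal) hP.time_pos hS h1 h2 h3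
    hP.w_time hP.F_time hc.ac_t hc.mono hc.mapsTo hc.ac_q h4 hdom
  exact h5

end Standing

end Model

/-! ### Lower bound for the contact potential -/

/-- Distances are infima that may not be attained; bounds are proved at each level `d' > d`, and
then `d'` decreases to `d`. -/
theorem le_add_mul_of_forall_lt {X r d c : ℝ≥0∞} (hc : c ≠ ⊤) (hd : d ≠ ⊤)
    (h : ∀ d', d < d' → X ≤ r + d' * c) : X ≤ r + d * c := by
  have : (𝓝[>] d).NeBot := nhdsGT_neBot_of_exists_gt ⟨⊤, lt_top_iff_ne_top.2 hd⟩
  have h1 : Tendsto (fun d' => r + d' * c) (𝓝[>] d) (𝓝 (r + d * c)) :=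
    ((ENNReal.Tendsto.mul_const (tendsto_id) (Or.inr hc)).const_add r).mono_left nhdsWithin_le_nhds
  exact ge_of_tendsto h1 (eventually_mem_nhdsWithin.mono h)

/-- Cauchy-Schwarz in `ℝ³` after scaling `a, c` by `√ν` and `α, γ` by `1/√ν`; this is why `D_ν` and
`D_ν^*` carry reciprocal weights. -/
theorem sum_mul_le_sqrt_mul_sqrt {ν a b c α β γ : ℝ} (hν : 0 < ν) :
    a * α + b * β + c * γ ≤
      √(ν * a ^ 2 + b ^ 2 + ν * c ^ 2) * √(ν⁻¹ * α ^ 2 + β ^ 2 + ν⁻¹ * γ ^ 2) := by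
  rw [← Real.sqrt_mul (by positivity)]
  refine Real.le_sqrt_of_sq_le ?_
  have h1 : ν = √ν ^ 2 := (Real.sq_sqrt hν.le).symm
  have h2 : 0 < √ν := Real.sqrt_pos.2 hν
  set s := √ν
  have e : (a * α + b * β + c * γ) ^ 2 =
      ((s * a) * (s⁻¹ * α) + b * β + (s * c) * (s⁻¹ * γ)) ^ 2 := by
    field_simp
  have e' : (ν * a ^ 2 + b ^ 2 + ν * c ^ 2) * (ν⁻¹ * α ^ 2 + β ^ 2 + ν⁻¹ * γ ^ 2) =
      ((s * a) ^ 2 + b ^ 2 + (s * c) ^ 2) * ((s⁻¹ * α) ^ 2 + β ^ 2 + (s⁻¹ * γ) ^ 2) := by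
    rw [h1]
    simp only [mul_pow, inv_pow]
  rw [e, e']
  generalize s * a = x
  generalize s * c = y
  generalize s⁻¹ * α = z
  generalize s⁻¹ * γ = w
  nlinarith [sq_nonneg (x * β - b * z), sq_nonneg (x * w - y * z), sq_nonneg (b * w - y * β)]

theorem sum_mul_le_ofReal_sqrt_mul {ν a b c : ℝ} (hν : 0 < ν) (ha : 0 ≤ a) (hb : 0 ≤ b) (hc : 0 ≤ c)
    {A B C : ℝ≥0∞} (hA : A ≠ ⊤) (hB : B ≠ ⊤) (hC : C ≠ ⊤) :
    A * ENNReal.ofReal a + B * ENNReal.ofReal b + C * ENNReal.ofReal c ≤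
      ENNReal.ofReal (√(ν * a ^ 2 + b ^ 2 + ν * c ^ 2)) *
      ((ENNReal.ofReal ν)⁻¹ * A ^ 2 + B ^ 2 + (ENNReal.ofReal ν)⁻¹ * C ^ 2) ^ (1 / 2 : ℝ) := by
  obtain ⟨α, hα, rfl⟩ : ∃ α : ℝ, 0 ≤ α ∧ ENNReal.ofReal α = A :=
    ⟨_, ENNReal.toReal_nonneg, ENNReal.ofReal_toReal hA⟩
  obtain ⟨β, hβ, rfl⟩ : ∃ α : ℝ, 0 ≤ α ∧ ENNReal.ofReal α = B :=
    ⟨_, ENNReal.toReal_nonneg, ENNReal.ofReal_toReal hB⟩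
  obtain ⟨γ, hγ, rfl⟩ : ∃ α : ℝ, 0 ≤ α ∧ ENNReal.ofReal α = C :=
    ⟨_, ENNReal.toReal_nonneg, ENNReal.ofReal_toReal hC⟩
  have hl : ENNReal.ofReal α * ENNReal.ofReal a + ENNReal.ofReal β * ENNReal.ofReal b +
      ENNReal.ofReal γ * ENNReal.ofReal c = ENNReal.ofReal (α * a + β * b + γ * c) := by
    rw [ENNReal.ofReal_add (by positivity) (by positivity),
      ENNReal.ofReal_add (by positivity) (by positivity), ENNReal.ofReal_mul hα,
      ENNReal.ofReal_mul hβ, ENNReal.ofReal_mul hγ]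
  have hr : (ENNReal.ofReal ν)⁻¹ * ENNReal.ofReal α ^ 2 + ENNReal.ofReal β ^ 2 +
      (ENNReal.ofReal ν)⁻¹ * ENNReal.ofReal γ ^ 2 =
      ENNReal.ofReal (ν⁻¹ * α ^ 2 + β ^ 2 + ν⁻¹ * γ ^ 2) := by
    rw [ENNReal.ofReal_add (by positivity) (by positivity),
      ENNReal.ofReal_add (by positivity) (by positivity), ENNReal.ofReal_mul (by positivity),
      ENNReal.ofReal_mul (by positivity), ENNReal.ofReal_inv_of_pos hν, ENNReal.ofReal_pow hα,
      ENNReal.ofReal_pow hβ, ENNReal.ofReal_pow hγ]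
  rw [hl, hr, ENNReal.ofReal_rpow_of_nonneg (by positivity) (by norm_num), ← Real.sqrt_eq_rpow,
    ← ENNReal.ofReal_mul (by positivity)]
  refine ENNReal.ofReal_le_ofReal ?_
  have := sum_mul_le_sqrt_mul_sqrt (a := a) (b := b) (c := c) (α := α) (β := β) (γ := γ) hν
  linarith

/-- A functional is controlled by its dual seminorm. -/
theorem ofReal_le_iSup_mul_sqrt {V : Type*} [AddCommMonoid V] [Module ℝ V] [TopologicalSpace V] {N : V → ℝ}
    (hN0 : ∀ v, 0 ≤ N v) (hN : ∀ (c : ℝ) v, N (c • v) = c ^ 2 * N v) (η : StrongDual ℝ V)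
    (hη : ⨆ (v : V) (_ : N v ≤ 1), ENNReal.ofReal (η v) ≠ ⊤) (v : V) :
    ENNReal.ofReal (η v) ≤ (⨆ (v : V) (_ : N v ≤ 1), ENNReal.ofReal (η v)) * ENNReal.ofReal √(N v) := by
  set A := ⨆ (v : V) (_ : N v ≤ 1), ENNReal.ofReal (η v) with hA
  have hle : ∀ v, N v ≤ 1 → η v ≤ A.toReal := fun v hv =>
    (ENNReal.ofReal_le_iff_le_toReal hη).1 (le_iSup₂_of_le v hv le_rfl)
  rw [← ENNReal.ofReal_toReal hη, ← ENNReal.ofReal_mul ENNReal.toReal_nonneg]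
  refine ENNReal.ofReal_le_ofReal ?_
  -- If `N v = 0`, every multiple of `v` is admissible in the supremum, whose finiteness forces `η v
  -- ≤ 0`. No definiteness of `N`, hence no Korn inequality, is needed.
  rcases (hN0 v).eq_or_lt with h0 | h0
  · rw [← h0, Real.sqrt_zero, mul_zero]
    by_contra hlt
    push Not at hlt
    have h1 := hle (((A.toReal + 1) / η v) • v) (by rw [hN, ← h0]; simp)
    rw [map_smul, smul_eq_mul, div_mul_cancel₀ _ hlt.ne'] at h1
    linarith
  · have hs : 0 < √(N v) := Real.sqrt_pos.2 h0
    have h1 := hle ((√(N v))⁻¹ • v) (by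
      rw [hN, inv_pow, Real.sq_sqrt h0.le, inv_mul_cancel₀ h0.ne'])
    rw [map_smul, smul_eq_mul, inv_mul_le_iff₀ hs] at h1
    linarith

theorem ofReal_le_of_coe_le {x : ℝ} {r : ℝ≥0∞} (h : (x : EReal) ≤ (r : EReal)) : ENNReal.ofReal x ≤ r := by
  rw [← EReal.coe_ennreal_le_coe_ennreal_iff, EReal.coe_ennreal_ofReal]
  rcases le_total 0 x with hx | hx
  · rwa [max_eq_left hx]
  · rw [max_eq_right hx]
    exact EReal.coe_ennreal_nonneg r

theorem subdiff_zero_eq {X : Type*} [NormedAddCommGroup X] [NormedSpace ℝ X] {f : X → EReal}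
    (hf : f 0 = 0) : subdiff f 0 = {ξ | ∀ y, ((ξ y : ℝ) : EReal) ≤ f y} := by
  simp [subdiff, hf]

theorem apply_prod_eq {U Z V : Type*} [AddCommGroup U] [Module ℝ U] [TopologicalSpace U]
    [AddCommGroup Z] [Module ℝ Z] [TopologicalSpace Z] [AddCommGroup V] [Module ℝ V]
    [TopologicalSpace V]
    (ξ : StrongDual ℝ (U × Z × V)) (v : U × Z × V) :
    (-ξ) v = (-ξ.comp (ContinuousLinearMap.inl ℝ U (Z × V))) v.1
      + (-ξ.comp ((ContinuousLinearMap.inr ℝ U (Z × V)).comp (ContinuousLinearMap.inl ℝ Z V))) v.2.1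
      + (-ξ.comp ((ContinuousLinearMap.inr ℝ U (Z × V)).comp (ContinuousLinearMap.inr ℝ Z V))) v.2.2 := by
  have h : v = ContinuousLinearMap.inl ℝ U (Z × V) v.1
      + (ContinuousLinearMap.inr ℝ U (Z × V)) (ContinuousLinearMap.inl ℝ Z V v.2.1)
      + (ContinuousLinearMap.inr ℝ U (Z × V)) (ContinuousLinearMap.inr ℝ Z V v.2.2) := by
    simp
  conv_lhs => rw [h]
  simp only [map_add, neg_apply, ContinuousLinearMap.comp_apply]

/-- A functional is controlled by the `L²`-distance to a set of functionals below `f`. -/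
theorem ofReal_le_add_iInf_mul {Z Y : Type*} [AddCommGroup Z] [Module ℝ Z] [TopologicalSpace Z]
    [NormedAddCommGroup Y] [InnerProductSpace ℝ Y] (D : Z → Y) {Γ : Set (StrongDual ℝ Z)}
    {f : Z → ℝ≥0∞} (hΓ : ∀ γ ∈ Γ, ∀ z, ((γ z : ℝ) : EReal) ≤ f z) (χ : StrongDual ℝ Z)
    (hχ : ⨅ γ ∈ Γ, ⨅ (b : Y) (_ : ∀ v, (χ - γ) v = inner ℝ b (D v)), ‖b‖ₑ ≠ ⊤) (z : Z) :
    ENNReal.ofReal (χ z) ≤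
      f z + (⨅ γ ∈ Γ, ⨅ (b : Y) (_ : ∀ v, (χ - γ) v = inner ℝ b (D v)), ‖b‖ₑ) * ENNReal.ofReal ‖D z‖ := by
  refine le_add_mul_of_forall_lt ENNReal.ofReal_ne_top hχ fun d' hd' => ?_
  simp only [iInf_lt_iff] at hd'
  obtain ⟨γ, hγ, b, hb, hlt⟩ := hd'
  have h1 : χ z = γ z + inner ℝ b (D z) := by
    rw [← hb z, sub_apply]; ring
  rw [h1]
  refine ENNReal.ofReal_add_le.trans (add_le_add (ofReal_le_of_coe_le (hΓ γ hγ z)) ?_)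
  calc ENNReal.ofReal (inner ℝ b (D z)) ≤ ENNReal.ofReal (‖b‖ * ‖D z‖) :=
        ENNReal.ofReal_le_ofReal (real_inner_le_norm _ _)
    _ = ‖b‖ₑ * ENNReal.ofReal ‖D z‖ := by
        rw [ENNReal.ofReal_mul (norm_nonneg _), ofReal_norm]
    _ ≤ d' * ENNReal.ofReal ‖D z‖ := by gcongr

/-- A functional is controlled by the distance to a set of functionals below `f`. -/
theorem ofReal_le_add_infEDist_mul {V : Type*} [NormedAddCommGroup V] [NormedSpace ℝ V]
    {Γ : Set (StrongDual ℝ V)} {f : V → ℝ} (hΓ : ∀ γ ∈ Γ, ∀ v, γ v ≤ f v) (ξ : StrongDual ℝ V)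
    (hξ : Metric.infEDist ξ Γ ≠ ⊤) (v : V) :
    ENNReal.ofReal (ξ v) ≤ ENNReal.ofReal (f v) + Metric.infEDist ξ Γ * ENNReal.ofReal ‖v‖ := by
  refine le_add_mul_of_forall_lt ENNReal.ofReal_ne_top hξ fun d' hd' => ?_
  obtain ⟨γ, hγ, hlt⟩ := Metric.infEDist_lt_iff.1 hd'
  have h1 : ξ v = γ v + (ξ - γ) v := by rw [sub_apply]; ring
  rw [h1]
  refine ENNReal.ofReal_add_le.trans (add_le_add (ENNReal.ofReal_le_ofReal (hΓ γ hγ v)) ?_)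
  calc ENNReal.ofReal ((ξ - γ) v) ≤ ENNReal.ofReal (‖ξ - γ‖ * ‖v‖) :=
        ENNReal.ofReal_le_ofReal ((le_abs_self _).trans ((ξ - γ).le_opNorm v))
    _ = edist ξ γ * ENNReal.ofReal ‖v‖ := by
        rw [ENNReal.ofReal_mul (norm_nonneg _), ofReal_norm, edist_eq_enorm_sub]
    _ ≤ d' * ENNReal.ofReal ‖v‖ := by gcongr

theorem inner_eq_integral_mul {X : Type*} [MeasurableSpace X] {ρ : Measure X} (b v : Lp ℝ 2 ρ) :
    inner ℝ b v = ∫ x, b x * v x ∂ρ := by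
  rw [L2.inner_def]
  exact integral_congr_ae (.of_forall fun x => mul_comm _ _)

theorem ofReal_add_three_le {x y z : ℝ} {a b c : ℝ≥0∞} (hx : ENNReal.ofReal x ≤ a)
    (hy : ENNReal.ofReal y ≤ b) (hz : ENNReal.ofReal z ≤ c) : ENNReal.ofReal (x + y + z) ≤ a + b + c :=
  ENNReal.ofReal_add_le.trans (add_le_add (ENNReal.ofReal_add_le.trans (add_le_add hx hy)) hz)

theorem ne_top_of_sqrt_sum_ne_top {ν : ℝ} {A B C : ℝ≥0∞}
    (h : ((ENNReal.ofReal ν)⁻¹ * A ^ 2 + B ^ 2 + (ENNReal.ofReal ν)⁻¹ * C ^ 2) ^ (1 / 2 : ℝ) ≠ ⊤) :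
    A ≠ ⊤ ∧ B ≠ ⊤ ∧ C ≠ ⊤ := by
  have hν : (ENNReal.ofReal ν)⁻¹ ≠ 0 := ENNReal.inv_ne_zero.2 ENNReal.ofReal_ne_top
  have hfin : (ENNReal.ofReal ν)⁻¹ * A ^ 2 + B ^ 2 + (ENNReal.ofReal ν)⁻¹ * C ^ 2 ≠ ⊤ := fun h' =>
    h (by rw [h']; exact ENNReal.top_rpow_of_pos (by norm_num))
  exact ⟨fun h => hfin (by simp [h, ENNReal.mul_top hν]), fun h => hfin (by simp [h]),
    fun h => hfin (by simp [h, ENNReal.mul_top hν])⟩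

theorem ofReal_sum_le_contact {ν x y z N b c : ℝ} {A B C r h : ℝ≥0∞} (hν : 0 < ν) (hN : 0 ≤ N)
    (hb : 0 ≤ b) (hc : 0 ≤ c) (hA : A ≠ ⊤) (hB : B ≠ ⊤) (hC : C ≠ ⊤)
    (hx : ENNReal.ofReal x ≤ A * ENNReal.ofReal √N) (hy : ENNReal.ofReal y ≤ r + B * ENNReal.ofReal b)
    (hz : ENNReal.ofReal z ≤ h + C * ENNReal.ofReal c) :
    ENNReal.ofReal (x + y + z) ≤ r + h + ENNReal.ofReal (√(ν * N + b ^ 2 + ν * c ^ 2)) *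
      ((ENNReal.ofReal ν)⁻¹ * A ^ 2 + B ^ 2 + (ENNReal.ofReal ν)⁻¹ * C ^ 2) ^ (1 / 2 : ℝ) := by
  have h4 := sum_mul_le_ofReal_sqrt_mul hν (Real.sqrt_nonneg N) hb hc hA hB hC
  rw [Real.sq_sqrt hN] at h4
  refine (ofReal_add_three_le hx hy hz).trans (le_trans (le_of_eq ?_) (add_le_add_right h4 _))
  ring

/-- Integrals of quadratic forms with bounded coefficients. -/
theorem exists_quadratic_form {X E V : Type*} [MeasurableSpace X] {ρ : Measure X} [NormedAddCommGroup E]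
    [InnerProductSpace ℝ E] [AddCommMonoid V] [Module ℝ V] [TopologicalSpace V] {D : X → E →L[ℝ] E}
    (hD : MemLp D ⊤ ρ) (B : V →L[ℝ] Lp E 2 ρ) {σ : V → X → E} (hσ : ∀ u, B u =ᵐ[ρ] σ u) :
    ∃ A : V →L[ℝ] Lp E 2 ρ, ∀ u, ∫ x, inner ℝ (D x (σ u x)) (σ u x) ∂ρ = inner ℝ (A u) (B u) :=
  ⟨((ContinuousLinearMap.id ℝ (E →L[ℝ] E)).holderL ρ ⊤ 2 2 hD.toLp).comp B, fun u =>
    (inner_holderL_eq_integral _ _ hD.coeFn_toLp (hσ u)).symm⟩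

theorem memLp_top_of_continuousOn_closure {X E : Type*} [MetricSpace X] [ProperSpace X]
    [MeasurableSpace X] [BorelSpace X] [SecondCountableTopology X] {ρ : Measure X}
    [NormedAddCommGroup E] {Ω : Set X} (ho : IsOpen Ω) (hb : Bornology.IsBounded Ω)
    {D : X → E} (hD : ContinuousOn D (closure Ω)) : MemLp D ⊤ (ρ.restrict Ω) := by
  obtain ⟨M, hM⟩ := hb.isCompact_closure.exists_bound_of_continuousOn hD
  refine memLp_top_of_bound ((hD.mono subset_closure).aestronglyMeasurable ho.measurableSet) M ?_
  filter_upwards [ae_restrict_mem ho.measurableSet] with x hx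
  exact hM x (subset_closure hx)

theorem quadratic_form_smul {V Y : Type*} [AddCommMonoid V] [Module ℝ V] [TopologicalSpace V]
    [NormedAddCommGroup Y] [InnerProductSpace ℝ Y] {A B : V →L[ℝ] Y} {N : V → ℝ}
    (h : ∀ u, N u = inner ℝ (A u) (B u)) (c : ℝ) (u : V) : N (c • u) = c ^ 2 * N u := by
  rw [h, h, map_smul, map_smul, real_inner_smul_left, real_inner_smul_right]
  ring

/-! ### The contact inequality for the model. -/

namespace Model

variable {n : ℕ} {P : Model n}

theorem calR_zero : P.calR 0 = 0 := by
  refine (lintegral_congr_ae ?_).trans lintegral_zero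
  filter_upwards [Lp.coeFn_zero ℝ 2 P.vol] with x hx
  have h : (damageFn (0 : Hm P.Ω P.m) : Vec n → ℝ) x = 0 := hx
  rw [h]
  simp [R]

theorem H_zero_right (z : ℝ) : P.H z 0 = 0 := by
  rcases (P.K z).eq_empty_or_nonempty with h | h
  · simp [H, h]
  · simp [H, h.image_const]

theorem calH_zero_right (z : Hm P.Ω P.m) : P.calH z 0 = 0 := by
  refine (integral_congr_ae ?_).trans (integral_zero _ _)
  filter_upwards [Lp.coeFn_zero (DevMat n) 2 P.vol] with x hx
  rw [hx, Pi.zero_apply, H_zero_right]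

theorem mem_subR0 {γ : StrongDual ℝ (Hm P.Ω P.m)} :
    γ ∈ P.subR0 ↔ ∀ ζ, ((γ ζ : ℝ) : EReal) ≤ ((P.calR ζ : ℝ≥0∞) : EReal) :=
  Set.ext_iff.1 (subdiff_zero_eq (f := fun ζ => ((P.calR ζ : ℝ≥0∞) : EReal)) (by rw [calR_zero]; rfl)) γ

theorem mem_subH0 {z : Hm P.Ω P.m} {γ : StrongDual ℝ (Lp (DevMat n) 2 P.vol)} :
    γ ∈ P.subH0 z ↔ ∀ π, γ π ≤ P.calH z π :=
  (Set.ext_iff.1 (subdiff_zero_eq (f := fun π => ((P.calH z π : ℝ) : EReal)) (by rw [calH_zero_right]; rfl)) γ).trans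
    (forall_congr' fun _ => EReal.coe_le_coe_iff)

theorem distR_eq (χ : StrongDual ℝ (Hm P.Ω P.m)) : P.distR χ = ⨅ γ ∈ P.subR0,
    ⨅ (b : Lp ℝ 2 P.vol) (_ : ∀ v, (χ - γ) v = inner ℝ b (damageL P.Ω P.m v)), ‖b‖ₑ := by
  exact iInf_congr fun γ => iInf_congr fun _ => iInf_congr fun b => iInf_congr_Prop
    (forall_congr' fun v => by rw [inner_eq_integral_mul]; rfl) fun _ => rfl

/-- The viscosity form as a product of continuous linear maps into `L²`. -/
theorem Standing.exists_viscosity_form (hP : P.Standing) :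
    ∃ A B : H1Dir P.Ω P.ΓD →L[ℝ] Lp (SymMat n) 2 P.vol, ∀ u, P.normDsq u = inner ℝ (A u) (B u) := by
  have hD : MemLp P.D ⊤ P.vol :=
    memLp_top_of_continuousOn_closure hP.domain.isOpen hP.domain.isBounded hP.visc_cont
  have h := exists_quadratic_form (V := H1Dir P.Ω P.ΓD) hD
    ((strainL P.Ω).comp (H1Dir P.Ω P.ΓD).subtypeL) (σ := fun u => strain u.1) fun u => coeFn_strainL u.1
  exact h.elim fun A hA => ⟨A, _, hA⟩

theorem Standing.normDsq_nonneg (hP : P.Standing) (u : H1Dir P.Ω P.ΓD) : 0 ≤ P.normDsq u := by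
  refine hP.visc_coercive.elim fun δ h => h.elim fun _ h => integral_nonneg_of_ae ?_
  filter_upwards [ae_restrict_mem hP.domain.isOpen.measurableSet] with x hx
  exact (mul_nonneg h.1.le (sq_nonneg _)).trans (h.2.2 x hx _).1

theorem Standing.normDsq_smul (hP : P.Standing) (c : ℝ) (u : H1Dir P.Ω P.ΓD) :
    P.normDsq (c • u) = c ^ 2 * P.normDsq u :=
  hP.exists_viscosity_form.elim fun _ h => h.elim fun _ h => quadratic_form_smul h c u

theorem neg_DqE_apply (t : ℝ) (q q' : P.State) :
    (-P.DqE t q) q' = (-P.DuE t q) q'.1 + (-P.DzE t q) q'.2.1 + (-P.DpE t q) q'.2.2 :=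
  apply_prod_eq (U := H1Dir P.Ω P.ΓD) (Z := Hm P.Ω P.m) (V := Lp (DevMat n) 2 P.vol) (P.DqE t q) q'

theorem ofReal_le_dualNormD (hP : P.Standing) {η : StrongDual ℝ (H1Dir P.Ω P.ΓD)}
    (hη : P.dualNormD η ≠ ⊤) (u : H1Dir P.Ω P.ΓD) :
    ENNReal.ofReal (η u) ≤ P.dualNormD η * ENNReal.ofReal √(P.normDsq u) :=
  ofReal_le_iSup_mul_sqrt (V := H1Dir P.Ω P.ΓD) hP.normDsq_nonneg hP.normDsq_smul η hη u

theorem ofReal_le_distR {χ : StrongDual ℝ (Hm P.Ω P.m)} (hχ : P.distR χ ≠ ⊤) (z : Hm P.Ω P.m) :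
    ENNReal.ofReal (χ z) ≤ P.calR z + P.distR χ * ENNReal.ofReal ‖damageFn z‖ := by
  have h := ofReal_le_add_iInf_mul (Z := Hm P.Ω P.m) (damageL P.Ω P.m)
    (fun γ hγ => mem_subR0.1 hγ) χ ((distR_eq χ).symm.trans_ne hχ) z
  exact h.trans_eq (congrArg (fun d => P.calR z + d * ENNReal.ofReal ‖damageFn z‖) (distR_eq χ).symm)

theorem ofReal_le_distH {z : Hm P.Ω P.m} {ξ : StrongDual ℝ (Lp (DevMat n) 2 P.vol)}
    (hξ : P.distH z ξ ≠ ⊤) (π : Lp (DevMat n) 2 P.vol) :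
    ENNReal.ofReal (ξ π) ≤ ENNReal.ofReal (P.calH z π) + P.distH z ξ * ENNReal.ofReal ‖π‖ :=
  ofReal_le_add_infEDist_mul (fun _ hγ => mem_subH0.1 hγ) ξ hξ π

theorem M_eq_top {t : ℝ} {q : P.State} {t' : ℝ} {q' : P.State} (h : P.Mred t q t' q' = ⊤) :
    P.M t q t' q' = ⊤ :=
  (congrArg (P.calR q'.2.1 + ENNReal.ofReal (P.calH q.2.1 q'.2.2) + ·) h).trans (add_top _)

/-- In equilibrium the displacement component of `-D_q E` vanishes and the other two are
subgradients at `0`, so that pairing them with the rate gives at most the dissipation potentials.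
Out of equilibrium `M` is infinite. -/
theorem ofReal_le_M_of_pos (t : ℝ) (q : P.State) {t' : ℝ} (q' : P.State)
    (ht : 0 < t') : ENNReal.ofReal ((-P.DqE t q) q') ≤ P.M t q t' q' := by
  by_cases h2 : -P.DuE t q = 0 ∧ -P.DzE t q ∈ P.subR0 ∧ -P.DpE t q ∈ P.subH0 q.2.1
  · have hx : (-P.DuE t q) q'.1 = 0 := DFunLike.congr_fun h2.1 q'.1
    have h := ofReal_add_three_le (ENNReal.ofReal_eq_zero.2 hx.le).le
      (ofReal_le_of_coe_le (mem_subR0.1 h2.2.1 q'.2.1))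
      (ENNReal.ofReal_le_ofReal (mem_subH0.1 h2.2.2 q'.2.2))
    have hM : P.Mred t q t' q' = 0 := (if_pos ht).trans (if_pos h2)
    have hM' : P.M t q t' q' = P.calR q'.2.1 + ENNReal.ofReal (P.calH q.2.1 q'.2.2) :=
      (congrArg (P.calR q'.2.1 + ENNReal.ofReal (P.calH q.2.1 q'.2.2) + ·) hM).trans (add_zero _)
    exact (congrArg ENNReal.ofReal (neg_DqE_apply t q q')).trans_le (h.trans_eq
      ((congrArg (· + ENNReal.ofReal (P.calH q.2.1 q'.2.2)) (zero_add _)).trans hM'.symm))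
  · exact le_top.trans_eq (M_eq_top ((if_pos ht).trans (if_neg h2))).symm

/-- If `D_ν^*` is finite, so are the dual norm and both distances. The three pairings are then
bounded separately and summed by the weighted Cauchy-Schwarz inequality. -/
theorem Standing.ofReal_le_M_of_not_pos (hP : P.Standing) (t : ℝ) (q : P.State) {t' : ℝ} (q' : P.State)
    (ht : ¬0 < t') : ENNReal.ofReal ((-P.DqE t q) q') ≤ P.M t q t' q' := by
  by_cases h3 : P.DnuStar t q = ⊤
  · exact le_top.trans_eq (M_eq_top ((if_neg ht).trans (if_pos h3))).symm
  · have hM : P.Mred t q t' q' = ENNReal.ofReal (P.Dnu q') * P.DnuStar t q :=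
      (if_neg ht).trans (if_neg h3)
    have hM' : P.M t q t' q' = P.calR q'.2.1 + ENNReal.ofReal (P.calH q.2.1 q'.2.2)
        + ENNReal.ofReal (P.Dnu q') * P.DnuStar t q :=
      congrArg (P.calR q'.2.1 + ENNReal.ofReal (P.calH q.2.1 q'.2.2) + ·) hM
    have hfin := ne_top_of_sqrt_sum_ne_top h3
    have h := ofReal_sum_le_contact hP.ν_pos (hP.normDsq_nonneg q'.1) (norm_nonneg (damageFn q'.2.1))
      (norm_nonneg q'.2.2) hfin.1 hfin.2.1 hfin.2.2 (ofReal_le_dualNormD hP hfin.1 q'.1)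
      (ofReal_le_distR hfin.2.1 q'.2.1) (ofReal_le_distH hfin.2.2 q'.2.2)
    exact (congrArg ENNReal.ofReal (neg_DqE_apply t q q')).trans_le (h.trans_eq hM'.symm)

theorem Standing.ofReal_le_M (hP : P.Standing) (t : ℝ) (q : P.State) (t' : ℝ) (q' : P.State) :
    ENNReal.ofReal ((-P.DqE t q) q') ≤ P.M t q t' q' := by
  by_cases ht : 0 < t'
  · exact ofReal_le_M_of_pos t q q' ht
  · exact hP.ofReal_le_M_of_not_pos t q q' ht

end Model

/-! ### Lower semicontinuity of distances and dual norms -/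

/-- The hypothesis is lower semicontinuity on `s`, tested at finite levels; it makes the sublevel
sets closed. Ultrafilters fit the weak compactness arguments, as no subsequences have to be
extracted. -/
theorem aemeasurable_of_le_of_ultrafilter {s : Set ℝ} (hs : IsClosed s) {f : ℝ → ℝ≥0∞}
    (h : ∀ x ∈ s, ∀ l : Ultrafilter ℝ, (l : Filter ℝ) ≤ 𝓝[s] x → ∀ d : ℝ≥0∞, d ≠ ⊤ →
      (∀ᶠ y in (l : Filter ℝ), f y ≤ d) → f x ≤ d) : AEMeasurable f (volume.restrict s) := by
  refine aemeasurable_restrict_of_measurable_subtype hs.measurableSet (measurable_of_Iic fun d => ?_)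
  have hcl : IsClosed (s ∩ {x | f x ≤ d}) := by
    refine isClosed_iff_ultrafilter.2 fun x l hl hmem => ?_
    have hls : s ∈ (l : Filter ℝ) := mem_of_superset hmem inter_subset_left
    have hx : x ∈ s := isClosed_iff_ultrafilter.1 hs x l hl hls
    refine ⟨hx, ?_⟩
    by_cases hd : d = ⊤
    · rw [mem_ofPred_eq, hd]; exact le_top
    · exact h x hx l (le_inf hl (le_principal_iff.2 hls)) d hd
        (mem_of_superset hmem inter_subset_right)
  have : (fun x : s => f x) ⁻¹' Iic d = Subtype.val ⁻¹' (s ∩ {x | f x ≤ d}) := by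
    ext x
    simp
  rw [this]
  exact measurable_subtype_coe hcl.measurableSet

theorem iSup_dual_le_of_tendsto {ι V : Type*} [AddCommMonoid V] [Module ℝ V] [TopologicalSpace V]
    {N : V → ℝ} {l : Filter ι} [l.NeBot] {η : ι → StrongDual ℝ V} {η₀ : StrongDual ℝ V}
    (hη : ∀ v, Tendsto (fun i => η i v) l (𝓝 (η₀ v))) {d : ℝ≥0∞}
    (h : ∀ᶠ i in l, ⨆ (v : V) (_ : N v ≤ 1), ENNReal.ofReal (η i v) ≤ d) :
    ⨆ (v : V) (_ : N v ≤ 1), ENNReal.ofReal (η₀ v) ≤ d :=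
  iSup₂_le fun v hv => le_of_tendsto (ENNReal.tendsto_ofReal (hη v))
    (h.mono fun _ hi => (le_iSup₂_of_le v hv le_rfl).trans hi)

theorem exists_weak_limit_dual {ι V : Type*} [NormedAddCommGroup V] [InnerProductSpace ℝ V]
    [CompleteSpace V] (l : Ultrafilter ι) (γ : ι → StrongDual ℝ V) (M : ℝ)
    (hγ : ∀ᶠ i in (l : Filter ι), ‖γ i‖ ≤ M) :
    ∃ g : StrongDual ℝ V, ‖g‖ ≤ M ∧ ∀ v, Tendsto (fun i => γ i v) l (𝓝 (g v)) := by
  obtain ⟨y, hy, h⟩ := exists_weak_limit l (fun i => (InnerProductSpace.toDual ℝ V).symm (γ i)) M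
    (by simpa using hγ)
  refine ⟨InnerProductSpace.toDual ℝ V y, by simpa using hy, fun v => ?_⟩
  simpa using h v

/-- Lower semicontinuity of the `L²`-distance to a set of functionals below `f`. -/
theorem iInf_enorm_le_of_tendsto {ι Z Y : Type*} [AddCommGroup Z] [Module ℝ Z] [TopologicalSpace Z]
    [NormedAddCommGroup Y] [InnerProductSpace ℝ Y] [CompleteSpace Y] (D : Z →L[ℝ] Y)
    {Γ : Set (StrongDual ℝ Z)} {f : Z → ℝ≥0∞}
    (hΓ : ∀ γ, γ ∈ Γ ↔ ∀ z, ((γ z : ℝ) : EReal) ≤ f z) (l : Ultrafilter ι) {χ : ι → StrongDual ℝ Z}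
    {χ₀ : StrongDual ℝ Z} (hχ : ∀ v, Tendsto (fun i => χ i v) l (𝓝 (χ₀ v))) {d : ℝ≥0∞}
    (h : ∀ᶠ i in (l : Filter ι),
      ⨅ γ ∈ Γ, ⨅ (b : Y) (_ : ∀ v, (χ i - γ) v = inner ℝ b (D v)), ‖b‖ₑ ≤ d) :
    ⨅ γ ∈ Γ, ⨅ (b : Y) (_ : ∀ v, (χ₀ - γ) v = inner ℝ b (D v)), ‖b‖ₑ ≤ d := by
  refine le_of_forall_gt_imp_ge_of_dense fun d' hd' => ?_
  rcases eq_or_ne d' ⊤ with rfl | hd'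
  · exact le_top
  have hex : ∀ᶠ i in (l : Filter ι), ∃ b : Y, ‖b‖ ≤ d'.toReal ∧
      ∀ z, (((χ i z - inner ℝ b (D z) : ℝ)) : EReal) ≤ f z := by
    filter_upwards [h] with i hi
    have hlt := hi.trans_lt ‹d < d'›
    simp only [iInf_lt_iff] at hlt
    obtain ⟨γ, hγ, b, hb, hlt⟩ := hlt
    refine ⟨b, ?_, fun z => ?_⟩
    · rw [← toReal_enorm]
      exact ENNReal.toReal_mono hd' hlt.le
    · rw [← hb z, sub_apply, sub_sub_cancel]
      exact (hΓ γ).1 hγ z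
  choose! b hb1 hb2 using fun i => fun (hi : ∃ b : Y, ‖b‖ ≤ d'.toReal ∧
      ∀ z, (((χ i z - inner ℝ b (D z) : ℝ)) : EReal) ≤ f z) => hi
  obtain ⟨y, hy, hlim⟩ := exists_weak_limit l b d'.toReal (hex.mono hb1)
  -- The subgradients themselves need not be bounded in `Z*`. Only their differences from `χ i` have
  -- weak limits, and the limit subgradient is `χ₀` minus such a limit. It belongs to `Γ`, which is
  -- described by inequalities that pass to the limit.
  let γ : StrongDual ℝ Z := χ₀ - (innerSL ℝ y).comp D
  have hγ : ∀ z, γ z = χ₀ z - inner ℝ y (D z) := fun z => rfl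
  refine iInf₂_le_of_le γ ((hΓ γ).2 fun z => ?_) (iInf₂_le_of_le y (fun v => ?_) ?_)
  · rw [hγ]
    refine le_of_tendsto ((continuous_coe_real_ereal.tendsto _).comp ((hχ z).sub (hlim (D z)))) ?_
    filter_upwards [hex] with i hi using hb2 i hi z
  · rw [sub_apply, hγ, sub_sub_cancel]
  · rw [← ofReal_norm]
    exact ENNReal.ofReal_le_of_le_toReal hy

/-- Lower semicontinuity of the distance to varying sets of functionals. -/
theorem infEDist_le_of_tendsto {ι V : Type*} [NormedAddCommGroup V] [InnerProductSpace ℝ V]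
    [CompleteSpace V] {Γ : ι → Set (StrongDual ℝ V)} {Γ₀ : Set (StrongDual ℝ V)} {f : ι → V → ℝ}
    {f₀ : V → ℝ} (hΓ : ∀ i, ∀ γ ∈ Γ i, ∀ v, γ v ≤ f i v) (hΓ₀ : ∀ γ, (∀ v, γ v ≤ f₀ v) → γ ∈ Γ₀)
    (l : Ultrafilter ι) (hf : ∀ v, Tendsto (fun i => f i v) l (𝓝 (f₀ v))) {ξ : ι → StrongDual ℝ V}
    {ξ₀ : StrongDual ℝ V} (hξ : ∀ v, Tendsto (fun i => ξ i v) l (𝓝 (ξ₀ v))) {d : ℝ≥0∞}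
    (h : ∀ᶠ i in (l : Filter ι), Metric.infEDist (ξ i) (Γ i) ≤ d) : Metric.infEDist ξ₀ Γ₀ ≤ d := by
  refine le_of_forall_gt_imp_ge_of_dense fun d' hd' => ?_
  rcases eq_or_ne d' ⊤ with rfl | hd'
  · exact le_top
  have hex : ∀ᶠ i in (l : Filter ι), ∃ δ : StrongDual ℝ V, ‖δ‖ ≤ d'.toReal ∧
      ∀ v, ξ i v - δ v ≤ f i v := by
    filter_upwards [h] with i hi
    obtain ⟨γ, hγ, hlt⟩ := Metric.infEDist_lt_iff.1 (hi.trans_lt ‹d < d'›)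
    refine ⟨ξ i - γ, ?_, fun v => ?_⟩
    · rw [← toReal_enorm, ← edist_eq_enorm_sub]
      exact ENNReal.toReal_mono hd' hlt.le
    · rw [sub_apply, sub_sub_cancel]
      exact hΓ i γ hγ v
  choose! δ hδ1 hδ2 using fun i => fun (hi : ∃ δ : StrongDual ℝ V, ‖δ‖ ≤ d'.toReal ∧
      ∀ v, ξ i v - δ v ≤ f i v) => hi
  -- The same argument with moving sets: pointwise convergence of the bounds `f i` suffices for the
  -- inequalities to pass to the limit.
  obtain ⟨δ₀, hδ₀, hlim⟩ := exists_weak_limit_dual l δ d'.toReal (hex.mono hδ1)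
  refine (Metric.infEDist_le_edist_of_mem (hΓ₀ (ξ₀ - δ₀) fun v => ?_)).trans ?_
  · rw [sub_apply]
    refine le_of_tendsto_of_tendsto ((hξ v).sub (hlim v)) (hf v) ?_
    filter_upwards [hex] with i hi using hδ2 i hi v
  · rw [edist_eq_enorm_sub, sub_sub_cancel, ← ofReal_norm]
    exact ENNReal.ofReal_le_of_le_toReal hδ₀

/-! ### Support functions -/

/-- Each `σ ∈ K₁` is replaced by some `τ ∈ K₂` at distance at most slightly above `δ`, and `σ : x =
τ : y + (σ - τ) : x + τ : (x - y)`. -/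
theorem sSup_inner_le {E : Type*} [NormedAddCommGroup E] [InnerProductSpace ℝ E] {K₁ K₂ : Set E}
    {R δ : ℝ} (h1 : K₁.Nonempty) (h2 : K₂.Nonempty) (hR1 : K₁ ⊆ Metric.ball 0 R)
    (hR2 : K₂ ⊆ Metric.ball 0 R) (hδ : Metric.hausdorffDist K₁ K₂ ≤ δ) (x y : E) :
    sSup ((fun σ => inner ℝ σ x) '' K₁) ≤ sSup ((fun σ => inner ℝ σ y) '' K₂) + δ * ‖x‖ + R * ‖x - y‖ := by
  have hbdd : BddAbove ((fun σ => (inner ℝ σ y : ℝ)) '' K₂) := by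
    refine ⟨R * ‖y‖, ?_⟩
    rintro _ ⟨σ, hσ, rfl⟩
    refine (real_inner_le_norm _ _).trans ?_
    gcongr
    exact (mem_ball_zero_iff.1 (hR2 hσ)).le
  refine csSup_le (h1.image _) ?_
  rintro _ ⟨σ, hσ, rfl⟩
  have hfin := Metric.hausdorffEDist_ne_top_of_nonempty_of_bounded h1 h2
    (Metric.isBounded_ball.subset hR1) (Metric.isBounded_ball.subset hR2)
  refine le_of_forall_pos_le_add fun ε hε => ?_
  -- The Hausdorff distance need not be attained; this slack costs at most `ε` after multiplication
  -- by `‖x‖`, and the `1` covers `x = 0`.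
  have hε' : 0 < ε / (‖x‖ + 1) := by positivity
  obtain ⟨τ, hτ, hd⟩ := Metric.exists_dist_lt_of_hausdorffDist_lt hσ
    (hδ.trans_lt (lt_add_of_pos_right δ hε')) hfin
  have e : (inner ℝ σ x : ℝ) = inner ℝ τ y + inner ℝ (σ - τ) x + inner ℝ τ (x - y) := by
    rw [inner_sub_left, inner_sub_right]; ring
  have b1 : (inner ℝ τ y : ℝ) ≤ sSup ((fun σ => inner ℝ σ y) '' K₂) := le_csSup hbdd ⟨τ, hτ, rfl⟩
  have b2 : (inner ℝ (σ - τ) x : ℝ) ≤ (δ + ε / (‖x‖ + 1)) * ‖x‖ :=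
    (real_inner_le_norm _ _).trans (by gcongr; rw [← dist_eq_norm]; exact hd.le)
  have b3 : (inner ℝ τ (x - y) : ℝ) ≤ R * ‖x - y‖ :=
    (real_inner_le_norm _ _).trans (by gcongr; exact (mem_ball_zero_iff.1 (hR2 hτ)).le)
  have b4 : ε / (‖x‖ + 1) * ‖x‖ ≤ ε := by
    rw [div_mul_eq_mul_div, div_le_iff₀ (by positivity)]
    nlinarith [norm_nonneg x]
  change (inner ℝ σ x : ℝ) ≤ _
  rw [e]
  nlinarith

section SuperposIntegral

variable {X E : Type*} [MeasurableSpace X] {ρ : Measure X} [NormedAddCommGroup E] {h : ℝ → E → ℝ}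
  {C R : ℝ}

theorem continuous_uncurry_of_le
    (hh : ∀ a b x y, |h a x - h b y| ≤ C * |a - b| * ‖y‖ + R * ‖x - y‖) :
    Continuous (Function.uncurry h) := by
  refine continuous_iff_continuousAt.2 fun p => ?_
  refine tendsto_iff_dist_tendsto_zero.2 (squeeze_zero (fun _ => dist_nonneg)
    (fun p' => (hh p'.1 p.1 p'.2 p.2)) ?_)
  have : Continuous fun p' : ℝ × E => C * |p'.1 - p.1| * ‖p.2‖ + R * ‖p'.2 - p.2‖ := by fun_prop
  simpa using this.tendsto p

/-- The pointwise Lipschitz estimate is integrated with Cauchy-Schwarz: the first term pairs two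
`L²` functions, the second pairs one with the constant `1`, by finiteness of the measure. -/
theorem continuous_integral_superpos [IsFiniteMeasure ρ] (h0 : ∀ a, h a 0 = 0)
    (hC : 0 ≤ C) (hR : 0 ≤ R)
    (hh : ∀ a b x y, |h a x - h b y| ≤ C * |a - b| * ‖y‖ + R * ‖x - y‖) :
    Continuous fun p : Lp ℝ 2 ρ × Lp E 2 ρ => ∫ x, h (p.1 x) (p.2 x) ∂ρ := by
  have hcont := continuous_uncurry_of_le hh
  have hint : ∀ p : Lp ℝ 2 ρ × Lp E 2 ρ, Integrable (fun x => h (p.1 x) (p.2 x)) ρ := by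
    intro p
    refine (((Lp.memLp p.2).integrable (by norm_num)).norm.const_mul R).mono' ?_ (.of_forall fun x => ?_)
    · exact hcont.comp_aestronglyMeasurable
        ((Lp.aestronglyMeasurable p.1).prodMk (Lp.aestronglyMeasurable p.2))
    · have := hh (p.1 x) (p.1 x) (p.2 x) 0
      simpa [h0] using this
  refine continuous_iff_continuousAt.2 fun p => ?_
  refine tendsto_iff_dist_tendsto_zero.2 (squeeze_zero (fun _ => dist_nonneg)
    (g := fun p' => C * (‖p'.1 - p.1‖ * ‖p.2‖) + R * (√(∫ _, (1 : ℝ) ∂ρ) * ‖p'.2 - p.2‖)) (fun p' => ?_) ?_)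
  · have i1 := integrable_norm_mul_norm (Lp.memLp (p'.1 - p.1)) (Lp.memLp p.2)
    have i2 : Integrable (fun x => ‖(p'.2 - p.2 : Lp E 2 ρ) x‖) ρ :=
      ((Lp.memLp (p'.2 - p.2)).integrable (by norm_num)).norm
    have b1 := integral_norm_mul_norm_le' (Lp.memLp (p'.1 - p.1)) (Lp.memLp p.2)
    have b2 := integral_norm_mul_norm_le' (memLp_const (1 : ℝ) : MemLp _ 2 ρ) (Lp.memLp (p'.2 - p.2))
    rw [← Lp.norm_eq_sqrt_integral, ← Lp.norm_eq_sqrt_integral] at b1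
    rw [← Lp.norm_eq_sqrt_integral] at b2
    simp only [norm_one, one_mul, one_pow] at b2
    rw [Real.dist_eq, ← integral_sub (hint p') (hint p)]
    calc |∫ x, (h (p'.1 x) (p'.2 x) - h (p.1 x) (p.2 x)) ∂ρ|
        ≤ ∫ x, |h (p'.1 x) (p'.2 x) - h (p.1 x) (p.2 x)| ∂ρ := abs_integral_le_integral_abs
      _ ≤ ∫ x, (C * (‖(p'.1 - p.1 : Lp ℝ 2 ρ) x‖ * ‖p.2 x‖) + R * ‖(p'.2 - p.2 : Lp E 2 ρ) x‖) ∂ρ := by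
          refine integral_mono_ae ((hint p').sub (hint p)).abs ((i1.const_mul C).add (i2.const_mul R)) ?_
          filter_upwards [Lp.coeFn_sub p'.1 p.1, Lp.coeFn_sub p'.2 p.2] with x h1 h2
          rw [h1, h2, Pi.sub_apply, Pi.sub_apply, Real.norm_eq_abs, ← mul_assoc]
          exact hh _ _ _ _
      _ ≤ _ := by
          rw [integral_add (i1.const_mul C) (i2.const_mul R), integral_const_mul, integral_const_mul]
          exact add_le_add (mul_le_mul_of_nonneg_left b1 hC) (mul_le_mul_of_nonneg_left b2 hR)
  · have : Continuous fun p' : Lp ℝ 2 ρ × Lp E 2 ρ =>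
        C * (‖p'.1 - p.1‖ * ‖p.2‖) + R * (√(∫ _, (1 : ℝ) ∂ρ) * ‖p'.2 - p.2‖) := by fun_prop
    simpa using this.tendsto p

-- On the closed cone `ζ ≤ 0` the functional is continuous, and off the cone it is `+∞`; it is thus
-- a measurable case distinction.
open Classical in
theorem measurable_lintegral_unidirectional [IsFiniteMeasure ρ] [MeasurableSpace (Lp ℝ 2 ρ)]
    [BorelSpace (Lp ℝ 2 ρ)] {κ : ℝ} (hκ : 0 ≤ κ) :
    Measurable fun ζ : Lp ℝ 2 ρ => ∫⁻ x, (if ζ x ≤ 0 then ENNReal.ofReal (-κ * ζ x) else ⊤) ∂ρ := by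
  have hcont : Continuous fun ζ : Lp ℝ 2 ρ => ∫ x, ζ x * 1 ∂ρ :=
    continuous_integral_mul (ContinuousLinearMap.id ℝ ℝ) (memLp_const 1)
  have hcl : IsClosed {ζ : Lp ℝ 2 ρ | ζ ≤ 0} := isClosed_le continuous_id continuous_const
  have heq : (fun ζ : Lp ℝ 2 ρ => ∫⁻ x, (if ζ x ≤ 0 then ENNReal.ofReal (-κ * ζ x) else ⊤) ∂ρ) =
      fun ζ : Lp ℝ 2 ρ => if ζ ≤ 0 then ENNReal.ofReal (-κ * ∫ x, ζ x * 1 ∂ρ) else ⊤ := by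
    funext ζ
    split_ifs with hζ
    · have hae : ∀ᵐ x ∂ρ, ζ x ≤ 0 := by
        filter_upwards [(Lp.coeFn_le ζ 0).2 hζ, Lp.coeFn_zero ℝ 2 ρ] with x h1 h2
        exact h1.trans_eq h2
      simp only [mul_one]
      rw [← integral_const_mul, ofReal_integral_eq_lintegral_ofReal]
      · refine lintegral_congr_ae ?_
        filter_upwards [hae] with x hx
        rw [if_pos hx]
      · exact ((Lp.memLp ζ).integrable (by norm_num)).const_mul _
      · filter_upwards [hae] with x hx
        exact mul_nonneg_of_nonpos_of_nonpos (neg_nonpos.2 hκ) hx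
    · refine lintegral_eq_top_of_measure_eq_top_ne_zero ?_ fun h0 => hζ ?_
      · refine Measurable.comp_aemeasurable (g := fun s : ℝ => if s ≤ 0 then ENNReal.ofReal (-κ * s) else ⊤)
          ?_ (Lp.aestronglyMeasurable ζ).aemeasurable
        exact Measurable.ite measurableSet_Iic (by fun_prop) measurable_const
      · refine (Lp.coeFn_le ζ 0).1 ?_
        filter_upwards [measure_eq_zero_iff_ae_notMem.1 h0, Lp.coeFn_zero ℝ 2 ρ] with x h1 h2
        rw [h2]
        by_contra h3
        exact h1 (if_neg h3)
  rw [heq]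
  exact Measurable.ite hcl.measurableSet
    (ENNReal.measurable_ofReal.comp (hcont.measurable.const_mul _)) measurable_const

end SuperposIntegral

/-! ### Measurability of the contact potential along curves -/

/-- The sets `K a` are controlled only for `a ≥ 0`; truncating with `max a 0` gives an estimate on
the whole line, and the truncation is inactive along the curve. -/
theorem abs_sSup_inner_sub_le {E : Type*} [NormedAddCommGroup E] [InnerProductSpace ℝ E] {K : ℝ → Set E}
    {R C : ℝ} (h0 : ∀ a, 0 ≤ a → (K a).Nonempty) (hR : ∀ a, 0 ≤ a → K a ⊆ Metric.ball 0 R)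
    (hC : 0 ≤ C)
    (hK : ∀ a ∈ Ici (0 : ℝ), ∀ b ∈ Ici (0 : ℝ), Metric.hausdorffDist (K a) (K b) ≤ C * |a - b|)
    (a b : ℝ) (x y : E) :
    |sSup ((fun σ => inner ℝ σ x) '' K (max a 0)) - sSup ((fun σ => inner ℝ σ y) '' K (max b 0))| ≤
      C * |a - b| * ‖y‖ + R * ‖x - y‖ := by
  have ha : 0 ≤ max a 0 := le_max_right _ _
  have hb : 0 ≤ max b 0 := le_max_right _ _
  have hab : C * |max a 0 - max b 0| ≤ C * |a - b| :=
    mul_le_mul_of_nonneg_left (abs_max_sub_max_le_abs a b 0) hC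
  have hd1 := (hK _ ha _ hb).trans hab
  have hd2 : Metric.hausdorffDist (K (max b 0)) (K (max a 0)) ≤ C * |a - b| := by
    rwa [Metric.hausdorffDist_comm]
  have hd0 : Metric.hausdorffDist (K (max a 0)) (K (max a 0)) ≤ 0 :=
    Metric.hausdorffDist_self_zero.le
  have e1 := sSup_inner_le (h0 _ ha) (h0 _ ha) (hR _ ha) (hR _ ha) hd0 x y
  have e2 := sSup_inner_le (h0 _ ha) (h0 _ hb) (hR _ ha) (hR _ hb) hd1 y y
  have e3 := sSup_inner_le (h0 _ hb) (h0 _ ha) (hR _ hb) (hR _ ha) hd2 y x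
  rw [sub_self, norm_zero, mul_zero, add_zero] at e2
  rw [norm_sub_rev y x] at e3
  rw [abs_sub_le_iff]
  constructor <;> linarith

open Classical in
theorem aemeasurable_contact {ρ : Measure ℝ} {t' : ℝ → ℝ} (ht : Measurable t') {g D x r h : ℝ → ℝ≥0∞}
    (hg : AEMeasurable g ρ) (hD : AEMeasurable D ρ) (hx : AEMeasurable x ρ) (hr : AEMeasurable r ρ)
    (hh : AEMeasurable h ρ) :
    AEMeasurable (fun τ => r τ + h τ +
      if 0 < t' τ then g τ else if D τ = ⊤ then ⊤ else x τ * D τ) ρ := by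
  refine (hr.add hh).add ?_
  have hF : Measurable fun p : ℝ × ℝ≥0∞ × ℝ≥0∞ × ℝ≥0∞ =>
      if 0 < p.1 then p.2.1 else if p.2.2.1 = ⊤ then ⊤ else p.2.2.2 * p.2.2.1 := by
    refine Measurable.ite (measurableSet_lt measurable_const measurable_fst) (by fun_prop)
      (Measurable.ite (measurableSet_eq_fun (by fun_prop) measurable_const) measurable_const
        (by fun_prop))
  exact hF.comp_aemeasurable (ht.aemeasurable.prodMk (hg.prodMk (hD.prodMk hx)))

theorem tendsto_apply_of_continuousOn {V W : Type*} [AddCommGroup V] [Module ℝ V]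
    [TopologicalSpace V] [ContinuousSMul ℝ V] [AddCommMonoid W] [Module ℝ W] [TopologicalSpace W]
    {ξ : ℝ → StrongDual ℝ V} {s : Set ℝ} (h : ContinuousOn ξ s) (L : W →L[ℝ] V) {x : ℝ} (hx : x ∈ s)
    {l : Ultrafilter ℝ} (hl : (l : Filter ℝ) ≤ 𝓝[s] x) (v : W) :
    Tendsto (fun τ => (-(ξ τ (L v)) : ℝ)) l (𝓝 (-(ξ x (L v)))) :=
  ((((continuous_eval_const (F := StrongDual ℝ V) (L v)).tendsto _).comp (h x hx)).neg).mono_left hl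

theorem measurable_quadratic_form {V Y : Type*} [AddCommMonoid V] [Module ℝ V] [TopologicalSpace V]
    [NormedAddCommGroup Y] [InnerProductSpace ℝ Y] {A B : V →L[ℝ] Y} {N : V → ℝ}
    (h : ∀ u, N u = inner ℝ (A u) (B u)) {f : ℝ → V} (hf : StronglyMeasurable f) :
    Measurable fun τ => N (f τ) := by
  simp only [h]
  exact ((A.continuous.comp_stronglyMeasurable hf).inner
    (B.continuous.comp_stronglyMeasurable hf) (𝕜 := ℝ)).measurable

namespace Model

variable {n : ℕ} {P : Model n}

/-- On nonnegative damage variables, the plastic dissipation potential is a continuous function. -/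
theorem Standing.exists_continuous_calH (hP : P.Standing) :
    ∃ G : Lp ℝ 2 P.vol × Lp (DevMat n) 2 P.vol → ℝ, Continuous G ∧
      ∀ (z : Hm P.Ω P.m) (π : Lp (DevMat n) 2 P.vol), (∀ᵐ x ∂P.vol, 0 ≤ damageFn z x) →
        P.calH z π = G (damageFn z, π) := by
  have := hP.isFiniteMeasure
  obtain ⟨r, R, hr, hrR, hK⟩ := hP.K_mono
  obtain ⟨C, hC, hL⟩ := hP.K_lipschitz
  have hh := abs_sSup_inner_sub_le (K := P.K) (R := R) (C := C)
    (fun a ha => ⟨0, (hK a a ha le_rfl).1 (Metric.mem_ball_self hr)⟩)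
    (fun a ha => (hK a a ha le_rfl).2.2) hC.le hL
  refine ⟨_, continuous_integral_superpos (ρ := P.vol) (h := fun a x => P.H (max a 0) x)
    (fun a => H_zero_right _) hC.le (hr.trans hrR).le hh, fun z π hz => integral_congr_ae ?_⟩
  filter_upwards [hz] with x hx
  rw [max_eq_left hx]

/-! ### Semicontinuity and measurability along a given curve. -/

section Curve

variable {S : ℝ} {t : ℝ → ℝ} {q : ℝ → P.State} 

theorem tendsto_DuE (hD : ContinuousOn (fun s => P.DqE (t s) (q s)) (Icc 0 S)) {x : ℝ}
    (hx : x ∈ Icc 0 S) {l : Ultrafilter ℝ} (hl : (l : Filter ℝ) ≤ 𝓝[Icc 0 S] x)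
    (v : H1Dir P.Ω P.ΓD) :
    Tendsto (fun τ => (-P.DuE (t τ) (q τ)) v) l (𝓝 ((-P.DuE (t x) (q x)) v)) :=
  tendsto_apply_of_continuousOn hD (ContinuousLinearMap.inl ℝ _ _) hx hl v

theorem tendsto_DzE (hD : ContinuousOn (fun s => P.DqE (t s) (q s)) (Icc 0 S)) {x : ℝ}
    (hx : x ∈ Icc 0 S) {l : Ultrafilter ℝ} (hl : (l : Filter ℝ) ≤ 𝓝[Icc 0 S] x) (v : Hm P.Ω P.m) :
    Tendsto (fun τ => (-P.DzE (t τ) (q τ)) v) l (𝓝 ((-P.DzE (t x) (q x)) v)) :=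
  tendsto_apply_of_continuousOn hD
    ((ContinuousLinearMap.inr ℝ _ _).comp (ContinuousLinearMap.inl ℝ _ _)) hx hl v

theorem tendsto_DpE (hD : ContinuousOn (fun s => P.DqE (t s) (q s)) (Icc 0 S)) {x : ℝ}
    (hx : x ∈ Icc 0 S) {l : Ultrafilter ℝ} (hl : (l : Filter ℝ) ≤ 𝓝[Icc 0 S] x)
    (v : Lp (DevMat n) 2 P.vol) :
    Tendsto (fun τ => (-P.DpE (t τ) (q τ)) v) l (𝓝 ((-P.DpE (t x) (q x)) v)) :=
  tendsto_apply_of_continuousOn hD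
    ((ContinuousLinearMap.inr ℝ _ _).comp (ContinuousLinearMap.inr ℝ _ _)) hx hl v

theorem ae_nonneg_of_mem_domain {q : P.State} (hq : q ∈ P.domain) :
    ∀ᵐ x ∂P.vol, 0 ≤ damageFn q.2.1 x :=
  hq.elim fun _ h => h.2.mono fun _ hx => h.1.le.trans hx

theorem Standing.tendsto_calH (hP : P.Standing) (hq : ContinuousOn q (Icc 0 S))
    (hdom : ∀ s ∈ Icc 0 S, q s ∈ P.domain) {x : ℝ} (hx : x ∈ Icc 0 S) {l : Ultrafilter ℝ}
    (hl : (l : Filter ℝ) ≤ 𝓝[Icc 0 S] x) (π : Lp (DevMat n) 2 P.vol) :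
    Tendsto (fun τ => P.calH (q τ).2.1 π) l (𝓝 (P.calH (q x).2.1 π)) := by
  obtain ⟨G, hG, hGe⟩ := hP.exists_continuous_calH
  have h1 : Tendsto (fun τ => damageL P.Ω P.m (q τ).2.1) l (𝓝 (damageL P.Ω P.m (q x).2.1)) :=
    ((((damageL P.Ω P.m).continuous.comp (continuous_fst.comp continuous_snd)).tendsto _).comp
      (hq x hx)).mono_left hl
  have h2 := (hG.tendsto _).comp (h1.prodMk_nhds (tendsto_const_nhds (x := π)))
  have h3 := hGe (q x).2.1 π (ae_nonneg_of_mem_domain (hdom x hx))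
  refine (h2.congr' ?_).trans (le_of_eq (congrArg 𝓝 h3.symm))
  have hmem : ∀ᶠ τ in (l : Filter ℝ), τ ∈ Icc 0 S := hl self_mem_nhdsWithin
  exact hmem.mono fun τ hτ => (hGe (q τ).2.1 π (ae_nonneg_of_mem_domain (hdom τ hτ))).symm

theorem aemeasurable_dualNormD (hD : ContinuousOn (fun s => P.DqE (t s) (q s)) (Icc 0 S)) :
    AEMeasurable (fun τ => P.dualNormD (-P.DuE (t τ) (q τ))) (volume.restrict (Icc 0 S)) :=
  aemeasurable_of_le_of_ultrafilter isClosed_Icc fun _ hx _ hl _ _ h =>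
    iSup_dual_le_of_tendsto (tendsto_DuE hD hx hl) h

theorem aemeasurable_distR (hD : ContinuousOn (fun s => P.DqE (t s) (q s)) (Icc 0 S)) :
    AEMeasurable (fun τ => P.distR (-P.DzE (t τ) (q τ))) (volume.restrict (Icc 0 S)) := by
  refine aemeasurable_of_le_of_ultrafilter isClosed_Icc fun x hx l hl d _ h => ?_
  refine (distR_eq _).trans_le (iInf_enorm_le_of_tendsto (damageL P.Ω P.m) (fun γ => mem_subR0) l
    (tendsto_DzE hD hx hl) (h.mono fun τ hτ => (distR_eq _).symm.trans_le hτ))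

theorem Standing.aemeasurable_distH (hP : P.Standing)
    (hD : ContinuousOn (fun s => P.DqE (t s) (q s)) (Icc 0 S)) (hq : ContinuousOn q (Icc 0 S))
    (hdom : ∀ s ∈ Icc 0 S, q s ∈ P.domain) :
    AEMeasurable (fun τ => P.distH (q τ).2.1 (-P.DpE (t τ) (q τ))) (volume.restrict (Icc 0 S)) :=
  aemeasurable_of_le_of_ultrafilter isClosed_Icc fun _ hx l hl _ _ h =>
    infEDist_le_of_tendsto (fun _ _ hγ => mem_subH0.1 hγ) (fun _ => mem_subH0.2) l
      (hP.tendsto_calH hq hdom hx hl) (tendsto_DpE hD hx hl) h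

theorem Standing.aemeasurable_DnuStar (hP : P.Standing)
    (hD : ContinuousOn (fun s => P.DqE (t s) (q s)) (Icc 0 S)) (hq : ContinuousOn q (Icc 0 S))
    (hdom : ∀ s ∈ Icc 0 S, q s ∈ P.domain) :
    AEMeasurable (fun τ => P.DnuStar (t τ) (q τ)) (volume.restrict (Icc 0 S)) :=
  (((((aemeasurable_dualNormD hD).pow_const 2).const_mul _).add
    ((aemeasurable_distR hD).pow_const 2)).add
    (((hP.aemeasurable_distH hD hq hdom).pow_const 2).const_mul _)).pow_const _

-- The states in equilibrium form a closed set along the curve, since `-D_u E = 0` and both families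
-- of subgradient inequalities are stable under limits. Hence the function with values `0` and `⊤`
-- is lower semicontinuous.
open Classical in
theorem Standing.aemeasurable_equilibrium (hP : P.Standing)
    (hD : ContinuousOn (fun s => P.DqE (t s) (q s)) (Icc 0 S)) (hq : ContinuousOn q (Icc 0 S))
    (hdom : ∀ s ∈ Icc 0 S, q s ∈ P.domain) :
    AEMeasurable (fun τ => if -P.DuE (t τ) (q τ) = 0 ∧ -P.DzE (t τ) (q τ) ∈ P.subR0 ∧
      -P.DpE (t τ) (q τ) ∈ P.subH0 (q τ).2.1 then (0 : ℝ≥0∞) else ⊤) (volume.restrict (Icc 0 S)) := by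
  refine aemeasurable_of_le_of_ultrafilter isClosed_Icc fun x hx l hl d hd h => ?_
  have hev : ∀ᶠ τ in (l : Filter ℝ), -P.DuE (t τ) (q τ) = 0 ∧ -P.DzE (t τ) (q τ) ∈ P.subR0 ∧
      -P.DpE (t τ) (q τ) ∈ P.subH0 (q τ).2.1 := by
    filter_upwards [h] with τ hτ
    by_contra hne
    exact hd (top_le_iff.1 ((if_neg hne).symm.trans_le hτ))
  refine (if_pos ⟨?_, ?_, ?_⟩).trans_le zero_le
  · refine ContinuousLinearMap.ext fun v => tendsto_nhds_unique (tendsto_DuE hD hx hl v) ?_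
    exact tendsto_const_nhds.congr' (hev.mono fun τ hτ => (DFunLike.congr_fun hτ.1 v).symm)
  · refine mem_subR0.2 fun ζ => le_of_tendsto
      ((continuous_coe_real_ereal.tendsto _).comp (tendsto_DzE hD hx hl ζ)) ?_
    exact hev.mono fun τ hτ => mem_subR0.1 hτ.2.1 ζ
  · refine mem_subH0.2 fun π => le_of_tendsto_of_tendsto (tendsto_DpE hD hx hl π)
      (hP.tendsto_calH hq hdom hx hl π) ?_
    exact hev.mono fun τ hτ => mem_subH0.1 hτ.2.2 π

theorem Standing.stronglyMeasurable_deriv (hP : P.Standing) (q : ℝ → P.State) :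
    StronglyMeasurable (deriv q) := by
  have := hP.completeSpace_Hm
  exact _root_.stronglyMeasurable_deriv q

theorem Standing.measurable_calR_deriv (hP : P.Standing) (q : ℝ → P.State) :
    Measurable fun τ => P.calR (deriv q τ).2.1 := by
  have := hP.isFiniteMeasure
  have h1 : StronglyMeasurable fun τ => damageL P.Ω P.m (deriv q τ).2.1 :=
    ((damageL P.Ω P.m).continuous.comp (continuous_fst.comp continuous_snd)).comp_stronglyMeasurable
      (hP.stronglyMeasurable_deriv q)
  borelize ↥(Lp ℝ 2 P.vol)
  exact (measurable_lintegral_unidirectional hP.κ_nonneg).comp h1.measurable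

theorem Standing.aemeasurable_calH_deriv (hP : P.Standing) (hq : ContinuousOn q (Icc 0 S))
    (hdom : ∀ s ∈ Icc 0 S, q s ∈ P.domain) :
    AEMeasurable (fun τ => P.calH (q τ).2.1 (deriv q τ).2.2) (volume.restrict (Icc 0 S)) := by
  obtain ⟨G, hG, hGe⟩ := hP.exists_continuous_calH
  have h1 : ContinuousOn (fun τ => damageL P.Ω P.m (q τ).2.1) (Icc 0 S) :=
    ((damageL P.Ω P.m).continuous.comp (continuous_fst.comp continuous_snd)).comp_continuousOn hq
  have h2 : StronglyMeasurable fun τ => (deriv q τ).2.2 :=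
    (continuous_snd.comp continuous_snd).comp_stronglyMeasurable (hP.stronglyMeasurable_deriv q)
  have h3 := hG.comp_aestronglyMeasurable (μ := volume.restrict (Icc 0 S))
    ((h1.aestronglyMeasurable measurableSet_Icc).prodMk h2.aestronglyMeasurable)
  refine h3.aemeasurable.congr ?_
  filter_upwards [ae_restrict_mem measurableSet_Icc] with τ hτ
  exact (hGe (q τ).2.1 (deriv q τ).2.2 (ae_nonneg_of_mem_domain (hdom τ hτ))).symm

theorem Standing.measurable_Dnu_deriv (hP : P.Standing) (q : ℝ → P.State) :
    Measurable fun τ => P.Dnu (deriv q τ) := by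
  have hq := hP.stronglyMeasurable_deriv q
  have h3 : Measurable fun τ => P.normDsq (deriv q τ).1 :=
    hP.exists_viscosity_form.elim fun A h => h.elim fun B h =>
      measurable_quadratic_form h (continuous_fst.comp_stronglyMeasurable hq)
  have h4 : Measurable fun τ => ‖damageL P.Ω P.m (deriv q τ).2.1‖ :=
    (((damageL P.Ω P.m).continuous.comp
      (continuous_fst.comp continuous_snd)).norm.comp_stronglyMeasurable hq).measurable
  have h5 : Measurable fun τ => ‖(deriv q τ).2.2‖ :=
    ((continuous_snd.comp continuous_snd).norm.comp_stronglyMeasurable hq).measurable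
  exact (((h3.const_mul P.ν).add (h4.pow_const 2)).add ((h5.pow_const 2).const_mul P.ν)).sqrt

theorem Standing.aemeasurable_M (hP : P.Standing)
    (hD : ContinuousOn (fun s => P.DqE (t s) (q s)) (Icc 0 S)) (hq : ContinuousOn q (Icc 0 S))
    (hdom : ∀ s ∈ Icc 0 S, q s ∈ P.domain) :
    AEMeasurable (fun τ => P.M (t τ) (q τ) (deriv t τ) (deriv q τ)) (volume.restrict (Icc 0 S)) := by
  classical
  have h := aemeasurable_contact (measurable_deriv t) (hP.aemeasurable_equilibrium hD hq hdom)
    (hP.aemeasurable_DnuStar hD hq hdom) (hP.measurable_Dnu_deriv q).ennreal_ofReal.aemeasurable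
    (hP.measurable_calR_deriv q).aemeasurable (hP.aemeasurable_calH_deriv hq hdom).ennreal_ofReal
  refine h.congr (.of_forall fun τ => ?_)
  refine congrArg (P.calR (deriv q τ).2.1 + ENNReal.ofReal (P.calH (q τ).2.1 (deriv q τ).2.2) + ·) ?_
  exact if_congr Iff.rfl (if_congr Iff.rfl rfl rfl) (if_congr Iff.rfl rfl rfl)

end Curve

end Model

/-! ### Equivalence of balance, upper estimate and contact condition -/

/-- The bound makes `M` finite almost everywhere. Then `M - g` is nonnegative with nonpositive
integral, hence zero almost everywhere. -/
theorem ae_eq_of_lintegral_le {X : Type*} [MeasurableSpace X] {ρ : Measure X} {M : X → ℝ≥0∞} {g : X → ℝ}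
    (hM : AEMeasurable M ρ) (hg : Integrable g ρ) (hle : ∀ x, ENNReal.ofReal (g x) ≤ M x)
    (h : ((∫⁻ x, M x ∂ρ : ℝ≥0∞) : EReal) ≤ ((∫ x, g x ∂ρ : ℝ) : EReal)) :
    ∀ᵐ x ∂ρ, ((M x : ℝ≥0∞) : EReal) = ((g x : ℝ) : EReal) := by
  have hfin : ∫⁻ x, M x ∂ρ ≠ ⊤ := fun h0 => by
    rw [h0, EReal.coe_ennreal_top, top_le_iff] at h
    exact EReal.coe_ne_top _ h
  have hae := ae_lt_top' hM hfin
  have hI : Integrable (fun x => (M x).toReal) ρ := integrable_toReal_of_lintegral_ne_top hM hfin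
  have hcoe : ∀ {a : ℝ≥0∞}, a ≠ ⊤ → ((a : ℝ≥0∞) : EReal) = ((a.toReal : ℝ) : EReal) := fun ha => by
    conv_lhs => rw [← ENNReal.ofReal_toReal ha]
    rw [EReal.coe_ennreal_ofReal, max_eq_left ENNReal.toReal_nonneg]
  have hgM : ∀ᵐ x ∂ρ, 0 ≤ (M x).toReal - g x := by
    filter_upwards [hae] with x hx
    exact sub_nonneg.2 ((ENNReal.ofReal_le_iff_le_toReal hx.ne).1 (hle x))
  have h1 : ∫ x, ((M x).toReal - g x) ∂ρ = 0 := by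
    refine le_antisymm ?_ (integral_nonneg_of_ae hgM)
    rw [integral_sub hI hg, integral_toReal hM hae, sub_nonpos]
    rw [hcoe hfin, EReal.coe_le_coe_iff] at h
    exact h
  have h2 := (integral_eq_zero_iff_of_nonneg_ae hgM (hI.sub hg)).1 h1
  filter_upwards [h2, hae] with x hx hx'
  rw [hcoe hx'.ne, sub_eq_zero.1 hx]

/-- The equality itself yields `g ≥ 0` almost everywhere, which allows the two kinds of integral to
be compared. -/
theorem coe_lintegral_eq_of_ae_eq {X : Type*} [MeasurableSpace X] {ρ : Measure X} {M : X → ℝ≥0∞}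
    {g : X → ℝ} (hg : Integrable g ρ) (h : ∀ᵐ x ∂ρ, ((M x : ℝ≥0∞) : EReal) = ((g x : ℝ) : EReal)) :
    ((∫⁻ x, M x ∂ρ : ℝ≥0∞) : EReal) = ((∫ x, g x ∂ρ : ℝ) : EReal) := by
  have h0 : ∀ᵐ x ∂ρ, 0 ≤ g x := by
    filter_upwards [h] with x hx
    rw [← EReal.coe_nonneg, ← hx]
    exact EReal.coe_ennreal_nonneg _
  have h1 : ∫⁻ x, M x ∂ρ = ENNReal.ofReal (∫ x, g x ∂ρ) := by
    rw [ofReal_integral_eq_lintegral_ofReal hg h0]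
    refine lintegral_congr_ae ?_
    filter_upwards [h, h0] with x hx hx0
    rw [← EReal.coe_ennreal_eq_coe_ennreal_iff, hx, EReal.coe_ennreal_ofReal, max_eq_left hx0]
  rw [h1, EReal.coe_ennreal_ofReal, max_eq_left (integral_nonneg_of_ae h0)]

theorem tfae_energy_balance {S : ℝ} (hS : 0 < S) {en : ℝ → EReal} {e g pw : ℝ → ℝ} {M : ℝ → ℝ≥0∞}
    (hen : ∀ s ∈ Icc 0 S, en s = ((e s : ℝ) : EReal)) (hg : IntervalIntegrable g volume 0 S)
    (hpw : IntervalIntegrable pw volume 0 S)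
    (he : ∀ s ∈ Icc 0 S, e s = e 0 + (∫ τ in (0 : ℝ)..s, pw τ) + ∫ τ in (0 : ℝ)..s, g τ)
    (hM : AEMeasurable M (volume.restrict (Icc 0 S))) (hle : ∀ τ, ENNReal.ofReal (-g τ) ≤ M τ) :
    List.TFAE [∀ s ∈ Icc 0 S, IntervalIntegrable pw volume 0 s ∧
        en s + ((∫⁻ τ in Ioc 0 s, M τ : ℝ≥0∞) : EReal) =
          en 0 + ((∫ τ in (0 : ℝ)..s, pw τ : ℝ) : EReal),
      IntervalIntegrable pw volume 0 S ∧ en S + ((∫⁻ τ in Ioc 0 S, M τ : ℝ≥0∞) : EReal) ≤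
          en 0 + ((∫ τ in (0 : ℝ)..S, pw τ : ℝ) : EReal),
      ∀ᵐ s ∂(volume.restrict (Ioo 0 S)), ((M s : ℝ≥0∞) : EReal) = ((-g s : ℝ) : EReal)] := by
  have h0 : (0 : ℝ) ∈ Icc 0 S := left_mem_Icc.2 hS.le
  have hSS : S ∈ Icc 0 S := right_mem_Icc.2 hS.le
  have hsub : ∀ s ∈ Icc 0 S, uIcc 0 s ⊆ uIcc 0 S := fun s hs => by
    rw [uIcc_of_le hs.1, uIcc_of_le hS.le]
    exact Icc_subset_Icc_right hs.2
  have hint : ∀ s ∈ Icc 0 S, Integrable (fun τ => -g τ) (volume.restrict (Ioc 0 s)) := fun s hs =>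
    ((intervalIntegrable_iff_integrableOn_Ioc_of_le hs.1).1 (hg.mono_set (hsub s hs))).neg
  have hng : ∀ s ∈ Icc 0 S, ∫ τ in Ioc 0 s, -g τ = -∫ τ in (0 : ℝ)..s, g τ := fun s hs => by
    rw [integral_neg, intervalIntegral.integral_of_le hs.1]
  tfae_have 1 → 2 := fun h => ⟨(h S hSS).1, (h S hSS).2.le⟩
  tfae_have 2 → 3 := by
    rintro ⟨-, h⟩
    have h1 : ((∫⁻ τ in Ioc 0 S, M τ : ℝ≥0∞) : EReal) ≤ ((∫ τ in Ioc 0 S, -g τ : ℝ) : EReal) := by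
      rw [hen S hSS, hen 0 h0] at h
      rw [hng S hSS]
      -- The dissipation could be infinite a priori; the estimate between real energies excludes it.
      generalize (∫⁻ τ in Ioc 0 S, M τ : ℝ≥0∞) = D at h ⊢
      induction D using ENNReal.recTopCoe with
      | top =>
        rw [EReal.coe_ennreal_top, EReal.coe_add_top, ← EReal.coe_add, top_le_iff] at h
        exact absurd h (EReal.coe_ne_top _)
      | coe D =>
        rw [EReal.coe_nnreal_eq_coe_real] at h ⊢
        rw [← EReal.coe_add, ← EReal.coe_add, EReal.coe_le_coe_iff, he S hSS] at h
        rw [EReal.coe_le_coe_iff]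
        linarith
    rw [← restrict_Ioo_eq_restrict_Ioc] at h1
    have hi := hint S hSS
    rw [← restrict_Ioo_eq_restrict_Ioc] at hi
    exact ae_eq_of_lintegral_le (hM.mono_set Ioo_subset_Icc_self) hi hle h1
  -- The contact condition is local in `s`, so it can be integrated over each `[0,s]`; this upgrades
  -- the estimate at the final point to the balance at every point.
  tfae_have 3 → 1 := fun h s hs => by
    refine ⟨hpw.mono_set (hsub s hs), ?_⟩
    rw [restrict_Ioo_eq_restrict_Ioc] at h
    have h1 := coe_lintegral_eq_of_ae_eq (hint s hs)
      (ae_restrict_of_ae_restrict_of_subset (Ioc_subset_Ioc_right hs.2) h)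
    rw [h1, hng s hs, hen s hs, hen 0 h0, ← EReal.coe_add, ← EReal.coe_add, EReal.coe_eq_coe_iff, he s hs]
    ring
  tfae_finish

end PlasticDamage

end

/-! ### Equivalence of the three notions for the model. -/

theorem proposition6 {n : ℕ} (P : PlasticDamage.Model n) (hP : P.Standing)
    (S : ℝ) (hS : 0 < S) (t : ℝ → ℝ) (q : ℝ → P.State) (hcurve : P.IsCurve S t q)
    (hdom : ∀ s ∈ Set.Icc 0 S, q s ∈ P.domain) :
    List.TFAE [P.IsBVSolution S t q, P.UpperEstimate S t q, P.ContactCondition S t q] := by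
  obtain ⟨hD, hI, hPow, hE⟩ := hP.energy_chain_rule hS hcurve hdom
  have hq : ContinuousOn q (Set.Icc 0 S) :=
    Set.uIcc_of_le hS.le ▸ hcurve.ac_q.continuousOn
  have hen : ∀ s ∈ Set.Icc 0 S,
      P.energy (t s) (q s) = (((P.energy (t s) (q s)).toReal : ℝ) : EReal) := fun s hs => by
    rw [hP.energy_eq (hdom s hs), EReal.toReal_coe]
  have h := PlasticDamage.tfae_energy_balance hS hen hI hPow hE (hP.aemeasurable_M hD hq hdom)
    fun τ => hP.ofReal_le_M (t τ) (q τ) (deriv t τ) (deriv q τ)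
  tfae_have 1 ↔ 2 := ⟨fun h1 => (h.out 0 1).1 h1.balance, fun h2 => ⟨hcurve, (h.out 0 1).2 h2⟩⟩
  tfae_have 2 ↔ 3 := h.out 1 2
  tfae_finish
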